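/- **Theorem 4.5** (intensity of zeros of $K_m$ on the unit circle). Let $\alpha\in\mathbb R$ and let $\ell$ be slowly varying at $+\infty$, i.e. $\ell:(0,\infty)\to\mathbb R$ is measurable, eventually positive, and $\ell(cx)/\ell(x)\to1$ as $x\to+\infty$ for every $c>0$. Put $b(x)=x^{\alpha}\ell(x)$ for $x>0$ and $S(-1)=\sum_{k\ge1}k^{-1}\ell^2(k)\in[0,\infty]$. Let $(\xi_k)_{k\ge 0}$ be i.i.d. centered isotropic complex Gaussian random variables with variance $\mathbb E|\xi_k|^2=\sigma^2>0$, and for $m\in\mathbb N$ let $$K_m(z)=1+\sum_{k=1}^m b(k)\xi_kz^k+\sum_{k=1}^m b(k)\overline{\xi_k}\,z^{2m-k+1}+z^{2m+1}.$$ Let $N_m(x)$ be the number of zeros of $K_m$, counted with multiplicity, on the arc $A(x)=\{e^{i\theta}:0\le\theta\le x\}$ of the unit circle, $0\le x\le2\pi$. Then $N_m(x)$ is integrable and, whenever $b(1),\dots,b(m)$ are not all zero (in particular for all large $m$), $\phi\mapsto\mathbb E[N_m(\phi)]$ is differentiable on $[0,2\pi]$ (one-sidedly at the end points); denote its derivative,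 the density of zeros on the circle, by $p_m(\phi)$. (i) If $\alpha>-\tfrac12$, or $\alpha=-\tfrac12$ and $S(-1)=\infty$, then $$\lim_{m\to\infty}\frac{p_m(\phi)}{2m+1}=\frac1{2\pi}\,\frac1{\sqrt{(1+\alpha)(3+2\alpha)}}\qquad\text{for every }\phi\in[0,2\pi].$$ (ii) If $\alpha<-\tfrac12$, or $\alpha=-\tfrac12$ and $S(-1)<\infty$, then for every $\phi\in[0,2\pi]\setminus\{0,\tfrac\pi2,\pi,\tfrac{3\pi}2,2\pi\}$ the sequence $p_m(\phi)/(2m+1)$ has no limit in $[-\infty,\infty]$ as $m\to\infty$, but $$\lim_{m\to\infty}\frac{\mathbb E[N_m(x)]}{2m+1}=\frac x{2\pi},\qquad 0\le x\le2\pi.$$ That is, the expected normalized counting measure of the zeros on the unit circle converges weakly to the uniform measure on $[0,2\pi]$: for every continuous $f:[0,2\pi]\to\mathbb R$, $$\lim_{m\to\infty}\frac1{2m+1}\,\mathbb E\Big[\sum_{z:\,K_m(z)=0,\ |z|=1}f(\arg z)\Big]=\frac1{2\pi}\int_0^{2\pi}f(\theta)\,d\theta,$$ where zeros are repeated according to multiplicity,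 $\arg z\in[0,2\pi)$, and the random sums are integrable for every $m$. -/

import Mathlib

open Filter Topology MeasureTheory ProbabilityTheory
open scoped NNReal ENNReal

noncomputable section

/-- `ℓ` is slowly varying at `+∞`: it is measurable on `(0, ∞)`, eventually positive, and
`ℓ(c x) / ℓ(x) → 1` as `x → +∞`, for every `c > 0`. -/
structure IsSlowlyVarying (ℓ : ℝ → ℝ) : Prop where
  measurable : Measurable fun x : Set.Ioi (0 : ℝ) => ℓ x
  eventually_pos : ∀ᶠ x in atTop, 0 < ℓ x
  tendsto_div : ∀ c : ℝ, 0 < c → Tendsto (fun x => ℓ (c * x) / ℓ x) atTop (𝓝 1)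

/-- `S(γ; ℓ) = ∑_{k ≥ 1} k ^ γ ℓ(k) ^ 2`, a number in `[0, ∞]`. -/
def slowSum (γ : ℝ) (ℓ : ℝ → ℝ) : ℝ≥0∞ :=
  ∑' k : ℕ, ENNReal.ofReal (((k + 1 : ℕ) : ℝ) ^ γ * ℓ ((k + 1 : ℕ) : ℝ) ^ 2)

/-- The isotropic (centered) Gaussian distribution on `ℂ` with variance `E|ξ|² = v`: the real and
imaginary parts are independent centered real Gaussians, each with variance `v / 2`. -/
def isotropicGaussian (v : ℝ≥0) : Measure ℂ :=
  ((gaussianReal 0 (v / 2)).prod (gaussianReal 0 (v / 2))).map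
    fun p : ℝ × ℝ => (p.1 : ℂ) + (p.2 : ℂ) * Complex.I

/-- The self-inversive polynomial
`K_m(z) = 1 + ∑_{k=1}^m b(k) ξ_k z^k + ∑_{k=1}^m b(k) conj(ξ_k) z^(2m-k+1) + z^(2m+1)`
with given coefficients. -/
def selfInversivePoly (b : ℝ → ℝ) (ξ : ℕ → ℂ) (m : ℕ) : Polynomial ℂ :=
  1 + ∑ k ∈ Finset.Icc 1 m, Polynomial.C ((b k : ℂ) * ξ k) * Polynomial.X ^ k
    + ∑ k ∈ Finset.Icc 1 m,
        Polynomial.C ((b k : ℂ) * (starRingEnd ℂ) (ξ k)) * Polynomial.X ^ (2 * m - k + 1)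
    + Polynomial.X ^ (2 * m + 1)

/-- The arc `A(x) = {exp(iθ) : 0 ≤ θ ≤ x}` of the unit circle. -/
def unitArc (x : ℝ) : Set ℂ :=
  (fun θ : ℝ => Complex.exp ((θ : ℂ) * Complex.I)) '' Set.Icc 0 x

open Classical in
/-- The number of zeros of `p` in the set `A`, counted with multiplicity. -/
def zeroCount (p : Polynomial ℂ) (A : Set ℂ) : ℕ :=
  p.roots.countP (fun z => z ∈ A)

/-- The argument of `z` in `[0, 2π)`. -/
def angle (z : ℂ) : ℝ := toIcoMod Real.two_pi_pos 0 (Complex.arg z)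

open Classical in
/-- `∑ f(angle z)` over the zeros `z` of `p` on the unit circle, with multiplicity: the integral
of `f` against the counting measure of the angles of these zeros. -/
def circleZeroSum (p : Polynomial ℂ) (f : ℝ → ℝ) : ℝ :=
  ((p.roots.filter (fun z => ‖z‖ = 1)).map (fun z => f (angle z))).sum

/-- `E[Zeros(K_m)(A(x))]`, the expected number of zeros of `K_m` on the arc `A(x)`. -/
def expectedArcCount {Ω : Type*} [MeasurableSpace Ω] (P : Measure Ω) (b : ℝ → ℝ)
    (ξ : ℕ → Ω → ℂ) (m : ℕ) (x : ℝ) : ℝ :=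
  ∫ ω, (zeroCount (selfInversivePoly b (fun k => ξ k ω) m) (unitArc x) : ℝ) ∂P

/-- The density `p_m(φ)`, `φ ∈ [0, 2π]`, of zeros of `K_m` on the unit circle: the derivative
(one-sided at the two end points) of the expected number of zeros on the arc `A(φ)`. -/
def zeroDensity {Ω : Type*} [MeasurableSpace Ω] (P : Measure Ω) (b : ℝ → ℝ)
    (ξ : ℕ → Ω → ℂ) (m : ℕ) (φ : ℝ) : ℝ :=
  derivWithin (expectedArcCount P b ξ m) (Set.Icc 0 (2 * Real.pi)) φ

end

/-!
On the unit circle `K_m(exp(iθ)) = 2 exp(i n θ / 2) H(θ)` with `n = 2m + 1` and a real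
trigonometric sum `H(θ) = cos(nθ/2) + ∑ b(k) (Re ξ_k cos(ω_k θ) + Im ξ_k sin(ω_k θ))`, where
`ω_k = n/2 - k` (`circleTrig`). For fixed `θ` the variables `H(θ)` and `H'(θ)` are independent
Gaussians with means `cos(nθ/2)` and `-(n/2) sin(nθ/2)` and with variances that do not depend
on `θ`: `V = (σ²/2) ∑ b(k)²` (`trigVar`) and `W = (σ²/2) ∑ b(k)² ω_k²` (`trigDerivVar`).

*The density.* The zeros of `K_m` on the circle have the Kac–Rice density
`p_m(θ) = φ_V(cos(nθ/2)) E|H'(θ)|` (`arcDensity`, `integral_circleZeroSum`), where `φ_V` is the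
density of `N(0, V)`. To prove this, all variables but one, `ξ_K` with `b(K) ≠ 0`, are held fixed.
Then `H(θ) = 0` says that the Gaussian point `ξ_K` of the plane lies on a line that rotates with
constant speed as `θ` varies. Such lines sweep the plane by the map `rotatingLine`, and the area
formula with multiplicities (`lintegral_abs_det_mul_eq_lintegral_tsum`) turns the mean number of
times at which `ξ_K` is hit into an integral over `θ` (`lintegral_tsum_rotatingLine`). The critical
values of that map are a null set, so almost surely all zeros are simple. Averaging over the other
variables uses the independence of `H(θ)` and `H'(θ)`.

*Normalization.* By scaling, `p_m(θ) / n = profile V q y` with `y = sin(nθ/2)`,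
`q = √(W / (n² V))` and
`profile V q y = (2π)^(-1/2) exp(-(1 - y²) / (2V)) E|y / (2√V) + q Z|`, `Z` standard Gaussian.
Everything depends on the limits of `V` and `q`.

*Regular variation.* The uniform convergence theorem for slowly varying functions
(`exists_tendsto_zero_increment_le`) shows that the step function `b(⌈x⌉)²` varies regularly with
index `2α`. If its sums diverge, they vary regularly with index `ρ = 2α + 1`, and summation by parts
gives `W / (n² V) → ½ ∫₀¹ t^ρ (1 - t) dt = 1 / (4 (1 + α) (3 + 2α))`
(`tendsto_trigVar_of_diverges`). If they converge, the weight stays on bounded `k`, where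
`ω_k / n → 1/2`, and `W / (n² V) → 1/4` (`tendsto_trigVar_of_converges`).

*The limits.* If `V → ∞`, then `profile V q y → q / π` uniformly in `y`
(`tendsto_profile_of_tendsto_atTop`). If `V` has a finite limit `V₀ > 0`, then `q → 1/2` and
`p_m / n` is asymptotically `profile V₀ (1/2) (sin(nθ/2))`. The limiting profile is even and
strictly increasing in `|y|`, so convergence would force convergence of `|sin(nθ/2)|`, hence of
`cos((2m+1)θ)`, which fails unless `sin 2θ = 0` (`not_tendsto_profile`). Against continuous
functions the oscillations average out to the mean of the limiting profile over a period
(`tendsto_integral_mul_profile`). That mean is `1 / (2π)`: up to scaling, the integral over a period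
counts how often a line through the origin that makes a half-turn meets a Gaussian point, and it
does so exactly once (`lintegral_gaussianPDF_cos_mul`).
-/

/-! ### Measurability of sums over the roots of a random polynomial -/

section Roots
open Polynomial

theorem measurable_coeff_prod_X_sub_C {ι : Type*} (s : Finset ι) (j : ℕ) :
    Measurable fun z : ι → ℂ => (∏ i ∈ s, (X - C (z i))).coeff j := by
  classical
  induction s using Finset.induction_on generalizing j with
  | empty => simp
  | insert a s ha ih =>
    simp only [Finset.prod_insert ha, coeff_mul]
    refine Finset.measurable_sum _ fun x _ => Measurable.mul ?_ (ih _)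
    simp only [coeff_sub, coeff_C]
    refine measurable_const.sub ?_
    split_ifs
    · exact measurable_pi_apply a
    · exact measurable_const

theorem natDegree_prod_X_sub_C (n : ℕ) (z : Fin n → ℂ) :
    (∏ i, (X - C (z i))).natDegree = n := by
  rw [natDegree_prod_of_monic _ _ fun i _ => monic_X_sub_C _]
  simp

/-- The power sums `∑ h(z)` over the roots of a monic complex polynomial are Borel functions of its
coefficients. The map from root tuples to coefficient tuples is a Borel surjection between standard
Borel spaces, so that measurability can be tested on root tuples. -/
theorem measurable_sum_roots_map {Ω : Type*} [MeasurableSpace Ω] {p : Ω → ℂ[X]} {n : ℕ}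
    (hp : ∀ ω, (p ω).Monic) (hdeg : ∀ ω, (p ω).natDegree = n)
    (hcoeff : ∀ i, Measurable fun ω => (p ω).coeff i) {h : ℂ → ℝ} (hh : Measurable h) :
    Measurable fun ω => ((p ω).roots.map h).sum := by
  let q : (Fin n → ℂ) → ℂ[X] := fun c => X ^ n + ∑ i : Fin n, C (c i) * X ^ (i : ℕ)
  let Φ : (Fin n → ℂ) → (Fin n → ℂ) := fun z j => (∏ i, (X - C (z i))).coeff j
  have hq : ∀ P : ℂ[X], P.Monic → P.natDegree = n → q (fun j => P.coeff j) = P := by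
    intro P hP hn
    conv_rhs => rw [hP.as_sum, hn]
    simp only [q]
    rw [Finset.sum_range]
  have hqΦ : ∀ z, q (Φ z) = ∏ i, (X - C (z i)) := fun z =>
    hq _ (monic_prod_of_monic _ _ fun i _ => monic_X_sub_C _) (natDegree_prod_X_sub_C n z)
  have hΦ : Measurable Φ :=
    measurable_pi_lambda _ fun j => measurable_coeff_prod_X_sub_C Finset.univ j
  have hsurj : Function.Surjective Φ := by
    intro c
    have hlt : (∑ i : Fin n, C (c i) * X ^ (i : ℕ)).degree < (n : WithBot ℕ) := by
      refine lt_of_le_of_lt (degree_sum_le _ _)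
        ((Finset.sup_lt_iff (WithBot.bot_lt_coe n)).2 fun i _ => ?_)
      exact lt_of_le_of_lt (degree_C_mul_X_pow_le _ _) (WithBot.coe_lt_coe.2 i.2)
    have hmon : (q c).Monic := monic_X_pow_add hlt
    have hnd : (q c).natDegree = n := by
      have := degree_eq_natDegree hmon.ne_zero
      rw [show q c = X ^ n + _ from rfl, degree_add_eq_left_of_degree_lt (by simpa using hlt),
        degree_X_pow] at this
      exact_mod_cast this.symm
    have hcard : Multiset.card (q c).roots = n := by
      rw [← (IsAlgClosed.splits (q c)).natDegree_eq_card_roots, hnd]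
    obtain ⟨l, hl⟩ := Quot.exists_rep (q c).roots
    have hl' : (l : Multiset ℂ) = (q c).roots := hl
    have hlen : l.length = n := by rw [← hcard, ← hl']; rfl
    subst hlen
    refine ⟨l.get, ?_⟩
    have hprod : ∏ i, (X - C (l.get i)) = q c := by
      conv_rhs => rw [(IsAlgClosed.splits (q c)).eq_prod_roots_of_monic hmon, ← hl']
      rw [Multiset.map_coe, Multiset.prod_coe, ← List.prod_ofFn]
      congr 1
      conv_rhs => rw [← List.ofFn_get l, List.map_ofFn]
      rfl
    funext j
    simp only [Φ, hprod, q, coeff_add, coeff_X_pow, finsetSum_coeff, coeff_C_mul]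
    rw [Finset.sum_eq_single j]
    · simp [(j.2).ne]
    · intro i _ hij
      have : (j : ℕ) ≠ i := fun h => hij (Fin.ext h).symm
      simp [this]
    · simp
  have hg : Measurable fun c => ((q c).roots.map h).sum := by
    rw [← hΦ.measurable_comp_iff_of_surjective hsurj]
    have : (fun c => ((q c).roots.map h).sum) ∘ Φ = fun z => ∑ i, h (z i) := by
      funext z
      simp only [Function.comp, hqΦ]
      rw [Polynomial.roots_prod _ _
        (Finset.prod_ne_zero_iff.2 fun i _ => X_sub_C_ne_zero _)]
      simp [List.sum_ofFn]
    rw [this]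
    exact Finset.measurable_sum _ fun i _ => hh.comp (measurable_pi_apply i)
  have := hg.comp (measurable_pi_lambda (fun ω (j : Fin n) => (p ω).coeff j) fun j => hcoeff j)
  simpa only [Function.comp_def, hq _ (hp _) (hdeg _)] using this

theorem selfInversivePoly_eq (b : ℝ → ℝ) (ξ : ℕ → ℂ) (m : ℕ) :
    ∃ r : ℂ[X], r.degree < ((2 * m + 1 : ℕ) : WithBot ℕ) ∧
      selfInversivePoly b ξ m = X ^ (2 * m + 1) + r := by
  refine ⟨1 + ∑ k ∈ Finset.Icc 1 m, C ((b k : ℂ) * ξ k) * X ^ k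
    + ∑ k ∈ Finset.Icc 1 m, C ((b k : ℂ) * (starRingEnd ℂ) (ξ k)) * X ^ (2 * m - k + 1),
    ?_, by rw [selfInversivePoly]; ring⟩
  have h0 : (⊥ : WithBot ℕ) < ((2 * m + 1 : ℕ) : WithBot ℕ) := WithBot.bot_lt_coe _
  refine lt_of_le_of_lt (degree_add_le _ _) (max_lt ?_ ?_)
  · refine lt_of_le_of_lt (degree_add_le _ _) (max_lt ?_ ?_)
    · rw [degree_one]; exact_mod_cast Nat.succ_pos _
    · refine lt_of_le_of_lt (degree_sum_le _ _) ((Finset.sup_lt_iff h0).2 fun k hk => ?_)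
      refine lt_of_le_of_lt (degree_C_mul_X_pow_le _ _) ?_
      rw [Finset.mem_Icc] at hk
      exact_mod_cast (by omega : k < 2 * m + 1)
  · refine lt_of_le_of_lt (degree_sum_le _ _) ((Finset.sup_lt_iff h0).2 fun k hk => ?_)
    refine lt_of_le_of_lt (degree_C_mul_X_pow_le _ _) ?_
    rw [Finset.mem_Icc] at hk
    exact_mod_cast (by omega : 2 * m - k + 1 < 2 * m + 1)

theorem selfInversivePoly_monic (b : ℝ → ℝ) (ξ : ℕ → ℂ) (m : ℕ) :
    (selfInversivePoly b ξ m).Monic := by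
  obtain ⟨r, hr, h⟩ := selfInversivePoly_eq b ξ m
  rw [h]
  exact monic_X_pow_add hr

theorem selfInversivePoly_natDegree (b : ℝ → ℝ) (ξ : ℕ → ℂ) (m : ℕ) :
    (selfInversivePoly b ξ m).natDegree = 2 * m + 1 := by
  obtain ⟨r, hr, h⟩ := selfInversivePoly_eq b ξ m
  refine natDegree_eq_of_degree_eq_some ?_
  rw [h, degree_add_eq_left_of_degree_lt (by simpa using hr), degree_X_pow]

theorem measurable_coeff_selfInversivePoly {Ω : Type*} [MeasurableSpace Ω] {b : ℝ → ℝ}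
    {ξ : ℕ → Ω → ℂ} {m : ℕ} (hξ : ∀ k ∈ Finset.Icc 1 m, Measurable (ξ k)) (i : ℕ) :
    Measurable fun ω => (selfInversivePoly b (fun k => ξ k ω) m).coeff i := by
  simp only [selfInversivePoly, coeff_add, finsetSum_coeff, coeff_C_mul]
  refine ((measurable_const.add ?_).add ?_).add measurable_const
  · exact Finset.measurable_sum _ fun k hk => ((hξ k hk).const_mul _).mul_const _
  · exact Finset.measurable_sum _ fun k hk =>
      (((Complex.continuous_conj.measurable.comp (hξ k hk)).const_mul _).mul_const _)

end Roots

/-! ### Zeros on the unit circle and their angles -/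

theorem angle_mem_Ico (z : ℂ) : angle z ∈ Set.Ico 0 (2 * Real.pi) := by
  simpa [angle] using toIcoMod_mem_Ico Real.two_pi_pos 0 (Complex.arg z)

theorem exp_angle {z : ℂ} (hz : ‖z‖ = 1) : Complex.exp ((angle z : ℂ) * Complex.I) = z := by
  have h : angle z = Complex.arg z - toIcoDiv Real.two_pi_pos 0 (Complex.arg z) • (2 * Real.pi) :=
    rfl
  have h2 := Complex.norm_mul_exp_arg_mul_I z
  rw [hz] at h2
  rw [h]
  push_cast
  rw [sub_mul, Complex.exp_sub]
  have h3 : Complex.exp (((toIcoDiv Real.two_pi_pos 0 (Complex.arg z) • (2 * Real.pi) : ℝ) : ℂ)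
      * Complex.I) = 1 := by
    rw [Complex.exp_eq_one_iff]
    exact ⟨toIcoDiv Real.two_pi_pos 0 (Complex.arg z), by push_cast [zsmul_eq_mul]; ring⟩
  push_cast at h3
  simp only [zsmul_eq_mul] at h3 ⊢
  rw [h3]
  simpa using h2

theorem exp_mul_I_injOn :
    Set.InjOn (fun θ : ℝ => Complex.exp ((θ : ℂ) * Complex.I)) (Set.Ico 0 (2 * Real.pi)) := by
  intro s hs t ht hst
  obtain ⟨n, hn⟩ := Complex.exp_eq_exp_iff_exists_int.1 hst
  have h : s = t + n * (2 * Real.pi) := by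
    have := congrArg Complex.im hn
    simpa using this
  have hpi := Real.pi_pos
  have h1 : (n : ℝ) < 1 := by
    by_contra hc
    push Not at hc
    nlinarith [hs.2, ht.1]
  have h2 : (-1 : ℝ) < n := by
    by_contra hc
    push Not at hc
    nlinarith [hs.1, ht.2]
  have h3 : n = 0 := by
    have : n < 1 := by exact_mod_cast h1
    have : -1 < n := by exact_mod_cast h2
    omega
  simpa [h3] using h

theorem norm_exp_mul_I_eq (θ : ℝ) : ‖Complex.exp ((θ : ℂ) * Complex.I)‖ = 1 :=
  Complex.norm_exp_ofReal_mul_I θ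

theorem angle_exp {θ : ℝ} (hθ : θ ∈ Set.Ico 0 (2 * Real.pi)) :
    angle (Complex.exp ((θ : ℂ) * Complex.I)) = θ :=
  exp_mul_I_injOn (angle_mem_Ico _) hθ (exp_angle (norm_exp_mul_I_eq θ))

theorem measurable_angle : Measurable angle := by
  have h : Measurable (toIcoMod Real.two_pi_pos (0 : ℝ)) := by
    have : toIcoMod Real.two_pi_pos (0 : ℝ)
        = fun x => 2 * Real.pi * Int.fract (x / (2 * Real.pi)) := by
      funext x
      rw [toIcoMod_eq_fract_mul]
      simp [mul_comm]
    rw [this]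
    fun_prop
  exact h.comp Complex.measurable_arg

theorem mem_unitArc_iff {x : ℝ} (hx : x ∈ Set.Icc 0 (2 * Real.pi)) (z : ℂ) :
    z ∈ unitArc x ↔ ‖z‖ = 1 ∧ angle z ∈ Set.Icc 0 x := by
  constructor
  · rintro ⟨θ, hθ, rfl⟩
    refine ⟨norm_exp_mul_I_eq θ, (angle_mem_Ico _).1, ?_⟩
    rcases lt_or_eq_of_le (hθ.2.trans hx.2) with h | h
    · simpa only [angle_exp ⟨hθ.1, h⟩] using hθ.2
    · have : x = 2 * Real.pi := le_antisymm hx.2 (h ▸ hθ.2)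
      rw [this]
      exact (angle_mem_Ico _).2.le
  · rintro ⟨hz, hθ⟩
    exact ⟨angle z, hθ, exp_angle hz⟩

open Classical in
theorem circleZeroSum_eq_sum_roots (p : Polynomial ℂ) (f : ℝ → ℝ) :
    circleZeroSum p f = (p.roots.map fun z => if ‖z‖ = 1 then f (angle z) else 0).sum := by
  rw [circleZeroSum]
  induction p.roots using Multiset.induction_on with
  | empty => simp
  | cons a s ih =>
    by_cases h : ‖a‖ = 1
    · simp [h, ih]
    · simp [h, ih]

theorem zeroCount_unitArc (p : Polynomial ℂ) {x : ℝ} (hx : x ∈ Set.Icc 0 (2 * Real.pi)) :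
    (zeroCount p (unitArc x) : ℝ) = circleZeroSum p (Set.indicator (Set.Icc 0 x) 1) := by
  classical
  rw [circleZeroSum_eq_sum_roots, zeroCount]
  induction p.roots using Multiset.induction_on with
  | empty => simp
  | cons a s ih =>
    rw [Multiset.countP_cons, Multiset.map_cons, Multiset.sum_cons, ← ih]
    by_cases h : a ∈ unitArc x
    · have h' := (mem_unitArc_iff hx a).1 h
      rw [if_pos h, if_pos h'.1, Set.indicator_of_mem h'.2]
      push_cast
      simp [add_comm]
    · rw [if_neg h]
      by_cases h1 : ‖a‖ = 1
      · rw [if_pos h1, Set.indicator_of_notMem fun h2 => h ((mem_unitArc_iff hx a).2 ⟨h1, h2⟩)]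
        simp
      · simp [h1]

theorem circleZeroSum_congr (p : Polynomial ℂ) {f g : ℝ → ℝ}
    (h : Set.EqOn f g (Set.Ico 0 (2 * Real.pi))) : circleZeroSum p f = circleZeroSum p g := by
  rw [circleZeroSum, circleZeroSum]
  congr 1
  exact Multiset.map_congr rfl fun z _ => h (angle_mem_Ico z)

theorem circleZeroSum_add (p : Polynomial ℂ) (f g : ℝ → ℝ) :
    circleZeroSum p (fun θ => f θ + g θ) = circleZeroSum p f + circleZeroSum p g := by
  simp [circleZeroSum]

theorem circleZeroSum_nonneg (p : Polynomial ℂ) {f : ℝ → ℝ} (hf : ∀ θ, 0 ≤ f θ) :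
    0 ≤ circleZeroSum p f := by
  refine Multiset.sum_nonneg fun x hx => ?_
  obtain ⟨z, -, rfl⟩ := Multiset.mem_map.1 hx
  exact hf _

theorem abs_circleZeroSum_le (p : Polynomial ℂ) {f : ℝ → ℝ} {c : ℝ} (hc : ∀ θ, |f θ| ≤ c) :
    |circleZeroSum p f| ≤ p.natDegree * c := by
  have hc0 : 0 ≤ c := (abs_nonneg _).trans (hc 0)
  rw [circleZeroSum]
  refine (Multiset.abs_sum_le_sum_abs).trans ?_
  rw [Multiset.map_map]
  refine (Multiset.sum_le_card_nsmul _ c ?_).trans ?_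
  · intro x hx
    obtain ⟨z, -, rfl⟩ := Multiset.mem_map.1 hx
    exact hc _
  · rw [nsmul_eq_mul]
    refine mul_le_mul_of_nonneg_right ?_ hc0
    rw [Multiset.card_map]
    exact_mod_cast (Multiset.card_le_card (Multiset.filter_le _ _)).trans p.card_roots'

theorem measurable_circleZeroSum {Ω : Type*} [MeasurableSpace Ω] {b : ℝ → ℝ}
    {ξ : ℕ → Ω → ℂ} {m : ℕ} (hξ : ∀ k ∈ Finset.Icc 1 m, Measurable (ξ k)) {f : ℝ → ℝ}
    (hf : Measurable f) :
    Measurable fun ω => circleZeroSum (selfInversivePoly b (fun k => ξ k ω) m) f := by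
  classical
  simp only [circleZeroSum_eq_sum_roots]
  refine measurable_sum_roots_map (fun ω => selfInversivePoly_monic _ _ _)
    (fun ω => selfInversivePoly_natDegree _ _ _) (measurable_coeff_selfInversivePoly hξ) ?_
  exact Measurable.ite (measurableSet_eq_fun measurable_norm measurable_const)
    (hf.comp measurable_angle) measurable_const

/-! ### The area formula with multiplicities -/

section AreaFormula

variable {E : Type*} [NormedAddCommGroup E] [NormedSpace ℝ E] [FiniteDimensional ℝ E]
  [MeasurableSpace E] [BorelSpace E]

/-- A set on which the differential is everywhere invertible is a countable disjoint union of
measurable sets on which the map is injective. -/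
theorem exists_partition_injOn {f : E → E} {f' : E → E →L[ℝ] E} {s : Set E}
    (hf : ∀ x ∈ s, HasStrictFDerivAt f (f' x) x) (hs : MeasurableSet s)
    (hdet : ∀ x ∈ s, (f' x).det ≠ 0) :
    ∃ u : ℕ → Set E, (∀ n, MeasurableSet (u n)) ∧ Pairwise (Function.onFun Disjoint u) ∧
      (⋃ n, u n) = s ∧ ∀ n, Set.InjOn f (u n) := by
  have hloc : ∀ x ∈ s, ∃ U : Set E, IsOpen U ∧ x ∈ U ∧ Set.InjOn f U := by
    intro x hx
    have h : HasStrictFDerivAt f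
        (((f' x).toContinuousLinearEquivOfDetNeZero (hdet x hx) : E ≃L[ℝ] E) : E →L[ℝ] E) x := by
      simpa using hf x hx
    exact ⟨_, (h.toOpenPartialHomeomorph f).open_source, h.mem_toOpenPartialHomeomorph_source,
      (h.toOpenPartialHomeomorph f).injOn⟩
  choose! U hUo hxU hUi using hloc
  rcases s.eq_empty_or_nonempty with rfl | hne
  · exact ⟨fun _ => ∅, fun _ => MeasurableSet.empty, fun _ _ _ => disjoint_bot_left, by simp,
      fun _ => Set.injOn_empty _⟩
  obtain ⟨t, hts, htc, hcov⟩ := TopologicalSpace.countable_cover_nhdsWithin (s := s) (f := U)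
    fun x hx => mem_nhdsWithin_of_mem_nhds ((hUo x hx).mem_nhds (hxU x hx))
  have htne : t.Nonempty := by
    obtain ⟨x, hx⟩ := hne
    obtain ⟨y, hy, -⟩ := Set.mem_iUnion₂.1 (hcov hx)
    exact ⟨y, hy⟩
  obtain ⟨e, rfl⟩ := htc.exists_eq_range htne
  have hm : ∀ n, MeasurableSet (U (e n) ∩ s) := fun n =>
    (hUo _ (hts ⟨n, rfl⟩)).measurableSet.inter hs
  refine ⟨disjointed fun n => U (e n) ∩ s, fun n => MeasurableSet.disjointed hm n,
    disjoint_disjointed _, ?_, fun n => ?_⟩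
  · rw [iUnion_disjointed]
    refine subset_antisymm (Set.iUnion_subset fun n => Set.inter_subset_right) fun x hx => ?_
    obtain ⟨_, ⟨n, rfl⟩, hy⟩ := Set.mem_iUnion₂.1 (hcov hx)
    exact Set.mem_iUnion.2 ⟨n, hy, hx⟩
  · exact (hUi _ (hts ⟨n, rfl⟩)).mono
      ((disjointed_subset _ n).trans Set.inter_subset_left)

/-- The area formula for maps that need not be injective: every value is weighted by the sum of
`G` over its preimages. -/
theorem lintegral_abs_det_mul_eq_lintegral_tsum (μ : Measure E) [μ.IsAddHaarMeasure] {f : E → E}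
    {f' : E → E →L[ℝ] E} {s : Set E} (hf : ∀ x ∈ s, HasStrictFDerivAt f (f' x) x)
    (hs : MeasurableSet s) (hdet : ∀ x ∈ s, (f' x).det ≠ 0) {G : E → ℝ≥0∞} (hG : Measurable G) :
    ∫⁻ x in s, ENNReal.ofReal |(f' x).det| * G x ∂μ
      = ∫⁻ y, ∑' x : ↥(s ∩ f ⁻¹' {y}), G x ∂μ := by
  obtain ⟨u, hum, hud, rfl, hui⟩ := exists_partition_injOn hf hs hdet
  have hf' : ∀ n, ∀ x ∈ u n, HasFDerivWithinAt f (f' x) (u n) x := fun n x hx =>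
    (hf x (Set.mem_iUnion.2 ⟨n, hx⟩)).hasFDerivAt.hasFDerivWithinAt
  -- `g n y` is the value of `G` at the only preimage of `y` in the `n`-th piece, if there is one
  let g : ℕ → E → ℝ≥0∞ := fun n =>
    Function.extend ((u n).domRestrict f) (fun x => G x) (fun _ => 0)
  have hemb : ∀ n, MeasurableEmbedding ((u n).domRestrict f) := fun n =>
    measurableEmbedding_of_fderivWithin (hum n) (hf' n) (hui n)
  have hgm : ∀ n, Measurable (g n) := fun n =>
    (hemb n).measurable_extend (hG.comp measurable_subtype_coe) measurable_const
  have hgf : ∀ n, ∀ x ∈ u n, g n (f x) = G x := fun n x hx =>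
    (hemb n).injective.extend_apply (fun x => G x) (fun _ => 0) ⟨x, hx⟩
  have hg0 : ∀ n, ∀ y, y ∉ f '' u n → g n y = 0 := by
    intro n y hy
    refine Function.extend_apply' _ _ _ ?_
    rintro ⟨x, hx⟩
    exact hy ⟨x, x.2, hx⟩
  have hsum : ∀ y, ∑' x : ↥((⋃ n, u n) ∩ f ⁻¹' {y}), G x = ∑' n, g n y := by
    intro y
    rw [Set.iUnion_inter, ENNReal.tsum_biUnion (t := fun n => u n ∩ f ⁻¹' {y}) fun i _ j _ hij =>
      (hud hij).mono Set.inter_subset_left Set.inter_subset_left]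
    refine tsum_congr fun n => ?_
    by_cases hy : y ∈ f '' u n
    · obtain ⟨x, hx, rfl⟩ := hy
      have : u n ∩ f ⁻¹' {f x} = {x} := by
        ext z
        constructor
        · rintro ⟨hz, hz'⟩
          exact hui n hz hx hz'
        · rintro rfl
          exact ⟨hx, rfl⟩
      rw [this, tsum_singleton x G, hgf n x hx]
    · have : u n ∩ f ⁻¹' {y} = ∅ := by
        ext z
        simp only [Set.mem_inter_iff, Set.mem_preimage, Set.mem_singleton_iff,
          Set.mem_empty_iff_false, iff_false, not_and]
        rintro hz rfl
        exact hy ⟨z, hz, rfl⟩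
      rw [this, hg0 n y hy]
      simp
  simp only [hsum]
  rw [lintegral_tsum fun n => (hgm n).aemeasurable, lintegral_iUnion hum hud]
  refine tsum_congr fun n => ?_
  have h1 : ∫⁻ y, g n y ∂μ = ∫⁻ y in f '' u n, g n y ∂μ := by
    rw [setLIntegral_eq_of_support_subset]
    intro y hy
    by_contra hc
    exact hy (hg0 n y hc)
  rw [h1, lintegral_image_eq_lintegral_abs_det_fderiv_mul μ (hum n) (hf' n) (hui n)]
  exact setLIntegral_congr_fun (hum n) fun x hx => by simp only [hgf n x hx]

end AreaFormula

/-! ### A Kac–Rice formula for rotating lines in the plane -/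

section RotatingLines

open Real

/-- The parametrization `(t, r) ↦ R_{κ t} (a(t), r)` of the plane, `R` being the rotation: the line
`{(x, y) | x cos κt + y sin κt = a(t)}` is the image of `{t} × ℝ`. -/
noncomputable def rotatingLine (κ : ℝ) (a : ℝ → ℝ) (p : ℝ × ℝ) : ℝ × ℝ :=
  (a p.1 * cos (κ * p.1) - p.2 * sin (κ * p.1), a p.1 * sin (κ * p.1) + p.2 * cos (κ * p.1))

/-- The differential of `rotatingLine κ a`, given the derivative `a'` of `a`. -/
noncomputable def rotatingLineDeriv (κ : ℝ) (a a' : ℝ → ℝ) (p : ℝ × ℝ) : ℝ × ℝ →L[ℝ] ℝ × ℝ :=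
  (Matrix.toLin (.finTwoProd ℝ) (.finTwoProd ℝ)
    !![a' p.1 * cos (κ * p.1) - a p.1 * (κ * sin (κ * p.1)) - p.2 * (κ * cos (κ * p.1)),
        -sin (κ * p.1);
      a' p.1 * sin (κ * p.1) + a p.1 * (κ * cos (κ * p.1)) - p.2 * (κ * sin (κ * p.1)),
        cos (κ * p.1)]).toContinuousLinearMap

variable {κ : ℝ} {a a' : ℝ → ℝ}

theorem hasStrictFDerivAt_rotatingLine (ha : ∀ t, HasStrictDerivAt a (a' t) t) (p : ℝ × ℝ) :
    HasStrictFDerivAt (rotatingLine κ a) (rotatingLineDeriv κ a a' p) p := by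
  have h1 : HasStrictFDerivAt (fun q : ℝ × ℝ => q.1) (ContinuousLinearMap.fst ℝ ℝ ℝ) p :=
    hasStrictFDerivAt_fst
  have h2 : HasStrictFDerivAt (fun q : ℝ × ℝ => q.2) (ContinuousLinearMap.snd ℝ ℝ ℝ) p :=
    hasStrictFDerivAt_snd
  have hA := (ha p.1).comp_hasStrictFDerivAt p h1
  have hl : HasStrictDerivAt (fun t : ℝ => κ * t) κ p.1 := by
    simpa using (hasStrictDerivAt_id p.1).const_mul κ
  have hc := (((hasStrictDerivAt_cos (κ * p.1)).comp p.1 hl)).comp_hasStrictFDerivAt p h1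
  have hs := (((hasStrictDerivAt_sin (κ * p.1)).comp p.1 hl)).comp_hasStrictFDerivAt p h1
  unfold rotatingLineDeriv
  rw [Matrix.toLin_finTwoProd_toContinuousLinearMap]
  convert! ((hA.mul hc).sub (h2.mul hs)).prodMk ((hA.mul hs).add (h2.mul hc)) using 2
  · ext <;> simp; ring
  · ext <;> simp; ring

theorem det_rotatingLineDeriv (p : ℝ × ℝ) :
    (rotatingLineDeriv κ a a' p).det = a' p.1 - κ * p.2 := by
  unfold rotatingLineDeriv
  simp only [LinearMap.det_toContinuousLinearMap, LinearMap.det_toLin, Matrix.det_fin_two_of]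
  linear_combination (a' p.1 - κ * p.2) * sin_sq_add_cos_sq (κ * p.1)

theorem rotatingLine_eq_iff (p y : ℝ × ℝ) :
    rotatingLine κ a p = y ↔ y.1 * cos (κ * p.1) + y.2 * sin (κ * p.1) = a p.1 ∧
      p.2 = y.2 * cos (κ * p.1) - y.1 * sin (κ * p.1) := by
  have h := sin_sq_add_cos_sq (κ * p.1)
  constructor
  · rintro rfl
    simp only [rotatingLine]
    constructor
    · linear_combination a p.1 * h
    · linear_combination - p.2 * h
  · rintro ⟨h1, h2⟩
    simp only [rotatingLine]
    ext
    · simp only [← h1, h2]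
      linear_combination y.1 * h
    · simp only [← h1, h2]
      linear_combination y.2 * h

/-- The centered Gaussian density in the plane is invariant under rotations. -/
theorem gaussianPDF_mul_gaussianPDF_rotate (s : ℝ≥0) (x y t : ℝ) :
    gaussianPDF 0 s (x * cos t - y * sin t) * gaussianPDF 0 s (x * sin t + y * cos t)
      = gaussianPDF 0 s x * gaussianPDF 0 s y := by
  simp only [gaussianPDF]
  rw [← ENNReal.ofReal_mul (gaussianPDFReal_nonneg _ _ _),
    ← ENNReal.ofReal_mul (gaussianPDFReal_nonneg _ _ _)]
  congr 1
  simp only [gaussianPDFReal, sub_zero]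
  rw [mul_mul_mul_comm, mul_mul_mul_comm _ _ _ (rexp (-y ^ 2 / (2 * s))), ← exp_add, ← exp_add]
  congr 2
  rw [← add_div, ← add_div]
  congr 1
  linear_combination (-x ^ 2 - y ^ 2) * sin_sq_add_cos_sq t

theorem prod_gaussianReal_eq_withDensity {s : ℝ≥0} (hs : s ≠ 0) :
    (gaussianReal 0 s).prod (gaussianReal 0 s) = (volume : Measure (ℝ × ℝ)).withDensity
      fun ξ => gaussianPDF 0 s ξ.1 * gaussianPDF 0 s ξ.2 := by
  rw [gaussianReal_of_var_ne_zero _ hs, prod_withDensity (measurable_gaussianPDF _ _)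
    (measurable_gaussianPDF _ _)]
  rfl

/-- Almost surely a Gaussian point of the plane lies on no line of the family at which the family
is degenerate: such points are critical values. -/
theorem ae_rotatingLine_nondegenerate (ha : ∀ t, HasStrictDerivAt a (a' t) t) {s : ℝ≥0}
    (hs : s ≠ 0) :
    ∀ᵐ ξ ∂(gaussianReal 0 s).prod (gaussianReal 0 s), ∀ t,
      ξ.1 * cos (κ * t) + ξ.2 * sin (κ * t) = a t →
        a' t - κ * (ξ.2 * cos (κ * t) - ξ.1 * sin (κ * t)) ≠ 0 := by
  rw [prod_gaussianReal_eq_withDensity hs]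
  refine (withDensity_absolutelyContinuous _ _).ae_le ?_
  have h := addHaar_image_eq_zero_of_det_fderivWithin_eq_zero (volume : Measure (ℝ × ℝ))
    (f := rotatingLine κ a) (f' := rotatingLineDeriv κ a a')
    (s := {p | (rotatingLineDeriv κ a a' p).det = 0})
    (fun p _ => (hasStrictFDerivAt_rotatingLine ha p).hasFDerivAt.hasFDerivWithinAt)
    (fun p hp => hp)
  filter_upwards [compl_mem_ae_iff.2 h] with ξ hξ t ht h0
  refine hξ ⟨(t, ξ.2 * cos (κ * t) - ξ.1 * sin (κ * t)), ?_, ?_⟩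
  · simpa only [Set.mem_ofPred_eq, det_rotatingLineDeriv] using h0
  · exact (rotatingLine_eq_iff _ _).2 ⟨ht, rfl⟩

/-- The Kac–Rice formula for the lines `{(x, y) | x cos κt + y sin κt = a(t)}` through a centered
isotropic Gaussian point `ξ` of the plane. It is the area formula for `rotatingLine κ a`. -/
theorem lintegral_tsum_rotatingLine (ha : ∀ t, HasStrictDerivAt a (a' t) t) (ha' : Continuous a')
    {s : ℝ≥0} (hs : s ≠ 0) {I : Set ℝ} (hI : MeasurableSet I) {f : ℝ → ℝ≥0∞}
    (hf : Measurable f) :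
    ∫⁻ ξ, ∑' t : ↥{t | t ∈ I ∧ ξ.1 * cos (κ * t) + ξ.2 * sin (κ * t) = a t ∧
          a' t - κ * (ξ.2 * cos (κ * t) - ξ.1 * sin (κ * t)) ≠ 0}, f t
        ∂(gaussianReal 0 s).prod (gaussianReal 0 s)
      = ∫⁻ t in I, f t * (gaussianPDF 0 s (a t)
          * ∫⁻ r, ENNReal.ofReal |a' t - κ * r| ∂gaussianReal 0 s) := by
  have hac : Continuous a := continuous_iff_continuousAt.2 fun t => (ha t).hasDerivAt.continuousAt
  let ρ : ℝ × ℝ → ℝ≥0∞ := fun ξ => gaussianPDF 0 s ξ.1 * gaussianPDF 0 s ξ.2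
  have hρ : Measurable ρ := ((measurable_gaussianPDF _ _).comp measurable_fst).mul
    ((measurable_gaussianPDF _ _).comp measurable_snd)
  have hρT : ∀ p, ρ (rotatingLine κ a p) = gaussianPDF 0 s (a p.1) * gaussianPDF 0 s p.2 :=
    fun p => gaussianPDF_mul_gaussianPDF_rotate _ _ _ _
  let S : Set (ℝ × ℝ) := {p | p.1 ∈ I ∧ a' p.1 - κ * p.2 ≠ 0}
  let G : ℝ × ℝ → ℝ≥0∞ := fun p => f p.1 * (gaussianPDF 0 s (a p.1) * gaussianPDF 0 s p.2)
  have hG : Measurable G := (hf.comp measurable_fst).mul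
    (((measurable_gaussianPDF _ _).comp (hac.measurable.comp measurable_fst)).mul
      ((measurable_gaussianPDF _ _).comp measurable_snd))
  have hdm : Measurable fun p : ℝ × ℝ => a' p.1 - κ * p.2 :=
    (ha'.measurable.comp measurable_fst).sub (measurable_snd.const_mul _)
  have hS : MeasurableSet S :=
    (measurable_fst hI).inter (measurableSet_eq_fun hdm measurable_const).compl
  have key := lintegral_abs_det_mul_eq_lintegral_tsum (volume : Measure (ℝ × ℝ))
    (f := rotatingLine κ a) (f' := rotatingLineDeriv κ a a') (s := S)
    (fun p _ => hasStrictFDerivAt_rotatingLine ha p) hS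
    (fun p hp => by rw [det_rotatingLineDeriv]; exact hp.2) hG
  rw [prod_gaussianReal_eq_withDensity hs,
    lintegral_withDensity_eq_lintegral_mul_non_measurable _ hρ
      (Eventually.of_forall fun ξ => ENNReal.mul_lt_top gaussianPDF_lt_top gaussianPDF_lt_top)]
  have hsum : ∀ ξ : ℝ × ℝ, ∑' p : ↥(S ∩ rotatingLine κ a ⁻¹' {ξ}), G p
      = ρ ξ * ∑' t : ↥{t | t ∈ I ∧ ξ.1 * cos (κ * t) + ξ.2 * sin (κ * t) = a t ∧
          a' t - κ * (ξ.2 * cos (κ * t) - ξ.1 * sin (κ * t)) ≠ 0}, f t := by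
    intro ξ
    let e : ↥(S ∩ rotatingLine κ a ⁻¹' {ξ}) ≃
        ↥{t | t ∈ I ∧ ξ.1 * cos (κ * t) + ξ.2 * sin (κ * t) = a t ∧
          a' t - κ * (ξ.2 * cos (κ * t) - ξ.1 * sin (κ * t)) ≠ 0} :=
      { toFun := fun p => ⟨p.1.1, p.2.1.1, ((rotatingLine_eq_iff _ _).1 p.2.2).1, by
          rw [← ((rotatingLine_eq_iff _ _).1 p.2.2).2]; exact p.2.1.2⟩
        invFun := fun t => ⟨(t.1, ξ.2 * cos (κ * t) - ξ.1 * sin (κ * t)), ⟨t.2.1, t.2.2.2⟩,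
          (rotatingLine_eq_iff _ _).2 ⟨t.2.2.1, rfl⟩⟩
        left_inv := fun p => Subtype.ext
          (Prod.ext rfl ((rotatingLine_eq_iff _ _).1 p.2.2).2.symm)
        right_inv := fun t => rfl }
    rw [← ENNReal.tsum_mul_left, ← e.tsum_eq]
    refine tsum_congr fun p => ?_
    have hp : rotatingLine κ a p.1 = ξ := p.2.2
    simp only [G, ← hρT, hp]
    exact mul_comm _ _
  simp only [hsum] at key
  refine Eq.trans key.symm ?_
  have h1 : ∫⁻ p in S, ENNReal.ofReal |(rotatingLineDeriv κ a a' p).det| * G p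
      = ∫⁻ p in I ×ˢ Set.univ, ENNReal.ofReal |a' p.1 - κ * p.2| * G p := by
    simp only [det_rotatingLineDeriv]
    rw [← lintegral_indicator hS, ← lintegral_indicator (hI.prod MeasurableSet.univ)]
    refine lintegral_congr fun p => ?_
    by_cases hp : p.1 ∈ I
    · have hp' : p ∈ I ×ˢ (Set.univ : Set ℝ) := ⟨hp, trivial⟩
      by_cases h0 : a' p.1 - κ * p.2 = 0
      · rw [Set.indicator_of_notMem (fun h => h.2 h0), Set.indicator_of_mem hp', h0]
        simp
      · rw [Set.indicator_of_mem (show p ∈ S from ⟨hp, h0⟩), Set.indicator_of_mem hp']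
    · rw [Set.indicator_of_notMem (fun h => hp h.1), Set.indicator_of_notMem (fun h => hp h.1)]
  have hgm : Measurable fun p : ℝ × ℝ => ENNReal.ofReal |a' p.1 - κ * p.2| :=
    ENNReal.measurable_ofReal.comp (measurable_norm.comp hdm)
  rw [h1, Measure.volume_eq_prod,
    setLIntegral_prod (fun p : ℝ × ℝ => ENNReal.ofReal |a' p.1 - κ * p.2| * G p)
      (hgm.mul hG).aemeasurable]
  refine lintegral_congr fun t => ?_
  have hgt : Measurable fun r : ℝ => ENNReal.ofReal |a' t - κ * r| :=
    hgm.comp measurable_prodMk_left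
  rw [Measure.restrict_univ, gaussianReal_of_var_ne_zero _ hs,
    lintegral_withDensity_eq_lintegral_mul _ (measurable_gaussianPDF _ _) hgt, ← mul_assoc,
    ← lintegral_const_mul _ ((measurable_gaussianPDF _ _).mul hgt)]
  refine lintegral_congr fun r => ?_
  simp only [G, Pi.mul_apply]
  ring

end RotatingLines

/-! ### Total mass of the limiting density -/

section HalfTurn

open Real

/-- A nonzero function `c cos t + d sin t` has exactly one zero in `[0, π)`. -/
theorem existsUnique_cos_sin_eq_zero {c d : ℝ} (h : c ≠ 0 ∨ d ≠ 0) :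
    ∃! t, t ∈ Set.Ico 0 π ∧ c * cos t + d * sin t = 0 := by
  refine existsUnique_of_exists_of_unique ?_ ?_
  · have hcont : ContinuousOn (fun t => c * cos t + d * sin t) (Set.uIcc 0 π) := by fun_prop
    have h0 : (0 : ℝ) ∈ Set.uIcc (c * cos 0 + d * sin 0) (c * cos π + d * sin π) := by
      rcases le_total 0 c with hc | hc
      · exact Set.mem_uIcc.2 (Or.inr (by simpa using hc))
      · exact Set.mem_uIcc.2 (Or.inl (by simpa using hc))
    obtain ⟨t, ht, h1⟩ := intermediate_value_uIcc hcont h0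
    rw [Set.uIcc_of_le pi_pos.le] at ht
    rcases lt_or_eq_of_le ht.2 with h2 | rfl
    · exact ⟨t, ⟨ht.1, h2⟩, h1⟩
    · refine ⟨0, ⟨le_rfl, pi_pos⟩, ?_⟩
      simp only [cos_pi, sin_pi] at h1
      simp only [cos_zero, sin_zero]
      linarith
  · rintro s t ⟨hs, h1⟩ ⟨ht, h2⟩
    have hd : d * sin (t - s) = 0 := by
      rw [sin_sub]; linear_combination cos s * h2 - cos t * h1
    have hc : c * sin (t - s) = 0 := by
      rw [sin_sub]; linear_combination sin t * h1 - sin s * h2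
    have h0 : sin (t - s) = 0 := by
      rcases h with h | h
      · exact (mul_eq_zero.1 hc).resolve_left h
      · exact (mul_eq_zero.1 hd).resolve_left h
    have := (sin_eq_zero_iff_of_lt_of_lt (x := t - s) (by linarith [hs.2, ht.1])
      (by linarith [hs.1, ht.2])).1 h0
    linarith

/-- Total mass of the limiting density: the line through the origin with a uniformly rotating
direction meets the Gaussian point `(1 + x, y)` exactly once per half-turn. -/
theorem lintegral_gaussianPDF_cos_mul {v : ℝ≥0} (hv : v ≠ 0) :
    ∫⁻ t in Set.Ico 0 π, gaussianPDF 0 v (-cos t)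
      * ∫⁻ r, ENNReal.ofReal |sin t - r| ∂gaussianReal 0 v = 1 := by
  have ha : ∀ t, HasStrictDerivAt (fun t => -cos t) (sin t) t := fun t => by
    have := (hasStrictDerivAt_cos t).neg
    rw [neg_neg] at this
    exact this
  have h := lintegral_tsum_rotatingLine (κ := 1) ha continuous_sin hv
    (measurableSet_Ico (a := 0) (b := π)) (f := fun _ => 1) measurable_const
  simp only [one_mul (gaussianPDF _ _ _ * _), one_mul (_ : ℝ)] at h
  rw [← h]
  have h1 : ∀ᵐ ξ ∂(gaussianReal 0 v).prod (gaussianReal 0 v),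
      ∑' _t : ↥{t | t ∈ Set.Ico 0 π ∧ ξ.1 * cos (1 * t) + ξ.2 * sin (1 * t) = -cos t ∧
          sin t - 1 * (ξ.2 * cos (1 * t) - ξ.1 * sin (1 * t)) ≠ 0}, (1 : ℝ≥0∞) = 1 := by
    filter_upwards [ae_rotatingLine_nondegenerate (κ := 1) ha hv] with ξ hξ
    simp only [one_mul] at hξ
    have hne : ξ.1 + 1 ≠ 0 ∨ ξ.2 ≠ 0 := by
      by_contra hc
      push Not at hc
      refine hξ 0 ?_ ?_
      · simp only [cos_zero, sin_zero]; linarith [hc.1]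
      · simp [hc.2]
    obtain ⟨t, ht, hu⟩ := existsUnique_cos_sin_eq_zero hne
    have : {t | t ∈ Set.Ico 0 π ∧ ξ.1 * cos (1 * t) + ξ.2 * sin (1 * t) = -cos t ∧
          sin t - 1 * (ξ.2 * cos (1 * t) - ξ.1 * sin (1 * t)) ≠ 0} = {t} := by
      ext u
      simp only [one_mul]
      constructor
      · rintro ⟨h1, h2, -⟩
        exact hu u ⟨h1, by linear_combination h2⟩
      · rintro rfl
        have h3 : ξ.1 * cos u + ξ.2 * sin u = -cos u := by linear_combination ht.2
        exact ⟨ht.1, h3, hξ u h3⟩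
    rw [this, tsum_singleton t (fun _ => (1 : ℝ≥0∞))]
  rw [lintegral_congr_ae h1]
  simp

end HalfTurn

/-! ### Reduction of circle zeros to zeros of a real trigonometric sum -/

/-- The frequency `(2m+1)/2 - k` of the `k`-th term of `circleTrig`. -/
noncomputable def freq (m k : ℕ) : ℝ := (2 * m + 1) / 2 - k

/-- The real trigonometric sum `H` with `K_m(exp(iθ)) = 2 exp(i(2m+1)θ/2) H(θ)`. -/
noncomputable def circleTrig (b : ℝ → ℝ) (ξ : ℕ → ℂ) (m : ℕ) (θ : ℝ) : ℝ :=
  Real.cos ((2 * m + 1) / 2 * θ) + ∑ k ∈ Finset.Icc 1 m,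
    b k * ((ξ k).re * Real.cos (freq m k * θ) + (ξ k).im * Real.sin (freq m k * θ))

/-- The derivative of `circleTrig`. -/
noncomputable def circleTrigDeriv (b : ℝ → ℝ) (ξ : ℕ → ℂ) (m : ℕ) (θ : ℝ) : ℝ :=
  -((2 * m + 1) / 2 * Real.sin ((2 * m + 1) / 2 * θ)) + ∑ k ∈ Finset.Icc 1 m,
    b k * (freq m k * ((ξ k).im * Real.cos (freq m k * θ) - (ξ k).re * Real.sin (freq m k * θ)))

theorem hasDerivAt_circleTrig (b : ℝ → ℝ) (ξ : ℕ → ℂ) (m : ℕ) (θ : ℝ) :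
    HasDerivAt (circleTrig b ξ m) (circleTrigDeriv b ξ m θ) θ := by
  have hl : ∀ c : ℝ, HasDerivAt (fun t : ℝ => c * t) c θ := fun c => by
    simpa using (hasDerivAt_id θ).const_mul c
  unfold circleTrigDeriv
  have hs := HasDerivAt.fun_sum (u := Finset.Icc 1 m) fun k _ =>
    ((((hl (freq m k)).cos.const_mul (ξ k).re).add
      ((hl (freq m k)).sin.const_mul (ξ k).im)).const_mul (b k))
  convert! (hl ((2 * m + 1) / 2)).cos.add hs using 1
  congr 1
  · ring
  · exact Finset.sum_congr rfl fun k _ => by ring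

open Complex in
theorem eval_exp_selfInversivePoly (b : ℝ → ℝ) (ξ : ℕ → ℂ) (m : ℕ) (θ : ℝ) :
    (selfInversivePoly b ξ m).eval (exp (θ * I))
      = 2 * exp (((2 * m + 1) / 2 * θ : ℝ) * I) * circleTrig b ξ m θ := by
  have hterm : ∀ k ∈ Finset.Icc 1 m,
      (b k : ℂ) * ξ k * exp (θ * I) ^ k
          + (b k : ℂ) * (starRingEnd ℂ) (ξ k) * exp (θ * I) ^ (2 * m - k + 1)
        = 2 * exp (((2 * m + 1) / 2 * θ : ℝ) * I)
          * ((b k * ((ξ k).re * Real.cos (freq m k * θ)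
              + (ξ k).im * Real.sin (freq m k * θ)) : ℝ) : ℂ) := by
    intro k hk
    rw [Finset.mem_Icc] at hk
    have h1 : exp (θ * I) ^ k
        = exp (((2 * m + 1) / 2 * θ : ℝ) * I) * exp (((-(freq m k * θ) : ℝ) : ℂ) * I) := by
      rw [← exp_nat_mul, ← exp_add]
      congr 1
      simp only [freq]
      push_cast
      ring
    have h2 : exp (θ * I) ^ (2 * m - k + 1)
        = exp (((2 * m + 1) / 2 * θ : ℝ) * I) * exp (((freq m k * θ : ℝ) : ℂ) * I) := by
      rw [← exp_nat_mul, ← exp_add]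
      congr 1
      simp only [freq]
      rw [Nat.cast_add, Nat.cast_sub (by omega)]
      push_cast
      ring
    rw [h1, h2, exp_mul_I ((-(freq m k * θ) : ℝ) : ℂ), exp_mul_I ((freq m k * θ : ℝ) : ℂ),
      ← ofReal_cos, ← ofReal_sin, ← ofReal_cos (freq m k * θ), ← ofReal_sin (freq m k * θ),
      Real.cos_neg, Real.sin_neg]
    have hξ := re_add_im (ξ k)
    have hξ' : (starRingEnd ℂ) (ξ k) = (ξ k).re - (ξ k).im * I :=
      Complex.ext (by simp) (by simp)
    rw [hξ']
    nth_rewrite 1 [← hξ]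
    push_cast
    linear_combination (-2 * exp (((2 * m + 1) / 2 * θ) * I) * b k * (ξ k).im
      * sin (freq m k * θ)) * I_sq
  have h0 : (1 : ℂ) + exp (θ * I) ^ (2 * m + 1)
      = 2 * exp (((2 * m + 1) / 2 * θ : ℝ) * I) * (Real.cos ((2 * m + 1) / 2 * θ) : ℂ) := by
    have h2 : exp (θ * I) ^ (2 * m + 1) = exp (((2 * m + 1) / 2 * θ : ℝ) * I) ^ 2 := by
      rw [← exp_nat_mul, ← exp_nat_mul]
      congr 1
      push_cast
      ring
    have h3 : exp (((2 * m + 1) / 2 * θ : ℝ) * I) * exp (-(((2 * m + 1) / 2 * θ : ℝ) * I)) = 1 := by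
      rw [← exp_add]; simp
    rw [h2, ofReal_cos, Complex.cos, neg_mul]
    linear_combination -h3
  simp only [selfInversivePoly, Polynomial.eval_add, Polynomial.eval_finsetSum,
    Polynomial.eval_one, Polynomial.eval_mul, Polynomial.eval_C, Polynomial.eval_pow,
    Polynomial.eval_X]
  rw [circleTrig, ofReal_add, ofReal_sum, mul_add, ← h0, Finset.mul_sum,
    ← Finset.sum_congr rfl hterm, Finset.sum_add_distrib]
  ring

theorem eval_exp_selfInversivePoly_eq_zero (b : ℝ → ℝ) (ξ : ℕ → ℂ) (m : ℕ) (θ : ℝ) :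
    (selfInversivePoly b ξ m).eval (Complex.exp (θ * Complex.I)) = 0 ↔ circleTrig b ξ m θ = 0 := by
  rw [eval_exp_selfInversivePoly]
  simp [Complex.exp_ne_zero]

/-- A simple zero of `circleTrig` is a simple root of the polynomial. -/
theorem eval_derivative_selfInversivePoly_ne_zero {b : ℝ → ℝ} {ξ : ℕ → ℂ} {m : ℕ} {θ : ℝ}
    (h0 : circleTrig b ξ m θ = 0) (h1 : circleTrigDeriv b ξ m θ ≠ 0) :
    (selfInversivePoly b ξ m).derivative.eval (Complex.exp (θ * Complex.I)) ≠ 0 := by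
  intro hc
  have hE : ∀ c : ℝ, HasDerivAt (fun t : ℝ => Complex.exp (((c * t : ℝ) : ℂ) * Complex.I))
      (Complex.exp (((c * θ : ℝ) : ℂ) * Complex.I) * (c * Complex.I)) θ := by
    intro c
    have : HasDerivAt (fun t : ℝ => c * t) c θ := by
      simpa using (hasDerivAt_id θ).const_mul c
    exact (this.ofReal_comp.mul_const Complex.I).cexp
  have hL : HasDerivAt (fun t : ℝ => (selfInversivePoly b ξ m).eval
      (Complex.exp (t * Complex.I))) 0 θ := by
    have h2 := ((selfInversivePoly b ξ m).hasDerivAt (Complex.exp (θ * Complex.I))).comp θ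
      (by simpa using hE 1)
    rw [hc, zero_mul] at h2
    exact h2
  have hR := ((hE ((2 * m + 1) / 2)).const_mul 2).mul (hasDerivAt_circleTrig b ξ m θ).ofReal_comp
  have hfun : (fun t : ℝ => (selfInversivePoly b ξ m).eval (Complex.exp (t * Complex.I)))
      = fun t : ℝ => 2 * Complex.exp (((2 * m + 1) / 2 * t : ℝ) * Complex.I)
        * (circleTrig b ξ m t : ℂ) := funext fun t => eval_exp_selfInversivePoly b ξ m t
  rw [hfun] at hL
  have := hL.unique hR
  rw [h0] at this
  simp [Complex.exp_ne_zero] at this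
  exact h1 this

/-- When all zeros of `circleTrig` are simple, sums over circle zeros of the polynomial are sums
over the zeros of `circleTrig` in `[0, 2π)`. -/
theorem ofReal_circleZeroSum {b : ℝ → ℝ} {ξ : ℕ → ℂ} {m : ℕ}
    (hsimple : ∀ θ, circleTrig b ξ m θ = 0 → circleTrigDeriv b ξ m θ ≠ 0)
    {f : ℝ → ℝ} (hf : ∀ θ, 0 ≤ f θ) :
    ENNReal.ofReal (circleZeroSum (selfInversivePoly b ξ m) f)
      = ∑' θ : ↥{θ | θ ∈ Set.Ico 0 (2 * Real.pi) ∧ circleTrig b ξ m θ = 0},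
          ENNReal.ofReal (f θ) := by
  classical
  set p := selfInversivePoly b ξ m with hp
  have hp0 : p ≠ 0 := (selfInversivePoly_monic b ξ m).ne_zero
  have hnd : (p.roots.filter fun z => ‖z‖ = 1).Nodup := by
    rw [Multiset.nodup_iff_count_le_one]
    intro z
    by_cases hz : z ∈ p.roots.filter fun z => ‖z‖ = 1
    · rw [Multiset.mem_filter, Polynomial.mem_roots hp0, Polynomial.IsRoot.def] at hz
      refine (Multiset.count_le_of_le z (Multiset.filter_le _ _)).trans ?_
      rw [Polynomial.count_roots]
      have h1 : circleTrig b ξ m (angle z) = 0 := by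
        rw [← eval_exp_selfInversivePoly_eq_zero, exp_angle hz.2]; exact hz.1
      have h2 := eval_derivative_selfInversivePoly_ne_zero h1 (hsimple _ h1)
      rw [exp_angle hz.2] at h2
      by_contra hc
      push Not at hc
      exact h2 ((Polynomial.one_lt_rootMultiplicity_iff_isRoot hp0).1 hc).2
    · rw [Multiset.count_eq_zero_of_notMem hz]
      exact zero_le_one
  let e : ↥{θ | θ ∈ Set.Ico 0 (2 * Real.pi) ∧ circleTrig b ξ m θ = 0} ≃
      ↥((p.roots.filter fun z => ‖z‖ = 1).toFinset) :=
    { toFun := fun θ => ⟨Complex.exp (θ * Complex.I), by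
        rw [Multiset.mem_toFinset, Multiset.mem_filter, Polynomial.mem_roots hp0,
          Polynomial.IsRoot.def, eval_exp_selfInversivePoly_eq_zero]
        exact ⟨θ.2.2, norm_exp_mul_I_eq θ⟩⟩
      invFun := fun z => ⟨angle z, angle_mem_Ico _, by
        have hz := z.2
        rw [Multiset.mem_toFinset, Multiset.mem_filter, Polynomial.mem_roots hp0,
          Polynomial.IsRoot.def] at hz
        rw [← eval_exp_selfInversivePoly_eq_zero, exp_angle hz.2]
        exact hz.1⟩
      left_inv := fun θ => Subtype.ext (angle_exp θ.2.1)
      right_inv := fun z => Subtype.ext (exp_angle (by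
        have hz := z.2
        rw [Multiset.mem_toFinset, Multiset.mem_filter] at hz
        exact hz.2)) }
  have h1 : circleZeroSum p f
      = ∑ z ∈ (p.roots.filter fun z => ‖z‖ = 1).toFinset, f (angle z) := by
    rw [Finset.sum_eq_multiset_sum, Multiset.toFinset_val, hnd.dedup, circleZeroSum]
  rw [h1, ENNReal.ofReal_sum_of_nonneg fun z _ => hf _, ← Finset.tsum_subtype, ← e.tsum_eq]
  refine tsum_congr fun θ => ?_
  simp only [e, Equiv.coe_fn_mk, angle_exp θ.2.1]

/-! ### Sums of independent rotated Gaussian vectors -/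

section GaussianSums

theorem nnreal_mk_sq_eq (c : ℝ) : NNReal.mk (c ^ 2) (sq_nonneg c) = ‖c‖₊ ^ 2 := by
  ext; simp

theorem charFunDual_gaussianReal_zero (v : ℝ≥0) (L : StrongDual ℝ ℝ) :
    charFunDual (gaussianReal 0 v) L = Complex.exp (-(v * (L 1 : ℂ) ^ 2 / 2)) := by
  have hL : (L : ℝ → ℝ) = fun x => L 1 * x := by
    funext x
    have := L.map_smul x 1
    simpa [mul_comm] using this
  rw [charFunDual_eq_charFun_map_one, hL, gaussianReal_map_const_mul, charFun_gaussianReal,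
    nnreal_mk_sq_eq]
  congr 1
  have : ((‖L 1‖ : ℝ) : ℂ) ^ 2 = (L 1 : ℂ) ^ 2 := by
    rw [← Complex.ofReal_pow, ← Complex.ofReal_pow, Real.norm_eq_abs, sq_abs]
  push_cast
  rw [this]
  ring

theorem charFunDual_prod_gaussianReal_zero (v w : ℝ≥0) (L : StrongDual ℝ (ℝ × ℝ)) :
    charFunDual ((gaussianReal 0 v).prod (gaussianReal 0 w)) L
      = Complex.exp (-((v * (L (1, 0) : ℂ) ^ 2 + w * (L (0, 1) : ℂ) ^ 2) / 2)) := by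
  rw [charFunDual_prod, charFunDual_gaussianReal_zero, charFunDual_gaussianReal_zero,
    ← Complex.exp_add]
  congr 1
  simp only [ContinuousLinearMap.coe_comp, Function.comp_apply, ContinuousLinearMap.inl_apply,
    ContinuousLinearMap.inr_apply]
  ring

theorem measurePreserving_isotropicGaussian (v : ℝ≥0) :
    (isotropicGaussian v).map (fun z => (z.re, z.im))
      = (gaussianReal 0 (v / 2)).prod (gaussianReal 0 (v / 2)) := by
  have h1 : Measurable fun p : ℝ × ℝ => (p.1 : ℂ) + (p.2 : ℂ) * Complex.I := by fun_prop
  have h2 : Measurable fun z : ℂ => (z.re, z.im) := by fun_prop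
  rw [isotropicGaussian, Measure.map_map h2 h1]
  have : (fun z : ℂ => (z.re, z.im)) ∘ (fun p : ℝ × ℝ => (p.1 : ℂ) + (p.2 : ℂ) * Complex.I)
      = id := by
    funext p
    ext <;> simp
  rw [this, Measure.map_id]

/-- The linear map `(x, y) ↦ (β (x cos t + y sin t), γ (y cos t - x sin t))`. -/
noncomputable def scaledRotation (β γ t : ℝ) : ℝ × ℝ →L[ℝ] ℝ × ℝ :=
  (β • (Real.cos t • ContinuousLinearMap.fst ℝ ℝ ℝ
      + Real.sin t • ContinuousLinearMap.snd ℝ ℝ ℝ)).prod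
    (γ • (Real.cos t • ContinuousLinearMap.snd ℝ ℝ ℝ
      - Real.sin t • ContinuousLinearMap.fst ℝ ℝ ℝ))

theorem scaledRotation_apply (β γ t : ℝ) (p : ℝ × ℝ) :
    scaledRotation β γ t p = (β * (p.1 * Real.cos t + p.2 * Real.sin t),
      γ * (p.2 * Real.cos t - p.1 * Real.sin t)) := by
  simp [scaledRotation, mul_comm, mul_add]

theorem charFunDual_map_scaledRotation (s : ℝ≥0) (β γ t : ℝ) (L : StrongDual ℝ (ℝ × ℝ)) :
    charFunDual (((gaussianReal 0 s).prod (gaussianReal 0 s)).map (scaledRotation β γ t)) L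
      = Complex.exp (-((s * (β : ℂ) ^ 2 * (L (1, 0) : ℂ) ^ 2
          + s * (γ : ℂ) ^ 2 * (L (0, 1) : ℂ) ^ 2) / 2)) := by
  rw [charFunDual_map, charFunDual_prod_gaussianReal_zero]
  congr 3
  have hL : ∀ p : ℝ × ℝ, L p = p.1 * L (1, 0) + p.2 * L (0, 1) := by
    intro p
    conv_lhs => rw [show p = p.1 • ((1, 0) : ℝ × ℝ) + p.2 • ((0, 1) : ℝ × ℝ) by
      ext <;> simp]
    rw [map_add, map_smul, map_smul, smul_eq_mul, smul_eq_mul]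
  simp only [ContinuousLinearMap.coe_comp, Function.comp_apply, scaledRotation_apply]
  rw [hL (β * _, _), hL (β * (0 * Real.cos t + _), _)]
  norm_cast
  linear_combination (s * β ^ 2 * L (1, 0) ^ 2 + s * γ ^ 2 * L (0, 1) ^ 2)
    * Real.sin_sq_add_cos_sq t

/-- For independent isotropic Gaussian `ξ_k`, the sums `∑ β_k Re(ξ_k exp(-i t_k))` and
`∑ γ_k Im(ξ_k exp(-i t_k))` are independent centered Gaussian variables. -/
theorem map_sum_rotated_gaussian {Ω : Type*} [MeasurableSpace Ω] {P : Measure Ω}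
    [IsProbabilityMeasure P] {ξ : ℕ → Ω → ℂ} {v : ℝ≥0} (hindep : iIndepFun ξ P)
    (hξ : ∀ k, Measurable (ξ k)) (hlaw : ∀ k, HasLaw (ξ k) (isotropicGaussian v) P)
    (S : Finset ℕ) (β γ t : ℕ → ℝ) :
    P.map (fun ω => ∑ k ∈ S, (β k * ((ξ k ω).re * Real.cos (t k) + (ξ k ω).im * Real.sin (t k)),
        γ k * ((ξ k ω).im * Real.cos (t k) - (ξ k ω).re * Real.sin (t k))))
      = (gaussianReal 0 (∑ k ∈ S, ‖β k‖₊ ^ 2 * (v / 2))).prod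
          (gaussianReal 0 (∑ k ∈ S, ‖γ k‖₊ ^ 2 * (v / 2))) := by
  have hre : Measurable fun z : ℂ => (z.re, z.im) := by fun_prop
  have hY : ∀ k, Measurable fun z : ℂ => scaledRotation (β k) (γ k) (t k) (z.re, z.im) := fun k =>
    (scaledRotation (β k) (γ k) (t k)).continuous.measurable.comp hre
  have hmap : ∀ k, P.map (fun ω => scaledRotation (β k) (γ k) (t k) ((ξ k ω).re, (ξ k ω).im))
      = ((gaussianReal 0 (v / 2)).prod (gaussianReal 0 (v / 2))).map
          (scaledRotation (β k) (γ k) (t k)) := by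
    intro k
    rw [← measurePreserving_isotropicGaussian, ← (hlaw k).map_eq,
      Measure.map_map hre (hξ k),
      Measure.map_map (scaledRotation _ _ _).continuous.measurable (hre.comp (hξ k))]
    rfl
  have hind := hindep.comp (fun k z => scaledRotation (β k) (γ k) (t k) (z.re, z.im)) hY
  have hms : Measurable fun ω => ∑ k ∈ S, scaledRotation (β k) (γ k) (t k)
      ((ξ k ω).re, (ξ k ω).im) :=
    Finset.measurable_sum _ fun k _ => (hY k).comp (hξ k)
  have hfun : (fun ω => ∑ k ∈ S, (β k * ((ξ k ω).re * Real.cos (t k)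
        + (ξ k ω).im * Real.sin (t k)),
        γ k * ((ξ k ω).im * Real.cos (t k) - (ξ k ω).re * Real.sin (t k))))
      = fun ω => ∑ k ∈ S, scaledRotation (β k) (γ k) (t k) ((ξ k ω).re, (ξ k ω).im) := by
    funext ω
    simp only [scaledRotation_apply]
  rw [hfun]
  have := Measure.isProbabilityMeasure_map (μ := P) hms.aemeasurable
  refine Measure.ext_of_charFunDual ?_
  have h := (hind.restrict S).charFunDual_map_fun_finsetSum_eq_prod
    fun k _ => ((hY k).comp (hξ k)).aemeasurable
  refine Eq.trans h ?_
  funext L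
  rw [Finset.prod_apply, charFunDual_prod_gaussianReal_zero]
  have h1 : ∀ k ∈ S, charFunDual (P.map
      ((fun z => scaledRotation (β k) (γ k) (t k) (z.re, z.im)) ∘ ξ k)) L
      = Complex.exp (-((((v / 2 : ℝ≥0) : ℂ) * (β k : ℂ) ^ 2 * (L (1, 0) : ℂ) ^ 2
          + ((v / 2 : ℝ≥0) : ℂ) * (γ k : ℂ) ^ 2 * (L (0, 1) : ℂ) ^ 2) / 2)) := by
    intro k _
    rw [← charFunDual_map_scaledRotation, ← hmap k]
    rfl
  rw [Finset.prod_congr rfl h1, ← Complex.exp_sum]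
  congr 1
  have hn : ∀ x : ℝ, ((‖x‖ : ℝ) : ℂ) ^ 2 = (x : ℂ) ^ 2 := fun x => by
    rw [← Complex.ofReal_pow, ← Complex.ofReal_pow, Real.norm_eq_abs, sq_abs]
  push_cast
  simp only [hn]
  rw [Finset.sum_neg_distrib, ← Finset.sum_div, Finset.sum_add_distrib, Finset.sum_mul,
    Finset.sum_mul]
  congr 3 <;> exact Finset.sum_congr rfl fun k _ => by ring

/-- Gaussian densities convolve to Gaussian densities, at every point. -/
theorem lintegral_gaussianPDF_sub (μ : ℝ) (v : ℝ≥0) {t : ℝ≥0} (ht : t ≠ 0) (x : ℝ) :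
    ∫⁻ y, gaussianPDF 0 t (x - y) ∂gaussianReal μ v = gaussianPDF μ (v + t) x := by
  have hvt : v + t ≠ 0 := by positivity
  have hpc : Continuous (gaussianPDFReal 0 t) := by
    unfold gaussianPDFReal; fun_prop
  have hpc' : Continuous (gaussianPDF μ (v + t)) := by
    unfold gaussianPDF gaussianPDFReal
    exact ENNReal.continuous_ofReal.comp (by fun_prop)
  have hbound : ∀ z, gaussianPDFReal 0 t z ≤ (Real.sqrt (2 * Real.pi * t))⁻¹ := by
    intro z
    unfold gaussianPDFReal
    refine mul_le_of_le_one_right (by positivity) (Real.exp_le_one_iff.2 ?_)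
    rw [neg_div]
    exact neg_nonpos.2 (by positivity)
  have hint : ∀ x, Integrable (fun y => gaussianPDFReal 0 t (x - y)) (gaussianReal μ v) := by
    intro x
    refine Integrable.of_bound (by fun_prop) (Real.sqrt (2 * Real.pi * t))⁻¹
      (Eventually.of_forall fun y => ?_)
    rw [Real.norm_of_nonneg (gaussianPDFReal_nonneg _ _ _)]
    exact hbound _
  have hFc : Continuous fun x => ∫ y, gaussianPDFReal 0 t (x - y) ∂gaussianReal μ v := by
    refine continuous_of_dominated (bound := fun _ => (Real.sqrt (2 * Real.pi * t))⁻¹)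
      (fun x => (hint x).aestronglyMeasurable) (fun x => Eventually.of_forall fun y => ?_)
      (integrable_const _) (Eventually.of_forall fun y => by fun_prop)
    rw [Real.norm_of_nonneg (gaussianPDFReal_nonneg _ _ _)]
    exact hbound _
  have hF : (fun x => ∫⁻ y, gaussianPDF 0 t (x - y) ∂gaussianReal μ v)
      = fun x => ENNReal.ofReal (∫ y, gaussianPDFReal 0 t (x - y) ∂gaussianReal μ v) := by
    funext x
    rw [ofReal_integral_eq_lintegral_ofReal (hint x)
      (Eventually.of_forall fun y => gaussianPDFReal_nonneg _ _ _)]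
    rfl
  have hFc' : Continuous fun x => ∫⁻ y, gaussianPDF 0 t (x - y) ∂gaussianReal μ v := by
    rw [hF]; exact ENNReal.continuous_ofReal.comp hFc
  -- both sides are densities of the same convolution; being continuous, they agree everywhere
  have hmeas : (volume : Measure ℝ).withDensity
      (fun x => ∫⁻ y, gaussianPDF 0 t (x - y) ∂gaussianReal μ v)
        = volume.withDensity (gaussianPDF μ (v + t)) := by
    rw [← gaussianReal_of_var_ne_zero μ hvt]
    have hconv := gaussianReal_conv_gaussianReal (m₁ := μ) (m₂ := 0) (v₁ := v) (v₂ := t)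
    rw [add_zero] at hconv
    rw [← hconv]
    refine Measure.ext_of_lintegral _ fun f hf => ?_
    rw [Measure.lintegral_conv hf, lintegral_withDensity_eq_lintegral_mul _ hFc'.measurable hf]
    have h1 : ∀ y, ∫⁻ z, f (y + z) ∂gaussianReal 0 t
        = ∫⁻ x, gaussianPDF 0 t (x - y) * f x := by
      intro y
      have hfy : Measurable fun z => f (y + z) := hf.comp (measurable_const_add y)
      rw [gaussianReal_of_var_ne_zero _ ht, lintegral_withDensity_eq_lintegral_mul _
        (measurable_gaussianPDF _ _) hfy, ← lintegral_sub_right_eq_self _ y]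
      refine lintegral_congr fun x => ?_
      simp
    simp only [h1]
    have hm2 : Measurable (Function.uncurry fun y x : ℝ => gaussianPDF 0 t (x - y) * f x) :=
      ((measurable_gaussianPDF 0 t).comp (measurable_snd.sub measurable_fst)).mul
        (hf.comp measurable_snd)
    rw [lintegral_lintegral_swap hm2.aemeasurable]
    refine lintegral_congr fun x => ?_
    have hpx : Measurable fun y => gaussianPDF 0 t (x - y) :=
      (measurable_gaussianPDF 0 t).comp (measurable_const.sub measurable_id)
    rw [lintegral_mul_const _ hpx]
    rfl
  have hae := (withDensity_eq_iff_of_sigmaFinite hFc'.measurable.aemeasurable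
    hpc'.measurable.aemeasurable).1 hmeas
  exact congrFun ((Continuous.ae_eq_iff_eq volume hFc' hpc').1 hae) x

/-- The mean absolute value `E|a + s Z|` for a standard Gaussian variable `Z`. -/
noncomputable def meanAbs (a s : ℝ) : ℝ := ∫ z, |a + s * z| ∂gaussianReal 0 1

theorem integrable_abs_gaussianReal (μ : ℝ) (v : ℝ≥0) :
    Integrable (fun z => |z|) (gaussianReal μ v) :=
  ((memLp_id_gaussianReal (μ := μ) (v := v) 1).integrable le_rfl).abs

theorem integrable_meanAbs (a s : ℝ) :
    Integrable (fun z => |a + s * z|) (gaussianReal 0 1) :=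
  ((integrable_const a).add
    (((memLp_id_gaussianReal (μ := 0) (v := 1) 1).integrable le_rfl).const_mul s)).abs

theorem meanAbs_nonneg (a s : ℝ) : 0 ≤ meanAbs a s := integral_nonneg fun _ => abs_nonneg _

theorem lintegral_abs_add_mul (a s : ℝ) :
    ∫⁻ z, ENNReal.ofReal |a + s * z| ∂gaussianReal 0 1 = ENNReal.ofReal (meanAbs a s) :=
  (ofReal_integral_eq_lintegral_ofReal (integrable_meanAbs a s)
    (Eventually.of_forall fun _ => abs_nonneg _)).symm

theorem lintegral_abs_add_mul_gaussianReal (a c : ℝ) (w : ℝ≥0) :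
    ∫⁻ y, ENNReal.ofReal |a + c * y| ∂gaussianReal 0 w
      = ENNReal.ofReal (meanAbs a (c * Real.sqrt w)) := by
  have h : gaussianReal 0 w = (gaussianReal 0 1).map (Real.sqrt w * ·) := by
    rw [gaussianReal_map_const_mul]
    congr 1
    · simp
    · ext; simp
  rw [h, lintegral_map (by fun_prop) (by fun_prop), ← lintegral_abs_add_mul]
  simp only [mul_assoc]

/-- The Gaussian average of the inner integral of `lintegral_tsum_rotatingLine`, when `a(t)` and
`a'(t)` are independent Gaussian variables, up to the scaling by `-β⁻¹`. -/
theorem lintegral_prod_gaussianPDF_mul_lintegral {s : ℝ≥0} (hs : s ≠ 0) (v w : ℝ≥0) {β : ℝ}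
    (hβ : β ≠ 0) (κ c d : ℝ) :
    ∫⁻ p, gaussianPDF 0 s (-(β⁻¹ * (c + p.1)))
        * ∫⁻ r, ENNReal.ofReal |-(β⁻¹ * (d + p.2)) - κ * r| ∂gaussianReal 0 s
          ∂(gaussianReal 0 v).prod (gaussianReal 0 w)
      = gaussianPDF 0 (v + ‖β‖₊ ^ 2 * s) c
          * ENNReal.ofReal (meanAbs d (Real.sqrt ((w + ‖β * κ‖₊ ^ 2 * s : ℝ≥0) : ℝ))) := by
  have hm1 : Measurable fun x : ℝ => gaussianPDF 0 s (-(β⁻¹ * (c + x))) :=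
    (measurable_gaussianPDF 0 s).comp (by fun_prop)
  have hm2 : Measurable fun y : ℝ =>
      ∫⁻ r, ENNReal.ofReal |-(β⁻¹ * (d + y)) - κ * r| ∂gaussianReal 0 s :=
    Measurable.lintegral_prod_right' (f := fun q : ℝ × ℝ =>
      ENNReal.ofReal |-(β⁻¹ * (d + q.1)) - κ * q.2|) (by fun_prop)
  rw [lintegral_prod_mul hm1.aemeasurable hm2.aemeasurable]
  have hβ' : ‖β‖₊ ^ 2 * s ≠ 0 := by
    have : ‖β‖₊ ≠ 0 := nnnorm_ne_zero_iff.2 hβ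
    positivity
  have h1 : ∫⁻ x, gaussianPDF 0 s (-(β⁻¹ * (c + x))) ∂gaussianReal 0 v
      = ENNReal.ofReal |β| * gaussianPDF 0 (v + ‖β‖₊ ^ 2 * s) c := by
    have h2 : ∀ x, gaussianPDF 0 s (-(β⁻¹ * (c + x)))
        = ENNReal.ofReal |β| * gaussianPDF 0 (‖β‖₊ ^ 2 * s) (-c - x) := by
      intro x
      simp only [gaussianPDF]
      rw [← ENNReal.ofReal_mul (abs_nonneg _), show -(β⁻¹ * (c + x)) = β⁻¹ * (-c - x) by ring,
        gaussianPDFReal_inv_mul hβ, mul_zero, nnreal_mk_sq_eq]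
    simp only [h2]
    have hpc : Measurable fun x => gaussianPDF 0 (‖β‖₊ ^ 2 * s) (-c - x) :=
      (measurable_gaussianPDF _ _).comp (measurable_const.sub measurable_id)
    rw [lintegral_const_mul _ hpc,
      lintegral_gaussianPDF_sub _ _ hβ']
    congr 1
    simp [gaussianPDF, gaussianPDFReal]
  have h3 : ENNReal.ofReal |β| * ∫⁻ y, ∫⁻ r,
        ENNReal.ofReal |-(β⁻¹ * (d + y)) - κ * r| ∂gaussianReal 0 s ∂gaussianReal 0 w
      = ENNReal.ofReal (meanAbs d (Real.sqrt ((w + ‖β * κ‖₊ ^ 2 * s : ℝ≥0) : ℝ))) := by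
    rw [← lintegral_const_mul _ hm2]
    have h4 : ∀ y, ENNReal.ofReal |β| * ∫⁻ r,
        ENNReal.ofReal |-(β⁻¹ * (d + y)) - κ * r| ∂gaussianReal 0 s
        = ∫⁻ u, ENNReal.ofReal |d + (y + u)| ∂gaussianReal 0 (‖β * κ‖₊ ^ 2 * s) := by
      intro y
      have hg : gaussianReal 0 (‖β * κ‖₊ ^ 2 * s) = (gaussianReal 0 s).map ((β * κ) * ·) := by
        rw [gaussianReal_map_const_mul, nnreal_mk_sq_eq, mul_zero]
      rw [hg, lintegral_map (by fun_prop) (by fun_prop), ← lintegral_const_mul _ (by fun_prop)]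
      refine lintegral_congr fun r => ?_
      rw [← ENNReal.ofReal_mul (abs_nonneg _), ← abs_mul, ← abs_neg]
      congr 2
      field_simp
      ring
    simp only [h4]
    rw [← Measure.lintegral_conv (f := fun z : ℝ => ENNReal.ofReal |d + z|) (by fun_prop),
      gaussianReal_conv_gaussianReal, add_zero]
    simpa only [one_mul] using lintegral_abs_add_mul_gaussianReal d 1 (w + ‖β * κ‖₊ ^ 2 * s)
  rw [h1, ← h3]
  ring

end GaussianSums

/-! ### The expected zero counting measure on the circle -/

section KacRice

/-- The variance of `circleTrig` at a point, when `E|ξ_k|² = v`. -/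
noncomputable def trigVar (b : ℝ → ℝ) (v : ℝ≥0) (m : ℕ) : ℝ≥0 :=
  ∑ k ∈ Finset.Icc 1 m, ‖b k‖₊ ^ 2 * (v / 2)

/-- The variance of `circleTrigDeriv` at a point, when `E|ξ_k|² = v`. -/
noncomputable def trigDerivVar (b : ℝ → ℝ) (v : ℝ≥0) (m : ℕ) : ℝ≥0 :=
  ∑ k ∈ Finset.Icc 1 m, ‖b k * freq m k‖₊ ^ 2 * (v / 2)

/-- The Kac–Rice density of the zeros of `K_m` on the circle: the density at `0` of `circleTrig`
times the mean of `|circleTrigDeriv|`, which is independent of `circleTrig` at each point. -/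
noncomputable def arcDensity (b : ℝ → ℝ) (v : ℝ≥0) (m : ℕ) (θ : ℝ) : ℝ :=
  gaussianPDFReal 0 (trigVar b v m) (Real.cos ((2 * m + 1) / 2 * θ))
    * meanAbs (-((2 * m + 1) / 2 * Real.sin ((2 * m + 1) / 2 * θ)))
        (Real.sqrt (trigDerivVar b v m))

theorem arcDensity_nonneg (b : ℝ → ℝ) (v : ℝ≥0) (m : ℕ) (θ : ℝ) : 0 ≤ arcDensity b v m θ :=
  mul_nonneg (gaussianPDFReal_nonneg _ _ _) (meanAbs_nonneg _ _)

theorem abs_meanAbs_sub_le (a s a' s' : ℝ) :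
    |meanAbs a s - meanAbs a' s'| ≤ |a - a'| + |s - s'| * ∫ z, |z| ∂gaussianReal 0 1 := by
  have hz := integrable_abs_gaussianReal 0 1
  rw [meanAbs, meanAbs, ← integral_sub (integrable_meanAbs a s) (integrable_meanAbs a' s')]
  refine (abs_integral_le_integral_abs).trans ?_
  have h1 : |a - a'| + |s - s'| * ∫ z, |z| ∂gaussianReal 0 1
      = ∫ z, (|a - a'| + |s - s'| * |z|) ∂gaussianReal 0 1 := by
    rw [integral_add (integrable_const _) (hz.const_mul _), integral_const_mul]
    simp
  rw [h1]
  refine integral_mono ((integrable_meanAbs a s).sub (integrable_meanAbs a' s')).abs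
    ((integrable_const _).add (hz.const_mul _)) fun z => ?_
  calc |(|a + s * z| - |a' + s' * z|)| ≤ |a + s * z - (a' + s' * z)| := abs_abs_sub_abs_le _ _
    _ = |(a - a') + (s - s') * z| := by congr 1; ring
    _ ≤ |a - a'| + |(s - s') * z| := abs_add_le _ _
    _ = |a - a'| + |s - s'| * |z| := by rw [abs_mul]

theorem continuous_meanAbs : Continuous fun p : ℝ × ℝ => meanAbs p.1 p.2 := by
  refine continuous_iff_continuousAt.2 fun p => ?_
  refine tendsto_iff_dist_tendsto_zero.2 (squeeze_zero (fun _ => dist_nonneg)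
    (fun q => abs_meanAbs_sub_le q.1 q.2 p.1 p.2) ?_)
  have : Continuous fun q : ℝ × ℝ =>
      |q.1 - p.1| + |q.2 - p.2| * ∫ z, |z| ∂gaussianReal 0 1 := by fun_prop
  simpa using this.tendsto p

theorem continuous_arcDensity (b : ℝ → ℝ) (v : ℝ≥0) (m : ℕ) : Continuous (arcDensity b v m) := by
  unfold arcDensity
  refine Continuous.mul ?_ ?_
  · unfold gaussianPDFReal
    fun_prop
  · exact continuous_meanAbs.comp (f := fun θ : ℝ =>
      (-((2 * m + 1) / 2 * Real.sin ((2 * m + 1) / 2 * θ)), Real.sqrt (trigDerivVar b v m)))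
      (by fun_prop)

theorem continuous_circleTrigDeriv (b : ℝ → ℝ) (ξ : ℕ → ℂ) (m : ℕ) :
    Continuous (circleTrigDeriv b ξ m) := by
  unfold circleTrigDeriv
  fun_prop

theorem hasStrictDerivAt_circleTrig (b : ℝ → ℝ) (ξ : ℕ → ℂ) (m : ℕ) (θ : ℝ) :
    HasStrictDerivAt (circleTrig b ξ m) (circleTrigDeriv b ξ m θ) θ :=
  hasStrictDerivAt_of_hasDerivAt_of_continuousAt
    (Eventually.of_forall fun t => hasDerivAt_circleTrig b ξ m t)
    (continuous_circleTrigDeriv b ξ m).continuousAt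

variable {b : ℝ → ℝ} {m K : ℕ}

theorem circleTrig_update (hK : K ∈ Finset.Icc 1 m) (ξ : ℕ → ℂ) (z : ℂ) (θ : ℝ) :
    circleTrig b (Function.update ξ K z) m θ
      = b K * (z.re * Real.cos (freq m K * θ) + z.im * Real.sin (freq m K * θ))
        + (Real.cos ((2 * m + 1) / 2 * θ) + ∑ k ∈ (Finset.Icc 1 m).erase K, b k
          * ((ξ k).re * Real.cos (freq m k * θ) + (ξ k).im * Real.sin (freq m k * θ))) := by
  rw [circleTrig, ← Finset.add_sum_erase _ _ hK, Function.update_self]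
  have : ∀ k ∈ (Finset.Icc 1 m).erase K, Function.update ξ K z k = ξ k := fun k hk =>
    Function.update_of_ne (Finset.ne_of_mem_erase hk) _ _
  rw [Finset.sum_congr rfl fun k hk => by rw [this k hk]]
  ring

theorem circleTrigDeriv_update (hK : K ∈ Finset.Icc 1 m) (ξ : ℕ → ℂ) (z : ℂ) (θ : ℝ) :
    circleTrigDeriv b (Function.update ξ K z) m θ
      = b K * (freq m K * (z.im * Real.cos (freq m K * θ) - z.re * Real.sin (freq m K * θ)))
        + (-((2 * m + 1) / 2 * Real.sin ((2 * m + 1) / 2 * θ))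
          + ∑ k ∈ (Finset.Icc 1 m).erase K, b k * (freq m k
          * ((ξ k).im * Real.cos (freq m k * θ) - (ξ k).re * Real.sin (freq m k * θ)))) := by
  rw [circleTrigDeriv, ← Finset.add_sum_erase _ _ hK, Function.update_self]
  have : ∀ k ∈ (Finset.Icc 1 m).erase K, Function.update ξ K z k = ξ k := fun k hk =>
    Function.update_of_ne (Finset.ne_of_mem_erase hk) _ _
  rw [Finset.sum_congr rfl fun k hk => by rw [this k hk]]
  ring

/-- The density of the zeros at `θ` conditionally on all coefficients but the `K`-th one. -/
noncomputable def condDensity (b : ℝ → ℝ) (v : ℝ≥0) (m K : ℕ) (ξ : ℕ → ℂ) (θ : ℝ) : ℝ≥0∞ :=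
  gaussianPDF 0 (v / 2) (-((b K)⁻¹ * circleTrig b (Function.update ξ K 0) m θ))
    * ∫⁻ r, ENNReal.ofReal |-((b K)⁻¹ * circleTrigDeriv b (Function.update ξ K 0) m θ)
        - freq m K * r| ∂gaussianReal 0 (v / 2)

/-- The conditional Kac–Rice formula, in which only the `K`-th coefficient is random. -/
theorem lintegral_circleZeroSum_update (hK : K ∈ Finset.Icc 1 m) (hbK : b K ≠ 0) (ξ : ℕ → ℂ)
    {v : ℝ≥0} (hv : v ≠ 0) {f : ℝ → ℝ} (hf : Measurable f) (hf0 : ∀ θ, 0 ≤ f θ) :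
    ∫⁻ z, ENNReal.ofReal (circleZeroSum (selfInversivePoly b (Function.update ξ K z) m) f)
        ∂isotropicGaussian v
      = ∫⁻ θ in Set.Ico 0 (2 * Real.pi), ENNReal.ofReal (f θ)
          * condDensity b v m K ξ θ := by
  have hs : v / 2 ≠ 0 := by positivity
  have hm : Measurable fun z : ℂ => ENNReal.ofReal
      (circleZeroSum (selfInversivePoly b (Function.update ξ K z) m) f) := by
    refine ENNReal.measurable_ofReal.comp ?_
    refine measurable_circleZeroSum (ξ := fun k z => Function.update ξ K z k) (fun k _ => ?_) hf
    by_cases hk : k = K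
    · subst hk; simpa using measurable_id'
    · simp [Function.update_of_ne hk]
  rw [isotropicGaussian, lintegral_map hm (by fun_prop)]
  have ha : ∀ t, HasStrictDerivAt
      (fun t => -((b K)⁻¹ * circleTrig b (Function.update ξ K 0) m t))
      (-((b K)⁻¹ * circleTrigDeriv b (Function.update ξ K 0) m t)) t := fun t =>
    ((hasStrictDerivAt_circleTrig b _ m t).const_mul _).neg
  have ha' : Continuous fun t => -((b K)⁻¹ * circleTrigDeriv b (Function.update ξ K 0) m t) :=
    ((continuous_circleTrigDeriv b _ m).const_mul _).neg
  have hfm : Measurable fun θ => ENNReal.ofReal (f θ) := ENNReal.measurable_ofReal.comp hf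
  simp only [condDensity]
  rw [← lintegral_tsum_rotatingLine ha ha' hs measurableSet_Ico hfm]
  refine lintegral_congr_ae ?_
  filter_upwards [ae_rotatingLine_nondegenerate (κ := freq m K) ha hs] with p hp
  -- `circleTrig` vanishes at `t` iff `p`, the value of the `K`-th variable, lies on a line that
  -- rotates with speed `freq m K`
  have h0 : ∀ t, circleTrig b (Function.update ξ K ((p.1 : ℂ) + (p.2 : ℂ) * Complex.I)) m t
      = b K * (p.1 * Real.cos (freq m K * t) + p.2 * Real.sin (freq m K * t)
        - -((b K)⁻¹ * circleTrig b (Function.update ξ K 0) m t)) := by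
    intro t
    rw [circleTrig_update hK, circleTrig_update hK]
    simp
    field_simp
  have h1 : ∀ t, circleTrigDeriv b (Function.update ξ K ((p.1 : ℂ) + (p.2 : ℂ) * Complex.I)) m t
      = -b K * (-((b K)⁻¹ * circleTrigDeriv b (Function.update ξ K 0) m t)
        - freq m K * (p.2 * Real.cos (freq m K * t) - p.1 * Real.sin (freq m K * t))) := by
    intro t
    rw [circleTrigDeriv_update hK, circleTrigDeriv_update hK]
    simp
    field_simp
    ring
  have hz : ∀ t, circleTrig b (Function.update ξ K ((p.1 : ℂ) + (p.2 : ℂ) * Complex.I)) m t = 0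
      ↔ p.1 * Real.cos (freq m K * t) + p.2 * Real.sin (freq m K * t)
        = -((b K)⁻¹ * circleTrig b (Function.update ξ K 0) m t) := by
    intro t
    rw [h0, mul_eq_zero, sub_eq_zero]
    simp [hbK]
  rw [ofReal_circleZeroSum (fun t ht => ?_) hf0]
  · have hset : {θ | θ ∈ Set.Ico 0 (2 * Real.pi) ∧
        circleTrig b (Function.update ξ K ((p.1 : ℂ) + (p.2 : ℂ) * Complex.I)) m θ = 0}
        = {t | t ∈ Set.Ico 0 (2 * Real.pi) ∧
          p.1 * Real.cos (freq m K * t) + p.2 * Real.sin (freq m K * t)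
            = -((b K)⁻¹ * circleTrig b (Function.update ξ K 0) m t) ∧
          -((b K)⁻¹ * circleTrigDeriv b (Function.update ξ K 0) m t)
            - freq m K * (p.2 * Real.cos (freq m K * t) - p.1 * Real.sin (freq m K * t)) ≠ 0} := by
      ext t
      simp only [Set.mem_ofPred_eq, hz]
      exact ⟨fun h => ⟨h.1, h.2, hp t h.2⟩, fun h => ⟨h.1, h.2.1⟩⟩
    rw [hset]
  · rw [h1]
    exact mul_ne_zero (neg_ne_zero.2 hbK) (hp t ((hz t).1 ht))

variable {Ω : Type*} [MeasurableSpace Ω] {P : Measure Ω} [IsProbabilityMeasure P]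
  {ξ : ℕ → Ω → ℂ} {v : ℝ≥0}

theorem isProbabilityMeasure_isotropicGaussian (v : ℝ≥0) :
    IsProbabilityMeasure (isotropicGaussian v) :=
  Measure.isProbabilityMeasure_map (by fun_prop)

/-- Conditioning on all coefficients but the `K`-th one. -/
theorem lintegral_circleZeroSum_eq_lintegral_update (hindep : iIndepFun ξ P)
    (hξ : ∀ k, Measurable (ξ k)) (hlaw : ∀ k, HasLaw (ξ k) (isotropicGaussian v) P)
    {f : ℝ → ℝ} (hf : Measurable f) (K : ℕ) :
    ∫⁻ ω, ENNReal.ofReal (circleZeroSum (selfInversivePoly b (fun k => ξ k ω) m) f) ∂P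
      = ∫⁻ ω, ∫⁻ z, ENNReal.ofReal (circleZeroSum
          (selfInversivePoly b (Function.update (fun k => ξ k ω) K z) m) f)
          ∂isotropicGaussian v ∂P := by
  classical
  have := isProbabilityMeasure_isotropicGaussian v
  let S : Finset ℕ := (Finset.Icc 1 m).erase K
  let Y : Ω → S → ℂ := fun ω k => ξ k ω
  have hY : Measurable Y := measurable_pi_lambda _ fun k => hξ k
  let η : ℕ → ℂ × (S → ℂ) → ℂ := fun k q =>
    if k = K then q.1 else if h : k ∈ S then q.2 ⟨k, h⟩ else 0
  have hη : ∀ k, Measurable (η k) := by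
    intro k
    by_cases hk : k = K
    · simpa only [η, if_pos hk] using measurable_fst
    · by_cases h : k ∈ S
      · simp only [η, if_neg hk, dif_pos h]
        exact (measurable_pi_apply _).comp measurable_snd
      · simp only [η, if_neg hk, dif_neg h]
        exact measurable_const
  let G : ℂ × (S → ℂ) → ℝ≥0∞ := fun q =>
    ENNReal.ofReal (circleZeroSum (selfInversivePoly b (fun k => η k q) m) f)
  have hG : Measurable G :=
    ENNReal.measurable_ofReal.comp (measurable_circleZeroSum (fun k _ => hη k) hf)
  have hpoly : ∀ z ω, selfInversivePoly b (Function.update (fun k => ξ k ω) K z) m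
      = selfInversivePoly b (fun k => η k (z, Y ω)) m := by
    intro z ω
    have : ∀ k ∈ Finset.Icc 1 m, Function.update (fun k => ξ k ω) K z k = η k (z, Y ω) := by
      intro k hk
      by_cases h : k = K
      · subst h; simp [η]
      · have hS : k ∈ S := Finset.mem_erase.2 ⟨h, hk⟩
        simp only [η, if_neg h, dif_pos hS, Function.update_of_ne h, Y]
    simp only [selfInversivePoly]
    rw [Finset.sum_congr rfl fun k hk => by rw [this k hk]]
    rw [Finset.sum_congr (s₁ := Finset.Icc 1 m)
      (f := fun k => Polynomial.C ((b k : ℂ) * (starRingEnd ℂ)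
        (Function.update (fun k => ξ k ω) K z k)) * Polynomial.X ^ (2 * m - k + 1)) rfl
      fun k hk => by rw [this k hk]]
  have hind : IndepFun (ξ K) Y P := by
    have h := hindep.indepFun_finset {K} S (by simp [S]) hξ
    exact h.comp (φ := fun y : ({K} : Finset ℕ) → ℂ => y ⟨K, Finset.mem_singleton_self K⟩)
      (ψ := id) (measurable_pi_apply _) measurable_id
  have hmap := (indepFun_iff_map_prod_eq_prod_map_map (hξ K).aemeasurable hY.aemeasurable).1 hind
  have h1 : ∀ ω, selfInversivePoly b (fun k => ξ k ω) m
      = selfInversivePoly b (fun k => η k (ξ K ω, Y ω)) m := by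
    intro ω
    rw [← hpoly, Function.update_eq_self K (fun k => ξ k ω)]
  simp only [h1, hpoly]
  have h2 : ∫⁻ ω, G (ξ K ω, Y ω) ∂P = ∫⁻ q, G q ∂P.map (fun ω => (ξ K ω, Y ω)) :=
    (lintegral_map hG ((hξ K).prodMk hY)).symm
  have := Measure.isProbabilityMeasure_map (μ := P) hY.aemeasurable
  refine h2.trans ?_
  rw [hmap, (hlaw K).map_eq, lintegral_prod_symm _ hG.aemeasurable,
    lintegral_map (Measurable.lintegral_prod_left' hG) hY]

theorem measurable_condDensity (hξ : ∀ k, Measurable (ξ k)) (K : ℕ) :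
    Measurable fun q : Ω × ℝ => condDensity b v m K (fun k => ξ k q.1) q.2 := by
  have hu : ∀ k, Measurable fun q : Ω × ℝ => Function.update (fun k => ξ k q.1) K 0 k := by
    intro k
    by_cases hk : k = K
    · subst hk; simp
    · simp only [Function.update_of_ne hk]
      exact (hξ k).comp measurable_fst
  have hre : ∀ k, Measurable fun q : Ω × ℝ => (Function.update (fun k => ξ k q.1) K 0 k).re :=
    fun k => Complex.measurable_re.comp (hu k)
  have him : ∀ k, Measurable fun q : Ω × ℝ => (Function.update (fun k => ξ k q.1) K 0 k).im :=
    fun k => Complex.measurable_im.comp (hu k)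
  have hcos : ∀ k, Measurable fun q : Ω × ℝ => Real.cos (freq m k * q.2) := fun k => by fun_prop
  have hsin : ∀ k, Measurable fun q : Ω × ℝ => Real.sin (freq m k * q.2) := fun k => by fun_prop
  have h : Measurable fun q : Ω × ℝ =>
      circleTrig b (Function.update (fun k => ξ k q.1) K 0) m q.2 := by
    unfold circleTrig
    refine Measurable.add (by fun_prop) (Finset.measurable_sum _ fun k _ => ?_)
    exact (((hre k).mul (hcos k)).add ((him k).mul (hsin k))).const_mul _
  have h' : Measurable fun q : Ω × ℝ =>
      circleTrigDeriv b (Function.update (fun k => ξ k q.1) K 0) m q.2 := by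
    unfold circleTrigDeriv
    refine Measurable.add (by fun_prop) (Finset.measurable_sum _ fun k _ => ?_)
    exact ((((him k).mul (hcos k)).sub ((hre k).mul (hsin k))).const_mul _).const_mul _
  refine Measurable.mul ((measurable_gaussianPDF _ _).comp (h.const_mul _).neg) ?_
  refine Measurable.lintegral_prod_right' (f := fun p : (Ω × ℝ) × ℝ =>
    ENNReal.ofReal
      |-((b K)⁻¹ * circleTrigDeriv b (Function.update (fun k => ξ k p.1.1) K 0) m p.1.2)
      - freq m K * p.2|) ?_
  exact ENNReal.measurable_ofReal.comp (measurable_norm.comp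
    ((((h'.comp measurable_fst).const_mul _).neg).sub (measurable_snd.const_mul _)))

theorem lintegral_condDensity (hindep : iIndepFun ξ P) (hξ : ∀ k, Measurable (ξ k))
    (hlaw : ∀ k, HasLaw (ξ k) (isotropicGaussian v) P) (hv : v ≠ 0)
    (hK : K ∈ Finset.Icc 1 m) (hbK : b K ≠ 0) (θ : ℝ) :
    ∫⁻ ω, condDensity b v m K (fun k => ξ k ω) θ ∂P = ENNReal.ofReal (arcDensity b v m θ) := by
  have hs : v / 2 ≠ 0 := by positivity
  have hlawh := map_sum_rotated_gaussian hindep hξ hlaw ((Finset.Icc 1 m).erase K)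
    (fun k => b k) (fun k => b k * freq m k) (fun k => freq m k * θ)
  have key := lintegral_prod_gaussianPDF_mul_lintegral hs
    (∑ k ∈ (Finset.Icc 1 m).erase K, ‖b k‖₊ ^ 2 * (v / 2))
    (∑ k ∈ (Finset.Icc 1 m).erase K, ‖b k * freq m k‖₊ ^ 2 * (v / 2)) hbK (freq m K)
    (Real.cos ((2 * m + 1) / 2 * θ)) (-((2 * m + 1) / 2 * Real.sin ((2 * m + 1) / 2 * θ)))
  rw [Finset.sum_erase_add _ _ hK,
    Finset.sum_erase_add (Finset.Icc 1 m) (fun k : ℕ => ‖b k * freq m k‖₊ ^ 2 * (v / 2)) hK,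
    ← hlawh] at key
  have hre : ∀ k, Measurable fun ω => (ξ k ω).re := fun k => Complex.measurable_re.comp (hξ k)
  have him : ∀ k, Measurable fun ω => (ξ k ω).im := fun k => Complex.measurable_im.comp (hξ k)
  rw [lintegral_map] at key
  · rw [arcDensity, ENNReal.ofReal_mul (gaussianPDFReal_nonneg _ _ _)]
    refine Eq.trans (lintegral_congr fun ω => ?_) key
    rw [condDensity, circleTrig_update hK, circleTrigDeriv_update hK, Prod.fst_sum, Prod.snd_sum]
    simp only [Complex.zero_re, Complex.zero_im, zero_mul, sub_zero, add_zero, mul_zero, zero_add,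
      mul_assoc]
  · refine Measurable.mul ((measurable_gaussianPDF _ _).comp (by fun_prop)) ?_
    exact Measurable.lintegral_prod_right' (f := fun q : (ℝ × ℝ) × ℝ =>
      ENNReal.ofReal |-((b K)⁻¹ * (-((2 * m + 1) / 2 * Real.sin ((2 * m + 1) / 2 * θ)) + q.1.2))
        - freq m K * q.2|) (by fun_prop)
  · exact Finset.measurable_sum _ fun k _ => Measurable.prodMk
      ((((hre k).mul_const _).add ((him k).mul_const _)).const_mul _)
      ((((him k).mul_const _).sub ((hre k).mul_const _)).const_mul _)

/-- The Kac–Rice formula for nonnegative test functions. -/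
theorem lintegral_circleZeroSum (hindep : iIndepFun ξ P) (hξ : ∀ k, Measurable (ξ k))
    (hlaw : ∀ k, HasLaw (ξ k) (isotropicGaussian v) P) (hv : v ≠ 0)
    (hK : K ∈ Finset.Icc 1 m) (hbK : b K ≠ 0) {f : ℝ → ℝ} (hf : Measurable f)
    (hf0 : ∀ θ, 0 ≤ f θ) :
    ∫⁻ ω, ENNReal.ofReal (circleZeroSum (selfInversivePoly b (fun k => ξ k ω) m) f) ∂P
      = ∫⁻ θ in Set.Ico 0 (2 * Real.pi), ENNReal.ofReal (f θ * arcDensity b v m θ) := by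
  have hm := measurable_condDensity (b := b) (m := m) (v := v) hξ K
  have hfm : Measurable fun q : Ω × ℝ => ENNReal.ofReal (f q.2) :=
    ENNReal.measurable_ofReal.comp (hf.comp measurable_snd)
  have hjoint : Measurable fun q : Ω × ℝ =>
      ENNReal.ofReal (f q.2) * condDensity b v m K (fun k => ξ k q.1) q.2 := hfm.mul hm
  calc ∫⁻ ω, ENNReal.ofReal (circleZeroSum (selfInversivePoly b (fun k => ξ k ω) m) f) ∂P
      = ∫⁻ ω, (∫⁻ θ in Set.Ico 0 (2 * Real.pi),
          ENNReal.ofReal (f θ) * condDensity b v m K (fun k => ξ k ω) θ) ∂P := by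
        rw [lintegral_circleZeroSum_eq_lintegral_update hindep hξ hlaw hf K]
        exact lintegral_congr fun ω => lintegral_circleZeroSum_update hK hbK _ hv hf hf0
    _ = ∫⁻ θ in Set.Ico 0 (2 * Real.pi), ∫⁻ ω,
          ENNReal.ofReal (f θ) * condDensity b v m K (fun k => ξ k ω) θ ∂P :=
        lintegral_lintegral_swap (f := fun ω θ =>
          ENNReal.ofReal (f θ) * condDensity b v m K (fun k => ξ k ω) θ) hjoint.aemeasurable
    _ = ∫⁻ θ in Set.Ico 0 (2 * Real.pi), ENNReal.ofReal (f θ * arcDensity b v m θ) := by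
        refine lintegral_congr fun θ => ?_
        have hpair : Measurable fun ω : Ω => (ω, θ) := measurable_id.prodMk measurable_const
        have hmθ := hm.comp hpair
        refine (lintegral_const_mul _ hmθ).trans ?_
        rw [ENNReal.ofReal_mul (hf0 θ), ← lintegral_condDensity hindep hξ hlaw hv hK hbK]
        rfl

theorem integrable_circleZeroSum (hξ : ∀ k, Measurable (ξ k)) {f : ℝ → ℝ} (hf : Measurable f)
    {C : ℝ} (hC : ∀ θ, |f θ| ≤ C) :
    Integrable (fun ω => circleZeroSum (selfInversivePoly b (fun k => ξ k ω) m) f) P :=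
  Integrable.of_bound (measurable_circleZeroSum (fun k _ => hξ k) hf).aestronglyMeasurable
    (((2 * m + 1 : ℕ) : ℝ) * C) (Eventually.of_forall fun ω => by
      have := abs_circleZeroSum_le (selfInversivePoly b (fun k => ξ k ω) m) hC
      rwa [selfInversivePoly_natDegree] at this)

/-- The Kac–Rice formula for bounded test functions: the expected zero counting measure on the
circle has density `arcDensity`. -/
theorem integral_circleZeroSum (hindep : iIndepFun ξ P) (hξ : ∀ k, Measurable (ξ k))
    (hlaw : ∀ k, HasLaw (ξ k) (isotropicGaussian v) P) (hv : v ≠ 0)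
    (hb : ∃ k ∈ Finset.Icc 1 m, b k ≠ 0) {f : ℝ → ℝ} (hf : Measurable f)
    {C : ℝ} (hC : ∀ θ, |f θ| ≤ C) :
    ∫ ω, circleZeroSum (selfInversivePoly b (fun k => ξ k ω) m) f ∂P
      = ∫ θ in (0 : ℝ)..(2 * Real.pi), f θ * arcDensity b v m θ := by
  obtain ⟨K, hK, hbK⟩ := hb
  have hpc := continuous_arcDensity b v m
  have key : ∀ g : ℝ → ℝ, Measurable g → (∀ θ, 0 ≤ g θ) →
      ∫ ω, circleZeroSum (selfInversivePoly b (fun k => ξ k ω) m) g ∂P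
        = ∫ θ in (0 : ℝ)..(2 * Real.pi), g θ * arcDensity b v m θ := by
    intro g hg hg0
    rw [integral_eq_lintegral_of_nonneg_ae
      (Eventually.of_forall fun ω => circleZeroSum_nonneg _ hg0)
      (measurable_circleZeroSum (fun k _ => hξ k) hg).aestronglyMeasurable,
      lintegral_circleZeroSum hindep hξ hlaw hv hK hbK hg hg0,
      intervalIntegral.integral_of_le Real.two_pi_pos.le, ← integral_Ico_eq_integral_Ioc,
      integral_eq_lintegral_of_nonneg_ae
      (Eventually.of_forall fun θ => mul_nonneg (hg0 θ) (arcDensity_nonneg _ _ _ _))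
      (hg.mul hpc.measurable).aestronglyMeasurable]
  have hC0 : 0 ≤ C := (abs_nonneg _).trans (hC 0)
  have hfC : ∀ θ, 0 ≤ f θ + C := fun θ => by linarith [neg_abs_le (f θ), hC θ]
  have h1 := key (fun θ => f θ + C) (hf.add_const C) hfC
  have h2 := key (fun _ => C) measurable_const fun _ => hC0
  have hi : Integrable (fun ω => circleZeroSum (selfInversivePoly b (fun k => ξ k ω) m) f) P :=
    integrable_circleZeroSum hξ hf hC
  have hiC : Integrable (fun ω => circleZeroSum (selfInversivePoly b (fun k => ξ k ω) m)
      fun _ => C) P := integrable_circleZeroSum hξ measurable_const (C := |C|) fun _ => le_rfl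
  have hj : IntervalIntegrable (fun θ => f θ * arcDensity b v m θ) volume 0 (2 * Real.pi) := by
    rw [intervalIntegrable_iff_integrableOn_Ioc_of_le Real.two_pi_pos.le]
    exact ((hpc.integrableOn_Ioc (a := 0) (b := 2 * Real.pi))).bdd_mul (c := C)
      hf.aestronglyMeasurable (Eventually.of_forall hC)
  have hjC : IntervalIntegrable (fun θ => C * arcDensity b v m θ) volume 0 (2 * Real.pi) :=
    (hpc.const_mul C).intervalIntegrable _ _
  simp only [circleZeroSum_add, add_mul] at h1
  rw [integral_add hi hiC, intervalIntegral.integral_add hj hjC, h2] at h1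
  exact add_right_cancel h1

end KacRice

/-! ### The density of zeros -/

section ZeroDensity

variable {Ω : Type*} [MeasurableSpace Ω] {P : Measure Ω} {ξ : ℕ → Ω → ℂ}
  {v : ℝ≥0} {b : ℝ → ℝ} {m : ℕ}

/-- The variables may be replaced by measurable ones without changing the polynomials, up to a
null set. -/
theorem exists_measurable_version (hindep : iIndepFun ξ P)
    (hlaw : ∀ k, HasLaw (ξ k) (isotropicGaussian v) P) :
    ∃ η : ℕ → Ω → ℂ, (∀ k, Measurable (η k)) ∧ iIndepFun η P ∧
      (∀ k, HasLaw (η k) (isotropicGaussian v) P) ∧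
      ∀ᵐ ω ∂P, (fun k => ξ k ω) = fun k => η k ω := by
  refine ⟨fun k => (hlaw k).aemeasurable.mk, fun k => (hlaw k).aemeasurable.measurable_mk,
    (iIndepFun_congr fun k => (hlaw k).aemeasurable.ae_eq_mk).1 hindep,
    fun k => (hlaw k).congr (hlaw k).aemeasurable.ae_eq_mk.symm, ?_⟩
  filter_upwards [ae_all_iff.2 fun k => (hlaw k).aemeasurable.ae_eq_mk] with ω hω
  exact funext hω

variable [IsProbabilityMeasure P]

theorem integrable_circleZeroSum_of_hasLaw (hindep : iIndepFun ξ P)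
    (hlaw : ∀ k, HasLaw (ξ k) (isotropicGaussian v) P) {f : ℝ → ℝ} (hf : Measurable f)
    {C : ℝ} (hC : ∀ θ, |f θ| ≤ C) :
    Integrable (fun ω => circleZeroSum (selfInversivePoly b (fun k => ξ k ω) m) f) P := by
  obtain ⟨η, hη, -, -, hae⟩ := exists_measurable_version hindep hlaw
  refine (integrable_circleZeroSum (b := b) (m := m) hη hf hC).congr ?_
  filter_upwards [hae] with ω hω
  rw [hω]

theorem integral_circleZeroSum_of_hasLaw (hindep : iIndepFun ξ P)
    (hlaw : ∀ k, HasLaw (ξ k) (isotropicGaussian v) P) (hv : v ≠ 0)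
    (hb : ∃ k ∈ Finset.Icc 1 m, b k ≠ 0) {f : ℝ → ℝ} (hf : Measurable f)
    {C : ℝ} (hC : ∀ θ, |f θ| ≤ C) :
    ∫ ω, circleZeroSum (selfInversivePoly b (fun k => ξ k ω) m) f ∂P
      = ∫ θ in (0 : ℝ)..(2 * Real.pi), f θ * arcDensity b v m θ := by
  obtain ⟨η, hη, hind, hl, hae⟩ := exists_measurable_version hindep hlaw
  rw [← integral_circleZeroSum hind hη hl hv hb hf hC]
  refine integral_congr_ae ?_
  filter_upwards [hae] with ω hω
  rw [hω]

theorem abs_indicator_one_le (s : Set ℝ) (θ : ℝ) : |s.indicator (1 : ℝ → ℝ) θ| ≤ 1 := by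
  by_cases h : θ ∈ s
  · simp [h]
  · simp [h]

theorem expectedArcCount_eq_integral (hindep : iIndepFun ξ P)
    (hlaw : ∀ k, HasLaw (ξ k) (isotropicGaussian v) P) (hv : v ≠ 0)
    (hb : ∃ k ∈ Finset.Icc 1 m, b k ≠ 0) {x : ℝ} (hx : x ∈ Set.Icc 0 (2 * Real.pi)) :
    expectedArcCount P b ξ m x = ∫ θ in (0 : ℝ)..x, arcDensity b v m θ := by
  rw [expectedArcCount]
  simp only [zeroCount_unitArc _ hx]
  rw [integral_circleZeroSum_of_hasLaw hindep hlaw hv hb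
    (measurable_one.indicator measurableSet_Icc) (abs_indicator_one_le _),
    intervalIntegral.integral_of_le Real.two_pi_pos.le, intervalIntegral.integral_of_le hx.1]
  have h1 : ∀ θ, (Set.Icc 0 x).indicator (1 : ℝ → ℝ) θ * arcDensity b v m θ
      = (Set.Icc 0 x).indicator (arcDensity b v m) θ := by
    intro θ
    by_cases h : θ ∈ Set.Icc 0 x
    · simp [h]
    · simp [h]
  simp only [h1]
  rw [setIntegral_indicator measurableSet_Icc]
  congr 2
  ext θ
  exact ⟨fun h => ⟨h.1.1, h.2.2⟩, fun h => ⟨⟨h.1, h.2.trans hx.2⟩, h.1.le, h.2⟩⟩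

theorem hasDerivWithinAt_expectedArcCount (hindep : iIndepFun ξ P)
    (hlaw : ∀ k, HasLaw (ξ k) (isotropicGaussian v) P) (hv : v ≠ 0)
    (hb : ∃ k ∈ Finset.Icc 1 m, b k ≠ 0) {φ : ℝ} (hφ : φ ∈ Set.Icc 0 (2 * Real.pi)) :
    HasDerivWithinAt (expectedArcCount P b ξ m) (arcDensity b v m φ)
      (Set.Icc 0 (2 * Real.pi)) φ := by
  have hpc := continuous_arcDensity b v m
  refine HasDerivWithinAt.congr
    (f := fun x => ∫ θ in (0 : ℝ)..x, arcDensity b v m θ) ?_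
    (fun x hx => expectedArcCount_eq_integral hindep hlaw hv hb hx)
    (expectedArcCount_eq_integral hindep hlaw hv hb hφ)
  exact (intervalIntegral.integral_hasDerivAt_right (hpc.intervalIntegrable _ _)
    hpc.stronglyMeasurable.stronglyMeasurableAtFilter hpc.continuousAt).hasDerivWithinAt

theorem zeroDensity_eq_arcDensity (hindep : iIndepFun ξ P)
    (hlaw : ∀ k, HasLaw (ξ k) (isotropicGaussian v) P) (hv : v ≠ 0)
    (hb : ∃ k ∈ Finset.Icc 1 m, b k ≠ 0) {φ : ℝ} (hφ : φ ∈ Set.Icc 0 (2 * Real.pi)) :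
    zeroDensity P b ξ m φ = arcDensity b v m φ :=
  (hasDerivWithinAt_expectedArcCount hindep hlaw hv hb hφ).derivWithin
    (uniqueDiffOn_Icc Real.two_pi_pos φ hφ)

end ZeroDensity

/-! ### Mean absolute values of Gaussian variables -/

section MeanAbs

theorem meanAbs_mul (c a s : ℝ) : meanAbs (c * a) (c * s) = |c| * meanAbs a s := by
  rw [meanAbs, meanAbs, ← integral_const_mul]
  refine integral_congr_ae (Eventually.of_forall fun z => ?_)
  simp only
  rw [← abs_mul]
  congr 1
  ring

theorem meanAbs_neg_right (a s : ℝ) : meanAbs a (-s) = meanAbs a s := by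
  have h : gaussianReal 0 1 = (gaussianReal 0 1).map (fun z => -z) := by
    rw [gaussianReal_map_neg, neg_zero]
  rw [meanAbs, meanAbs]
  conv_rhs => rw [h]
  rw [integral_map (by fun_prop) (by fun_prop)]
  simp

theorem meanAbs_neg_left (a s : ℝ) : meanAbs (-a) s = meanAbs a s := by
  rw [← meanAbs_neg_right a s]
  have := meanAbs_mul (-1) a (-s)
  simpa using this

/-- By symmetry of `Z`, `E|a + sZ| = E max(|a|, |sZ|)`. -/
theorem meanAbs_eq_integral_max (a s : ℝ) :
    meanAbs a s = ∫ z, max |a| |s * z| ∂gaussianReal 0 1 := by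
  have h1 : meanAbs a s = (meanAbs a s + meanAbs a (-s)) / 2 := by
    rw [meanAbs_neg_right]; ring
  rw [h1, meanAbs, meanAbs, ← integral_add (integrable_meanAbs a s) (integrable_meanAbs a (-s)),
    ← integral_div]
  refine integral_congr_ae (Eventually.of_forall fun z => ?_)
  simp only
  rw [neg_mul, ← sub_eq_add_neg]
  generalize s * z = t
  rcases le_total |a| |t| with h | h
  · rw [max_eq_right h]
    cases abs_cases a <;> cases abs_cases t <;> cases abs_cases (a + t) <;>
      cases abs_cases (a - t) <;> linarith
  · rw [max_eq_left h]
    cases abs_cases a <;> cases abs_cases t <;> cases abs_cases (a + t) <;>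
      cases abs_cases (a - t) <;> linarith

/-- Adding independent symmetric noise preserves the order of absolute values in the mean. -/
theorem meanAbs_mono {a a' : ℝ} (h : |a| ≤ |a'|) (s : ℝ) : meanAbs a s ≤ meanAbs a' s := by
  have hi : ∀ c : ℝ, Integrable (fun z => max |c| |s * z|) (gaussianReal 0 1) := fun c =>
    (integrable_const _).sup
      (((memLp_id_gaussianReal (μ := 0) (v := 1) 1).integrable le_rfl).const_mul s).abs
  rw [meanAbs_eq_integral_max, meanAbs_eq_integral_max]
  exact integral_mono (hi a) (hi a') fun z => max_le_max_right _ h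

theorem abs_le_meanAbs (a s : ℝ) : |a| ≤ meanAbs a s := by
  have hi : Integrable (fun z => max |a| |s * z|) (gaussianReal 0 1) :=
    (integrable_const _).sup
      (((memLp_id_gaussianReal (μ := 0) (v := 1) 1).integrable le_rfl).const_mul s).abs
  rw [meanAbs_eq_integral_max]
  calc |a| = ∫ _z, |a| ∂gaussianReal 0 1 := by simp
    _ ≤ _ := integral_mono (integrable_const _) hi fun z => le_max_left _ _

theorem meanAbs_zero_one : meanAbs 0 1 = Real.sqrt (2 / Real.pi) := by
  have hpos : (0 : ℝ) < 1 / 2 := by norm_num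
  have hsym : meanAbs 0 1 = 2 * ∫ z in Set.Ioi (0 : ℝ), (Real.sqrt (2 * Real.pi))⁻¹
      * (z * Real.exp (-(1 / 2) * z ^ 2)) := by
    rw [meanAbs, integral_gaussianReal_eq_integral_smul one_ne_zero]
    have h1 : ∀ z : ℝ, gaussianPDFReal 0 1 z • |0 + 1 * z|
        = (fun x => (Real.sqrt (2 * Real.pi))⁻¹ * (x * Real.exp (-(1 / 2) * x ^ 2))) |z| := by
      intro z
      simp only [gaussianPDFReal, smul_eq_mul, sq_abs, zero_add, one_mul, sub_zero, NNReal.coe_one,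
        mul_one]
      rw [mul_assoc, mul_comm (Real.exp _)]
      congr 3
      ring
    simp only [h1]
    rw [integral_comp_abs (f := fun x => (Real.sqrt (2 * Real.pi))⁻¹
      * (x * Real.exp (-(1 / 2) * x ^ 2)))]
  have h2 : ∫ z in Set.Ioi (0 : ℝ), z * Real.exp (-(1 / 2) * z ^ 2) = 1 := by
    have := integral_mul_cexp_neg_mul_sq (b := (1 / 2 : ℂ)) (by norm_num)
    have h3 : (∫ z in Set.Ioi (0 : ℝ), ((z * Real.exp (-(1 / 2) * z ^ 2) : ℝ) : ℂ)) = 1 := by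
      rw [show (1 : ℂ) = (2 * (1 / 2 : ℂ))⁻¹ by norm_num, ← this]
      refine integral_congr_ae (Eventually.of_forall fun z => ?_)
      push_cast
      rfl
    have h4 := integral_ofReal (𝕜 := ℂ) (μ := volume.restrict (Set.Ioi (0 : ℝ)))
      (f := fun z : ℝ => z * Real.exp (-(1 / 2) * z ^ 2))
    exact Complex.ofReal_injective (h4.symm.trans h3)
  rw [hsym, integral_const_mul, h2, mul_one, Real.sqrt_mul (by norm_num),
    Real.sqrt_div (by norm_num)]
  have h3 : Real.sqrt 2 ^ 2 = 2 := Real.sq_sqrt (by norm_num)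
  have h4 : Real.sqrt 2 ≠ 0 := by positivity
  have h5 : Real.sqrt Real.pi ≠ 0 := by have := Real.pi_pos; positivity
  field_simp
  linarith

end MeanAbs

/-! ### The normalized density -/

section Profile

/-- The normalized density of circle zeros as a function of `y = sin((2m+1)θ/2)`, the variance `V`
of `circleTrig` and the normalized ratio `q` of standard deviations of `circleTrigDeriv` and
`circleTrig`. -/
noncomputable def profile (V q y : ℝ) : ℝ :=
  (Real.sqrt (2 * Real.pi))⁻¹ * Real.exp (-(1 - y ^ 2) / (2 * V))
    * meanAbs (y / (2 * Real.sqrt V)) q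

/-- The density depends on `θ` only through `sin((2m+1)θ/2)`; the normalization by `2m+1` is
absorbed by the scaling of `meanAbs`. -/
theorem arcDensity_div_eq_profile {b : ℝ → ℝ} {v : ℝ≥0} {m : ℕ} (hV : 0 < trigVar b v m) (θ : ℝ) :
    arcDensity b v m θ / (2 * m + 1)
      = profile (trigVar b v m)
          (Real.sqrt (trigDerivVar b v m / ((2 * m + 1) ^ 2 * trigVar b v m)))
          (Real.sin ((2 * m + 1) / 2 * θ)) := by
  set n : ℝ := 2 * m + 1 with hn
  have hn0 : 0 < n := by positivity
  have hV' : (0 : ℝ) < trigVar b v m := hV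
  have hsV : 0 < Real.sqrt (trigVar b v m) := Real.sqrt_pos.2 hV'
  have h1 : meanAbs (-(n / 2 * Real.sin (n / 2 * θ))) (Real.sqrt (trigDerivVar b v m))
      = n * Real.sqrt (trigVar b v m)
        * meanAbs (Real.sin (n / 2 * θ) / (2 * Real.sqrt (trigVar b v m)))
          (Real.sqrt (trigDerivVar b v m / (n ^ 2 * trigVar b v m))) := by
    have hc : 0 < n * Real.sqrt (trigVar b v m) := mul_pos hn0 hsV
    conv_rhs => rw [← abs_of_pos hc]
    rw [← meanAbs_mul, meanAbs_neg_left]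
    congr 1
    · field_simp
    · rw [Real.sqrt_div' _ (by positivity), Real.sqrt_mul (by positivity), Real.sqrt_sq hn0.le]
      field_simp
  rw [arcDensity, ← hn, h1, profile, gaussianPDFReal, Real.sqrt_mul (by positivity), sub_zero,
    ← Real.cos_sq' (n / 2 * θ)]
  field_simp

theorem continuousOn_profile :
    ContinuousOn (fun p : (ℝ × ℝ) × ℝ => profile p.1.1 p.1.2 p.2) {p | 0 < p.1.1} := by
  unfold profile
  have h1 : ContinuousOn (fun p : (ℝ × ℝ) × ℝ => p.2 / (2 * Real.sqrt p.1.1)) {p | 0 < p.1.1} :=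
    ContinuousOn.div (by fun_prop) (by fun_prop) fun p hp =>
      (mul_pos two_pos (Real.sqrt_pos.2 hp)).ne'
  refine ContinuousOn.mul (continuousOn_const.mul (ContinuousOn.rexp ?_)) ?_
  · exact ContinuousOn.div (by fun_prop) (by fun_prop) fun p hp => (mul_pos two_pos hp).ne'
  · exact continuous_meanAbs.comp_continuousOn
      (f := fun p : (ℝ × ℝ) × ℝ => (p.2 / (2 * Real.sqrt p.1.1), p.1.2)) (h1.prodMk (by fun_prop))

theorem continuous_profile {V : ℝ} (hV : 0 < V) (q : ℝ) : Continuous (profile V q) := by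
  have := continuousOn_profile.comp_continuous (f := fun y : ℝ => ((V, q), y)) (by fun_prop)
    fun _ => hV
  exact this

theorem profile_neg (V q y : ℝ) : profile V q (-y) = profile V q y := by
  simp only [profile, neg_sq, neg_div, meanAbs_neg_left]

theorem strictMonoOn_profile {V : ℝ} (hV : 0 < V) (q : ℝ) :
    StrictMonoOn (profile V q) (Set.Ici 0) := by
  intro y hy y' hy' hlt
  have hy0 : 0 ≤ y := hy
  have hsV : 0 < Real.sqrt V := Real.sqrt_pos.2 hV
  have hpi := Real.pi_pos
  have h1 : Real.exp (-(1 - y ^ 2) / (2 * V)) < Real.exp (-(1 - y' ^ 2) / (2 * V)) := by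
    refine Real.exp_lt_exp.2 (div_lt_div_of_pos_right ?_ (by positivity))
    nlinarith
  have h2 : meanAbs (y / (2 * Real.sqrt V)) q ≤ meanAbs (y' / (2 * Real.sqrt V)) q := by
    refine meanAbs_mono ?_ q
    rw [abs_of_nonneg (by positivity), abs_of_nonneg (div_nonneg hy' (by positivity))]
    exact div_le_div_of_nonneg_right hlt.le (by positivity)
  have h3 : 0 < meanAbs (y' / (2 * Real.sqrt V)) q := by
    refine lt_of_lt_of_le ?_ (abs_le_meanAbs _ _)
    have : 0 < y' := lt_of_le_of_lt hy0 hlt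
    positivity
  unfold profile
  rw [mul_assoc, mul_assoc]
  refine mul_lt_mul_of_pos_left ?_ (by positivity)
  calc _ ≤ Real.exp (-(1 - y ^ 2) / (2 * V)) * meanAbs (y' / (2 * Real.sqrt V)) q :=
        mul_le_mul_of_nonneg_left h2 (Real.exp_pos _).le
    _ < _ := mul_lt_mul_of_pos_right h1 h3

/-- The limiting profile with `q = 1/2` has integral `1/2` over a period. -/
theorem integral_profile_sin {V : ℝ} (hV : 0 < V) :
    ∫ t in (0 : ℝ)..Real.pi, profile V (1 / 2) (Real.sin t) = 1 / 2 := by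
  lift V to ℝ≥0 using hV.le
  have hV0 : V ≠ 0 := by rintro rfl; simp at hV
  have hsV : 0 < Real.sqrt V := Real.sqrt_pos.2 hV
  have h := lintegral_gaussianPDF_cos_mul hV0
  have h1 : ∀ t, gaussianPDF 0 V (-Real.cos t)
      * ∫⁻ r, ENNReal.ofReal |Real.sin t - r| ∂gaussianReal 0 V
      = ENNReal.ofReal (2 * profile V (1 / 2) (Real.sin t)) := by
    intro t
    have h2 := lintegral_abs_add_mul_gaussianReal (Real.sin t) (-1) V
    simp only [neg_one_mul, ← sub_eq_add_neg, meanAbs_neg_right] at h2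
    rw [h2, gaussianPDF, ← ENNReal.ofReal_mul (gaussianPDFReal_nonneg _ _ _)]
    congr 1
    have h3 : meanAbs (Real.sin t) (Real.sqrt V)
        = 2 * Real.sqrt V * meanAbs (Real.sin t / (2 * Real.sqrt V)) (1 / 2) := by
      have hc : 0 < 2 * Real.sqrt V := by positivity
      conv_rhs => rw [← abs_of_pos hc]
      rw [← meanAbs_mul, abs_of_pos hc]
      congr 1
      · field_simp
      · ring
    rw [h3, gaussianPDFReal, profile, Real.sqrt_mul (by positivity), sub_zero, neg_sq,
      ← Real.cos_sq' t]
    field_simp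
  simp only [h1] at h
  have hc : Continuous fun t => 2 * profile V (1 / 2) (Real.sin t) :=
    ((continuous_profile hV _).comp Real.continuous_sin).const_mul 2
  have hnn : ∀ t, 0 ≤ 2 * profile V (1 / 2) (Real.sin t) := by
    intro t
    unfold profile
    have := meanAbs_nonneg (Real.sin t / (2 * Real.sqrt V)) (1 / 2)
    positivity
  have h4 : ∫ t in (0 : ℝ)..Real.pi, 2 * profile V (1 / 2) (Real.sin t) = 1 := by
    rw [intervalIntegral.integral_of_le Real.pi_pos.le, ← integral_Ico_eq_integral_Ioc,
      integral_eq_lintegral_of_nonneg_ae (Eventually.of_forall hnn) hc.aestronglyMeasurable, h]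
    simp
  rw [intervalIntegral.integral_const_mul] at h4
  linarith

end Profile

/-! ### Averaging against rapidly oscillating periodic functions -/

section Fejer

theorem exists_abs_le_of_periodic {g : ℝ → ℝ} (hg : Continuous g) {T : ℝ} (hT : 0 < T)
    (hper : Function.Periodic g T) : ∃ B, ∀ t, |g t| ≤ B := by
  obtain ⟨B, hB⟩ := (isCompact_Icc (a := 0) (b := T)).exists_bound_of_continuousOn hg.continuousOn
  refine ⟨B, fun t => ?_⟩
  obtain ⟨y, hy, hy'⟩ := hper.exists_mem_Ico₀ hT t
  rw [hy']
  exact hB y ⟨hy.1, hy.2.le⟩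

/-- Continuity of translations in `L¹`, for bounded, compactly supported, almost everywhere
continuous functions. -/
theorem tendsto_integral_abs_translate_sub {F : ℝ → ℝ} (hF : Measurable F) {C R : ℝ}
    (hFC : ∀ θ, |F θ| ≤ C) (hR : ∀ θ, R < |θ| → F θ = 0) (hcont : ∀ᵐ θ, ContinuousAt F θ) :
    Tendsto (fun h => ∫ θ, |F (θ + h) - F θ|) (𝓝 0) (𝓝 0) := by
  suffices h : Tendsto (fun h => ∫ θ, |F (θ + h) - F θ|) (𝓝 0) (𝓝 (∫ _θ : ℝ, (0 : ℝ))) by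
    simpa using h
  refine tendsto_integral_filter_of_dominated_convergence
    ((Set.Icc (-(R + 1)) (R + 1)).indicator fun _ => 2 * C) ?_ ?_ ?_ ?_
  · exact Eventually.of_forall fun h =>
      (((hF.comp (measurable_add_const h)).sub hF).norm).aestronglyMeasurable
  · have h1 : ∀ᶠ h : ℝ in 𝓝 0, |h| < 1 := by
      have := (continuous_abs (G := ℝ)).tendsto 0
      rw [abs_zero] at this
      exact this.eventually (gt_mem_nhds zero_lt_one)
    filter_upwards [h1] with h hh
    refine Eventually.of_forall fun θ => ?_
    rw [Real.norm_eq_abs, abs_abs]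
    by_cases hθ : θ ∈ Set.Icc (-(R + 1)) (R + 1)
    · rw [Set.indicator_of_mem hθ]
      calc |F (θ + h) - F θ| ≤ |F (θ + h)| + |F θ| := abs_sub _ _
        _ ≤ 2 * C := by linarith [hFC (θ + h), hFC θ]
    · rw [Set.indicator_of_notMem hθ]
      have hθ' : R + 1 < |θ| := by
        by_contra hc
        push Not at hc
        exact hθ (abs_le.1 hc)
      have h2 : |θ| ≤ |θ + h| + |h| := by
        calc |θ| = |(θ + h) - h| := by rw [add_sub_cancel_right]
          _ ≤ _ := abs_sub _ _
      rw [hR θ (by linarith), hR (θ + h) (by linarith)]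
      simp
  · rw [integrable_indicator_iff measurableSet_Icc]
    exact integrableOn_const (by simp)
  · filter_upwards [hcont] with θ hθ
    have h1 : Tendsto (fun h : ℝ => θ + h) (𝓝 0) (𝓝 θ) := by
      simpa using (continuous_const_add θ).tendsto (0 : ℝ)
    have h2 := ((hθ.tendsto.comp h1).sub_const (F θ)).abs
    simpa using h2

/-- A rapidly oscillating periodic function averages out. The integral is invariant under
translations by a fraction `s` of the short period; averaging over `s` replaces the periodic
function by its mean, at the cost of an `L¹`-small translation of `F`. -/
theorem tendsto_integral_mul_comp_periodic {g : ℝ → ℝ} (hg : Continuous g) {T : ℝ} (hT : 0 < T)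
    (hper : Function.Periodic g T) {c : ℕ → ℝ} (hc : Tendsto c atTop atTop) {F : ℝ → ℝ}
    (hF : Measurable F) {C R : ℝ} (hFC : ∀ θ, |F θ| ≤ C) (hR : ∀ θ, R < |θ| → F θ = 0)
    (hcont : ∀ᵐ θ, ContinuousAt F θ) :
    Tendsto (fun m => ∫ θ, F θ * g (c m * θ)) atTop
      (𝓝 ((T⁻¹ * ∫ t in (0 : ℝ)..T, g t) * ∫ θ, F θ)) := by
  obtain ⟨B, hB⟩ := exists_abs_le_of_periodic hg hT hper
  have hB0 : 0 ≤ B := (abs_nonneg _).trans (hB 0)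
  have hFi : Integrable F := by
    have : F = (Set.Icc (-R) R).indicator F := by
      funext θ
      by_cases hθ : θ ∈ Set.Icc (-R) R
      · rw [Set.indicator_of_mem hθ]
      · rw [Set.indicator_of_notMem hθ]
        refine hR θ ?_
        by_contra hc
        push Not at hc
        exact hθ (abs_le.1 hc)
    rw [this, integrable_indicator_iff measurableSet_Icc]
    exact Measure.integrableOn_of_bounded (M := C) (by simp) hF.aestronglyMeasurable
      (Eventually.of_forall hFC)
  have hprod : ∀ k : ℝ → ℝ, Continuous k → (∀ t, |k t| ≤ B) → Integrable fun θ => F θ * k θ :=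
    fun k hk hkB => hFi.mul_bdd (c := B) hk.aestronglyMeasurable (Eventually.of_forall hkB)
  -- averaging over the phase
  have havg : ∀ a : ℝ, IntervalIntegrable (fun s : ℝ => ∫ θ, F θ * g (a * θ + s * T)) volume 0 1 ∧
      ∫ s in (0 : ℝ)..1, ∫ θ, F θ * g (a * θ + s * T)
        = (T⁻¹ * ∫ t in (0 : ℝ)..T, g t) * ∫ θ, F θ := by
    intro a
    have hint : Integrable (Function.uncurry fun s θ : ℝ => F θ * g (a * θ + s * T))
        ((volume.restrict (Set.Ioc (0 : ℝ) 1)).prod volume) := by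
      have h1 : Integrable (fun p : ℝ × ℝ => F p.2)
          ((volume.restrict (Set.Ioc (0 : ℝ) 1)).prod volume) := hFi.comp_snd _
      exact h1.mul_bdd (c := B) (by fun_prop : Continuous fun p : ℝ × ℝ =>
        g (a * p.2 + p.1 * T)).aestronglyMeasurable (Eventually.of_forall fun p => hB _)
    refine ⟨?_, ?_⟩
    · rw [intervalIntegrable_iff_integrableOn_Ioc_of_le zero_le_one]
      exact hint.integral_prod_left
    · rw [intervalIntegral.integral_of_le zero_le_one, integral_integral_swap hint,
        ← integral_const_mul]
      refine integral_congr_ae (Eventually.of_forall fun θ => ?_)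
      simp only
      rw [integral_const_mul, mul_comm]
      congr 1
      rw [← intervalIntegral.integral_of_le zero_le_one]
      have h2 := intervalIntegral.integral_comp_mul_add (a := 0) (b := 1) g hT.ne' (a * θ)
      simp only [mul_zero, zero_add, mul_one, smul_eq_mul] at h2
      have h3 : ∫ s in (0 : ℝ)..1, g (a * θ + s * T) = ∫ s in (0 : ℝ)..1, g (T * s + a * θ) := by
        refine intervalIntegral.integral_congr fun s _ => ?_
        congr 1
        ring
      rw [h3, h2, add_comm T, hper.intervalIntegral_add_eq (a * θ) 0, zero_add]
  have hΔ := tendsto_integral_abs_translate_sub hF hFC hR hcont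
  rw [Metric.tendsto_atTop]
  intro ε hε
  have hε' : 0 < ε / (B + 1) := by positivity
  obtain ⟨δ, hδ, hδ'⟩ := Metric.tendsto_nhds_nhds.1 hΔ _ hε'
  have h1 : ∀ᶠ m in atTop, T / δ < c m ∧ 0 < c m :=
    (hc.eventually_gt_atTop (T / δ)).and (hc.eventually_gt_atTop 0)
  obtain ⟨M, hM⟩ := eventually_atTop.1 h1
  refine ⟨M, fun m hm => ?_⟩
  obtain ⟨hcm, hcm0⟩ := hM m hm
  have hdiff : ∀ s ∈ Set.Icc (0 : ℝ) 1,
      |(∫ θ, F θ * g (c m * θ)) - ∫ θ, F θ * g (c m * θ + s * T)| ≤ B * (ε / (B + 1)) := by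
    intro s hs
    have ht : ∫ θ, F θ * g (c m * θ)
        = ∫ θ, F (θ + s * T / c m) * g (c m * θ + s * T) := by
      rw [← integral_add_right_eq_self _ (s * T / c m)]
      refine integral_congr_ae (Eventually.of_forall fun θ => ?_)
      simp only
      congr 2
      field_simp
    have hFi' : Integrable fun θ => F (θ + s * T / c m) := hFi.comp_add_right _
    have hi1 : Integrable fun θ => F (θ + s * T / c m) * g (c m * θ + s * T) :=
      hFi'.mul_bdd (c := B) (by fun_prop : Continuous fun θ : ℝ =>
        g (c m * θ + s * T)).aestronglyMeasurable (Eventually.of_forall fun θ => hB _)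
    rw [ht, ← integral_sub hi1 (hprod _ (by fun_prop) fun θ => hB _)]
    have hh : |s * T / c m| < δ := by
      rw [abs_of_nonneg (div_nonneg (mul_nonneg hs.1 hT.le) hcm0.le), div_lt_iff₀ hcm0]
      rw [div_lt_iff₀ hδ] at hcm
      nlinarith [hs.2]
    have hbi : Integrable fun θ => B * |F (θ + s * T / c m) - F θ| :=
      (hFi'.sub hFi).abs.const_mul B
    have h2 := hδ' (x := s * T / c m) (by rw [Real.dist_eq, sub_zero]; exact hh)
    rw [Real.dist_eq, sub_zero] at h2
    calc |∫ θ, (F (θ + s * T / c m) * g (c m * θ + s * T) - F θ * g (c m * θ + s * T))|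
        ≤ ∫ θ, B * |F (θ + s * T / c m) - F θ| := by
          refine (Real.norm_eq_abs _).symm.trans_le (norm_integral_le_of_norm_le hbi
            (Eventually.of_forall fun θ => ?_))
          rw [← sub_mul, Real.norm_eq_abs, abs_mul, mul_comm]
          exact mul_le_mul_of_nonneg_right (hB _) (abs_nonneg _)
      _ = B * ∫ θ, |F (θ + s * T / c m) - F θ| := integral_const_mul _ _
      _ ≤ B * (ε / (B + 1)) := mul_le_mul_of_nonneg_left ((le_abs_self _).trans h2.le) hB0
  obtain ⟨hJ, hJ'⟩ := havg (c m)
  rw [Real.dist_eq, ← hJ']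
  have h3 : (∫ θ, F θ * g (c m * θ)) - ∫ s in (0 : ℝ)..1, ∫ θ, F θ * g (c m * θ + s * T)
      = ∫ s in (0 : ℝ)..1, ((∫ θ, F θ * g (c m * θ)) - ∫ θ, F θ * g (c m * θ + s * T)) := by
    rw [intervalIntegral.integral_sub intervalIntegrable_const hJ]
    simp
  rw [h3]
  have h4 := intervalIntegral.norm_integral_le_of_norm_le_const (a := 0) (b := 1)
    (C := B * (ε / (B + 1)))
    (f := fun s => (∫ θ, F θ * g (c m * θ)) - ∫ θ, F θ * g (c m * θ + s * T)) fun s hs => by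
      rw [Set.uIoc_of_le zero_le_one] at hs
      exact hdiff s ⟨hs.1.le, hs.2⟩
  rw [Real.norm_eq_abs] at h4
  refine lt_of_le_of_lt h4 ?_
  rw [sub_zero, abs_one, mul_one, mul_div_assoc', div_lt_iff₀ (by positivity)]
  nlinarith

theorem measurable_and_bounded_indicator_Icc {f : ℝ → ℝ} {x : ℝ} (hx : 0 ≤ x)
    (hf : ContinuousOn f (Set.Icc 0 x)) :
    Measurable ((Set.Icc 0 x).indicator f) ∧ ∃ C, ∀ θ, |(Set.Icc 0 x).indicator f θ| ≤ C := by
  classical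
  obtain ⟨C, hC⟩ := (isCompact_Icc (a := 0) (b := x)).exists_bound_of_continuousOn hf
  have hC0 : 0 ≤ C := (norm_nonneg _).trans (hC 0 ⟨le_rfl, hx⟩)
  refine ⟨?_, C, fun θ => ?_⟩
  · rw [← Set.piecewise_eq_indicator]
    exact hf.measurable_piecewise continuousOn_const measurableSet_Icc
  · by_cases hθ : θ ∈ Set.Icc 0 x
    · rw [Set.indicator_of_mem hθ]; exact hC θ hθ
    · rw [Set.indicator_of_notMem hθ]; simpa using hC0

/-- Averaging against a rapidly oscillating periodic function on an interval. -/
theorem tendsto_intervalIntegral_mul_comp_periodic {g : ℝ → ℝ} (hg : Continuous g) {T : ℝ}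
    (hT : 0 < T) (hper : Function.Periodic g T) {c : ℕ → ℝ} (hc : Tendsto c atTop atTop)
    {f : ℝ → ℝ} {x : ℝ} (hx : 0 ≤ x) (hf : ContinuousOn f (Set.Icc 0 x)) :
    Tendsto (fun m => ∫ θ in (0 : ℝ)..x, f θ * g (c m * θ)) atTop
      (𝓝 ((T⁻¹ * ∫ t in (0 : ℝ)..T, g t) * ∫ θ in (0 : ℝ)..x, f θ)) := by
  obtain ⟨hFm, C, hFC⟩ := measurable_and_bounded_indicator_Icc hx hf
  have hR : ∀ θ, x < |θ| → (Set.Icc 0 x).indicator f θ = 0 := by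
    intro θ hθ
    refine Set.indicator_of_notMem (fun h => ?_) _
    rw [abs_of_nonneg h.1] at hθ
    linarith [h.2]
  have hcont : ∀ᵐ θ, ContinuousAt ((Set.Icc 0 x).indicator f) θ := by
    have hnull : volume ({0, x} : Set ℝ) = 0 := (Set.toFinite _).measure_zero _
    filter_upwards [compl_mem_ae_iff.2 hnull] with θ hθ
    have hθ0 : θ ≠ 0 := fun h => hθ (by simp [h])
    have hθx : θ ≠ x := fun h => hθ (by simp [h])
    by_cases hm : θ ∈ Set.Icc 0 x
    · have hn : Set.Icc 0 x ∈ 𝓝 θ :=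
        Icc_mem_nhds (lt_of_le_of_ne hm.1 hθ0.symm) (lt_of_le_of_ne hm.2 hθx)
      refine (hf.continuousAt hn).congr ?_
      filter_upwards [hn] with y hy
      rw [Set.indicator_of_mem hy]
    · have hn : (Set.Icc 0 x)ᶜ ∈ 𝓝 θ := isClosed_Icc.isOpen_compl.mem_nhds hm
      refine (continuousAt_const (y := (0 : ℝ))).congr ?_
      filter_upwards [hn] with y hy
      rw [Set.indicator_of_notMem hy]
  have key := tendsto_integral_mul_comp_periodic hg hT hper hc hFm hFC hR hcont
  have hI : ∀ k : ℝ → ℝ, ∫ θ in (0 : ℝ)..x, f θ * k θ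
      = ∫ θ, (Set.Icc 0 x).indicator f θ * k θ := by
    intro k
    have : ∀ θ, (Set.Icc 0 x).indicator f θ * k θ
        = (Set.Icc 0 x).indicator (fun θ => f θ * k θ) θ := fun θ => by
      rw [Set.indicator_mul_left]
    simp only [this]
    rw [integral_indicator measurableSet_Icc, integral_Icc_eq_integral_Ioc,
      intervalIntegral.integral_of_le hx]
  have hI1 := hI fun _ => 1
  simp only [mul_one] at hI1
  simpa only [hI, hI1] using key

end Fejer

/-! ### Oscillation of the density -/

section Oscillation

theorem sin_two_mul_ne_zero {φ : ℝ} (hφ : φ ∈ Set.Icc 0 (2 * Real.pi))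
    (hφ' : φ ∉ ({0, Real.pi / 2, Real.pi, 3 * Real.pi / 2, 2 * Real.pi} : Set ℝ)) :
    Real.sin (2 * φ) ≠ 0 := by
  intro h
  obtain ⟨n, hn⟩ := Real.sin_eq_zero_iff.1 h
  have hpi := Real.pi_pos
  have h0 : (-1 : ℝ) < n := by
    by_contra hc
    push Not at hc
    nlinarith [hφ.1]
  have h5 : (n : ℝ) < 5 := by
    by_contra hc
    push Not at hc
    nlinarith [hφ.2]
  have h0' : -1 < n := by exact_mod_cast h0
  have h5' : n < 5 := by exact_mod_cast h5
  refine hφ' ?_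
  simp only [Set.mem_insert_iff, Set.mem_singleton_iff]
  have hcases : n = 0 ∨ n = 1 ∨ n = 2 ∨ n = 3 ∨ n = 4 := by omega
  rcases hcases with rfl | rfl | rfl | rfl | rfl
  · left; push_cast at hn; linarith
  · right; left; push_cast at hn; linarith
  · right; right; left; push_cast at hn; linarith
  · right; right; right; left; push_cast at hn; linarith
  · right; right; right; right; push_cast at hn; linarith

/-- Along the odd multiples of `φ`, a convergent cosine has limit `0` by the sum formula; then the
addition formula forces the sine to tend to `0` as well, against `cos² + sin² = 1`. -/
theorem not_tendsto_cos_odd_mul {φ : ℝ} (hφ : Real.sin (2 * φ) ≠ 0) (c : ℝ) :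
    ¬ Tendsto (fun m : ℕ => Real.cos ((2 * m + 1) * φ)) atTop (𝓝 c) := by
  intro h
  have h1 := h.comp (tendsto_add_atTop_nat 1)
  have h2 := h.comp (tendsto_add_atTop_nat 2)
  have hsum : (fun m : ℕ => Real.cos ((2 * (m + 2 : ℕ) + 1) * φ) + Real.cos ((2 * m + 1) * φ))
      = fun m : ℕ => 2 * Real.cos (2 * φ) * Real.cos ((2 * (m + 1 : ℕ) + 1) * φ) := by
    funext m
    rw [show (2 * ((m + 2 : ℕ) : ℝ) + 1) * φ = (2 * ((m + 1 : ℕ) : ℝ) + 1) * φ + 2 * φ by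
      push_cast; ring, show (2 * (m : ℝ) + 1) * φ = (2 * ((m + 1 : ℕ) : ℝ) + 1) * φ - 2 * φ by
      push_cast; ring, Real.cos_add, Real.cos_sub]
    ring
  have h3 : c + c = 2 * Real.cos (2 * φ) * c := by
    refine tendsto_nhds_unique (h2.add h) ?_
    have := h1.const_mul (2 * Real.cos (2 * φ))
    refine this.congr fun m => ?_
    exact (congrFun hsum m).symm
  have hcos : Real.cos (2 * φ) ≠ 1 := by
    intro h4
    have := Real.sin_sq_add_cos_sq (2 * φ)
    rw [h4] at this
    exact hφ (pow_eq_zero_iff two_ne_zero |>.1 (by linarith))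
  have hc0 : c = 0 := by
    have : (1 - Real.cos (2 * φ)) * c = 0 := by linarith
    exact (mul_eq_zero.1 this).resolve_left (sub_ne_zero.2 hcos.symm)
  subst hc0
  have hs : Tendsto (fun m : ℕ => Real.sin ((2 * m + 1) * φ)) atTop (𝓝 0) := by
    have h5 := ((h.mul_const (Real.cos (2 * φ))).sub h1).div_const (Real.sin (2 * φ))
    simp only [zero_mul, sub_zero, zero_div] at h5
    refine h5.congr fun m => ?_
    simp only [Function.comp]
    rw [show (2 * ((m + 1 : ℕ) : ℝ) + 1) * φ = (2 * (m : ℝ) + 1) * φ + 2 * φ by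
      push_cast; ring, Real.cos_add]
    field_simp
    ring
  have h6 := (hs.pow 2).add (h.pow 2)
  simp only [Real.sin_sq_add_cos_sq] at h6
  have := tendsto_nhds_unique h6 tendsto_const_nhds
  norm_num at this

variable {V q : ℕ → ℝ} {V₀ q₀ : ℝ}

theorem tendsto_profile_sub (hV₀ : 0 < V₀) (hV : Tendsto V atTop (𝓝 V₀))
    (hq : Tendsto q atTop (𝓝 q₀)) {ε : ℝ} (hε : 0 < ε) :
    ∀ᶠ m in atTop, ∀ y ∈ Set.Icc (-1 : ℝ) 1, |profile (V m) (q m) y - profile V₀ q₀ y| < ε := by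
  let f : ℝ × ℝ → Set.Icc (-1 : ℝ) 1 → ℝ := fun p y => profile p.1 p.2 y
  have hU : {p : ℝ × ℝ | 0 < p.1} ∈ 𝓝 (V₀, q₀) :=
    (isOpen_lt continuous_const continuous_fst).mem_nhds hV₀
  have hf : ContinuousOn (Function.HasUncurry.uncurry f)
      ({p : ℝ × ℝ | 0 < p.1} ×ˢ Set.univ) :=
    continuousOn_profile.comp (f := fun z : (ℝ × ℝ) × Set.Icc (-1 : ℝ) 1 => (z.1, (z.2 : ℝ)))
      (by fun_prop) fun z hz => hz.1
  have h1 := ContinuousOn.tendstoUniformly hU hf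
  have h2 := Metric.tendstoUniformly_iff.1 h1 ε hε
  have h3 : Tendsto (fun m => (V m, q m)) atTop (𝓝 (V₀, q₀)) := hV.prodMk_nhds hq
  filter_upwards [h3.eventually h2] with m hm y hy
  have := hm ⟨y, hy⟩
  rw [dist_comm, Real.dist_eq] at this
  exact this

/-- The profile along odd multiples of `φ/2` has no limit. -/
theorem not_tendsto_profile (hV₀ : 0 < V₀) (hV : Tendsto V atTop (𝓝 V₀))
    (hq : Tendsto q atTop (𝓝 q₀)) {φ : ℝ} (hφ : Real.sin (2 * φ) ≠ 0) :
    ¬ ∃ L : EReal, Tendsto (fun m : ℕ =>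
      ((profile (V m) (q m) (Real.sin ((2 * m + 1) / 2 * φ)) : ℝ) : EReal)) atTop (𝓝 L) := by
  rintro ⟨L, hL⟩
  let y : ℕ → Set.Icc (0 : ℝ) 1 := fun m =>
    ⟨|Real.sin ((2 * m + 1) / 2 * φ)|, abs_nonneg _, Real.abs_sin_le_one _⟩
  have hy : ∀ m : ℕ, profile V₀ q₀ (Real.sin ((2 * m + 1) / 2 * φ)) = profile V₀ q₀ (y m) := by
    intro m
    rcases abs_choice (Real.sin ((2 * m + 1) / 2 * φ)) with h | h
    · simp only [y, h]
    · simp only [y, h, profile_neg]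
  have hdiff : Tendsto (fun m : ℕ => profile (V m) (q m) (Real.sin ((2 * m + 1) / 2 * φ))
      - profile V₀ q₀ (y m)) atTop (𝓝 0) := by
    rw [Metric.tendsto_nhds]
    intro ε hε
    filter_upwards [tendsto_profile_sub hV₀ hV hq hε] with m hm
    rw [Real.dist_eq, sub_zero, ← hy]
    exact hm _ ⟨Real.neg_one_le_sin _, Real.sin_le_one _⟩
  have hPc : Continuous fun t : Set.Icc (0 : ℝ) 1 => profile V₀ q₀ t :=
    (continuous_profile hV₀ q₀).comp continuous_subtype_val
  have hemb : IsClosedEmbedding fun t : Set.Icc (0 : ℝ) 1 => profile V₀ q₀ t :=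
    hPc.isClosedEmbedding fun s t hst =>
      Subtype.ext ((strictMonoOn_profile hV₀ q₀).injOn s.2.1 t.2.1 hst)
  -- the limit is finite because the profile is bounded
  obtain ⟨B, hB⟩ := (isCompact_range hPc).isBounded.exists_norm_le
  have hbd : ∀ᶠ m : ℕ in atTop, |profile (V m) (q m) (Real.sin ((2 * m + 1) / 2 * φ))| ≤ B + 1 := by
    filter_upwards [Metric.tendsto_nhds.1 hdiff 1 one_pos] with m hm
    rw [Real.dist_eq, sub_zero] at hm
    have h1 := hB _ ⟨y m, rfl⟩
    rw [Real.norm_eq_abs] at h1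
    have h2 := abs_sub_abs_le_abs_sub (profile (V m) (q m) (Real.sin ((2 * m + 1) / 2 * φ)))
      (profile V₀ q₀ (y m))
    simp only at h1
    linarith
  have hle : L ≤ ((B + 1 : ℝ) : EReal) := le_of_tendsto hL (hbd.mono fun m hm =>
    EReal.coe_le_coe_iff.2 (abs_le.1 hm).2)
  have hge : ((-(B + 1) : ℝ) : EReal) ≤ L := ge_of_tendsto hL (hbd.mono fun m hm =>
    EReal.coe_le_coe_iff.2 (abs_le.1 hm).1)
  lift L to ℝ using ⟨ne_top_of_le_ne_top (EReal.coe_ne_top _) hle,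
    ne_bot_of_le_ne_bot (EReal.coe_ne_bot _) hge⟩
  have hL' := EReal.tendsto_coe.1 hL
  have hP : Tendsto (fun m => profile V₀ q₀ (y m)) atTop (𝓝 L) := by
    have := hL'.sub hdiff
    simpa using this
  obtain ⟨u, hu⟩ : L ∈ Set.range fun t : Set.Icc (0 : ℝ) 1 => profile V₀ q₀ t :=
    hemb.isClosed_range.mem_of_tendsto hP (Eventually.of_forall fun m => ⟨y m, rfl⟩)
  have hyu : Tendsto y atTop (𝓝 u) := by
    rw [hemb.isEmbedding.tendsto_nhds_iff]
    rw [← hu] at hP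
    exact hP
  have hcos := (((continuous_subtype_val.tendsto u).comp hyu).pow 2).const_mul 2
  refine not_tendsto_cos_odd_mul hφ (1 - 2 * (u : ℝ) ^ 2) ?_
  refine (hcos.const_sub 1).congr fun m => ?_
  simp only [Function.comp, y, sq_abs]
  rw [show (2 * (m : ℝ) + 1) * φ = 2 * ((2 * m + 1) / 2 * φ) by ring, Real.cos_two_mul,
    Real.cos_sq']
  ring

/-- The oscillating profiles average out to the uniform density `1 / (2π)`. -/
theorem tendsto_integral_mul_profile (hV₀ : 0 < V₀) (hV : Tendsto V atTop (𝓝 V₀))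
    (hq : Tendsto q atTop (𝓝 (1 / 2))) (hV0 : ∀ᶠ m in atTop, 0 < V m) {f : ℝ → ℝ} {x : ℝ}
    (hx : 0 ≤ x) (hf : ContinuousOn f (Set.Icc 0 x)) :
    Tendsto (fun m : ℕ => ∫ θ in (0 : ℝ)..x,
      f θ * profile (V m) (q m) (Real.sin ((2 * m + 1) / 2 * θ))) atTop
      (𝓝 (1 / (2 * Real.pi) * ∫ θ in (0 : ℝ)..x, f θ)) := by
  have hpi := Real.pi_pos
  have hgc : Continuous fun t => profile V₀ (1 / 2) (Real.sin t) :=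
    (continuous_profile hV₀ _).comp Real.continuous_sin
  have hper : Function.Periodic (fun t => profile V₀ (1 / 2) (Real.sin t)) Real.pi := by
    intro t
    simp only [Real.sin_add_pi, profile_neg]
  have hc : Tendsto (fun m : ℕ => ((2 * m + 1) / 2 : ℝ)) atTop atTop := by
    refine tendsto_atTop_mono (fun m => ?_) tendsto_natCast_atTop_atTop
    linarith
  have h1 := tendsto_intervalIntegral_mul_comp_periodic hgc hpi hper hc hx hf
  rw [integral_profile_sin hV₀, show Real.pi⁻¹ * (1 / 2) = 1 / (2 * Real.pi) by field_simp] at h1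
  have hfi : IntervalIntegrable f volume 0 x := by
    refine ContinuousOn.intervalIntegrable ?_
    rwa [Set.uIcc_of_le hx]
  obtain ⟨C, hC⟩ := (isCompact_Icc (a := 0) (b := x)).exists_bound_of_continuousOn hf
  have hC0 : 0 ≤ C := (norm_nonneg _).trans (hC 0 ⟨le_rfl, hx⟩)
  have hdiff : Tendsto (fun m : ℕ => (∫ θ in (0 : ℝ)..x,
      f θ * profile (V m) (q m) (Real.sin ((2 * m + 1) / 2 * θ)))
        - ∫ θ in (0 : ℝ)..x, f θ * profile V₀ (1 / 2) (Real.sin ((2 * m + 1) / 2 * θ)))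
      atTop (𝓝 0) := by
    rw [Metric.tendsto_nhds]
    intro ε hε
    have hε' : 0 < ε / (C * x + 1) := by positivity
    filter_upwards [tendsto_profile_sub hV₀ hV hq hε', hV0] with m hm hVm
    rw [Real.dist_eq, sub_zero]
    have hi : ∀ W r : ℝ, 0 < W → IntervalIntegrable
        (fun θ => f θ * profile W r (Real.sin ((2 * m + 1) / 2 * θ))) volume 0 x := by
      intro W r hW
      refine hfi.mul_continuousOn (Continuous.continuousOn ?_)
      exact (continuous_profile hW r).comp (by fun_prop)
    rw [← intervalIntegral.integral_sub (hi _ _ hVm) (hi _ _ hV₀)]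
    have h2 := intervalIntegral.norm_integral_le_of_norm_le_const (a := 0) (b := x)
      (C := C * (ε / (C * x + 1))) (f := fun θ =>
        f θ * profile (V m) (q m) (Real.sin ((2 * m + 1) / 2 * θ))
          - f θ * profile V₀ (1 / 2) (Real.sin ((2 * m + 1) / 2 * θ))) fun θ hθ => by
        rw [Set.uIoc_of_le hx] at hθ
        rw [← mul_sub, norm_mul]
        exact mul_le_mul (hC θ ⟨hθ.1.le, hθ.2⟩)
          (hm _ ⟨Real.neg_one_le_sin _, Real.sin_le_one _⟩).le (norm_nonneg _) hC0
    rw [Real.norm_eq_abs] at h2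
    refine lt_of_le_of_lt h2 ?_
    rw [sub_zero, abs_of_nonneg hx, mul_div_assoc', div_mul_eq_mul_div, div_lt_iff₀ (by positivity)]
    nlinarith
  simpa using hdiff.add h1

end Oscillation

/-! ### Uniform convergence for slowly varying functions -/

section SlowlyVarying

theorem min_one_abs_sub_le (x y z : ℝ) :
    min 1 |x - z| ≤ min 1 |x - y| + min 1 |z - y| := by
  have h := abs_sub_le x y z
  rw [abs_sub_comm y z] at h
  rcases le_total 1 |x - y| with h1 | h1
  · rw [min_eq_left h1]
    have := le_min zero_le_one (abs_nonneg (z - y))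
    linarith [min_le_left 1 |x - z|]
  · rcases le_total 1 |z - y| with h2 | h2
    · rw [min_eq_left h2]
      have := le_min zero_le_one (abs_nonneg (x - y))
      linarith [min_le_left 1 |x - z|]
    · rw [min_eq_right h1, min_eq_right h2]
      exact (min_le_right _ _).trans h

/-- The integral version of the uniform convergence theorem, in additive form: if
`h (x + y) - h x → 0` for every `y`, then the increments over a unit interval tend to `0` uniformly.
An increment of `h` between `x` and `x + u` is compared, for each `y ∈ [1, 2]`, with the increments
from `x` and from `x + u` to `x + y`, and averaging over `y` turns pointwise convergence into
uniform convergence. -/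
theorem exists_tendsto_zero_increment_le {h : ℝ → ℝ} (hm : Measurable h)
    (hh : ∀ y, Tendsto (fun x => h (x + y) - h x) atTop (𝓝 0)) :
    ∃ A : ℝ → ℝ, Tendsto A atTop (𝓝 0) ∧
      ∀ x, ∀ u ∈ Set.Icc (0 : ℝ) 1, min 1 |h (x + u) - h x| ≤ A x + A (x + u) := by
  -- truncation at `1` provides the dominating function
  have hmeas : ∀ z x : ℝ, Measurable fun y => min 1 |h (x + y) - z| := fun z x =>
    measurable_const.min (((hm.comp (measurable_const_add x)).sub_const z).abs)
  have hint : ∀ z x a b : ℝ, IntervalIntegrable (fun y => min 1 |h (x + y) - z|) volume a b := by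
    intro z x a b
    refine (intervalIntegrable_const (c := (1 : ℝ))).mono_fun
      (hmeas z x).aestronglyMeasurable (Eventually.of_forall fun y => ?_)
    simp only [norm_one]
    rw [Real.norm_eq_abs, abs_of_nonneg (le_min zero_le_one (abs_nonneg _))]
    exact min_le_left _ _
  refine ⟨fun x => ∫ y in (0 : ℝ)..2, min 1 |h (x + y) - h x|, ?_, ?_⟩
  · suffices H : Tendsto (fun x => ∫ y in (0 : ℝ)..2, min 1 |h (x + y) - h x|) atTop
        (𝓝 (∫ _y in (0 : ℝ)..2, (0 : ℝ))) by simpa using H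
    refine intervalIntegral.tendsto_integral_filter_of_dominated_convergence (fun _ => 1)
      (Eventually.of_forall fun x => (hmeas _ x).aestronglyMeasurable)
      (Eventually.of_forall fun x => Eventually.of_forall fun y _ => ?_)
      intervalIntegrable_const (Eventually.of_forall fun y _ => ?_)
    · rw [Real.norm_eq_abs, abs_of_nonneg (le_min zero_le_one (abs_nonneg _))]
      exact min_le_left _ _
    · have := (tendsto_const_nhds (x := (1 : ℝ))).min (hh y).abs
      simpa using this
  · intro x u hu
    have h1 : ∫ _y in (1 : ℝ)..2, min 1 |h (x + u) - h x|
        ≤ ∫ y in (1 : ℝ)..2, (min 1 |h (x + y) - h x| + min 1 |h (x + y) - h (x + u)|) := by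
      refine intervalIntegral.integral_mono_on (by norm_num) intervalIntegrable_const
        ((hint _ x 1 2).add (hint _ x 1 2)) fun y _ => ?_
      have := min_one_abs_sub_le (h (x + u)) (h (x + y)) (h x)
      rw [abs_sub_comm (h (x + u)) (h (x + y)), abs_sub_comm (h x) (h (x + y))] at this
      linarith
    rw [intervalIntegral.integral_const,
      intervalIntegral.integral_add (hint _ x 1 2) (hint _ x 1 2)] at h1
    have hnn : ∀ z w : ℝ, 0 ≤ᵐ[volume.restrict (Set.Ioc (0 : ℝ) 2)]
        fun y => min 1 |h (w + y) - z| := fun z w =>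
      Eventually.of_forall fun y => le_min zero_le_one (abs_nonneg _)
    have h2 : ∫ y in (1 : ℝ)..2, min 1 |h (x + y) - h x|
        ≤ ∫ y in (0 : ℝ)..2, min 1 |h (x + y) - h x| :=
      intervalIntegral.integral_mono_interval (by norm_num) (by norm_num) le_rfl (hnn _ _)
        (hint _ _ _ _)
    have h3 : ∫ y in (1 : ℝ)..2, min 1 |h (x + y) - h (x + u)|
        = ∫ y in (1 - u)..(2 - u), min 1 |h (x + u + y) - h (x + u)| := by
      have := intervalIntegral.integral_comp_sub_right (a := 1) (b := 2)
        (fun y => min 1 |h (x + u + y) - h (x + u)|) u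
      rw [← this]
      refine intervalIntegral.integral_congr fun y _ => ?_
      congr 4
      ring
    have h4 : ∫ y in (1 - u)..(2 - u), min 1 |h (x + u + y) - h (x + u)|
        ≤ ∫ y in (0 : ℝ)..2, min 1 |h (x + u + y) - h (x + u)| :=
      intervalIntegral.integral_mono_interval (by linarith [hu.2]) (by linarith)
        (by linarith [hu.1]) (hnn _ _) (hint _ _ _ _)
    rw [smul_eq_mul, show (2 : ℝ) - 1 = 1 by norm_num, one_mul] at h1
    exact h1.trans (add_le_add h2 (h3.trans_le h4))

/-- A slowly varying function has equivalent values along functions with ratio tending to `1`. -/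
theorem IsSlowlyVarying.tendsto_div_of_tendsto_one {ℓ : ℝ → ℝ} (hℓ : IsSlowlyVarying ℓ)
    {ι : Type*} {l : Filter ι} {f g : ι → ℝ} (hf : Tendsto f l atTop)
    (hg : Tendsto (fun i => g i / f i) l (𝓝 1)) :
    Tendsto (fun i => ℓ (g i) / ℓ (f i)) l (𝓝 1) := by
  -- slow variation of `ℓ` in additive form, for `log ∘ ℓ ∘ exp`
  have hm : Measurable fun x => Real.log (ℓ (Real.exp x)) :=
    Real.measurable_log.comp (hℓ.measurable.comp
      (Real.measurable_exp.subtype_mk (h := fun x => Real.exp_pos x)))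
  have hh : ∀ y, Tendsto (fun x => Real.log (ℓ (Real.exp (x + y))) - Real.log (ℓ (Real.exp x)))
      atTop (𝓝 0) := by
    intro y
    have h1 := (((hℓ.tendsto_div (Real.exp y) (Real.exp_pos y)).comp Real.tendsto_exp_atTop).log
      one_ne_zero)
    rw [Real.log_one] at h1
    have h2 : ∀ᶠ x in atTop, 0 < ℓ (Real.exp x) :=
      Real.tendsto_exp_atTop.eventually hℓ.eventually_pos
    have h3 : ∀ᶠ x in atTop, 0 < ℓ (Real.exp (x + y)) :=
      (Real.tendsto_exp_atTop.comp (tendsto_atTop_add_const_right _ y tendsto_id)).eventually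
        hℓ.eventually_pos
    refine h1.congr' ?_
    filter_upwards [h2, h3] with x hx hx'
    have he : Real.exp y * Real.exp x = Real.exp (x + y) := by rw [Real.exp_add, mul_comm]
    simp only [Function.comp, he]
    rw [Real.log_div hx'.ne' hx.ne']
  obtain ⟨A, hA, hAh⟩ := exists_tendsto_zero_increment_le hm hh
  have hf0 : ∀ᶠ i in l, 0 < f i := hf.eventually_gt_atTop 0
  have hgtop : Tendsto g l atTop := by
    have := hf.atTop_mul_pos one_pos hg
    refine this.congr' ?_
    filter_upwards [hf0] with i hi
    field_simp
  have hg0 : ∀ᶠ i in l, 0 < g i := hgtop.eventually_gt_atTop 0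
  have hAf := hA.comp (Real.tendsto_log_atTop.comp hf)
  have hAg := hA.comp (Real.tendsto_log_atTop.comp hgtop)
  have hsum := hAf.add hAg
  rw [add_zero] at hsum
  have hlog := hg.log one_ne_zero
  rw [Real.log_one] at hlog
  have hlog1 : ∀ᶠ i in l, |Real.log (g i / f i)| < 1 := by
    have := hlog.abs
    rw [abs_zero] at this
    exact this.eventually (gt_mem_nhds one_pos)
  have hmin : Tendsto (fun i => min 1 |Real.log (ℓ (g i)) - Real.log (ℓ (f i))|) l (𝓝 0) := by
    refine squeeze_zero' (Eventually.of_forall fun i => le_min zero_le_one (abs_nonneg _)) ?_ hsum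
    filter_upwards [hf0, hg0, hlog1] with i hfi hgi hi
    simp only [Function.comp]
    rw [Real.log_div hgi.ne' hfi.ne', abs_lt] at hi
    rcases le_total (Real.log (f i)) (Real.log (g i)) with hle | hle
    · have := hAh (Real.log (f i)) (Real.log (g i) - Real.log (f i)) ⟨by linarith, by linarith⟩
      rwa [add_sub_cancel, Real.exp_log hfi, Real.exp_log hgi] at this
    · have := hAh (Real.log (g i)) (Real.log (f i) - Real.log (g i)) ⟨by linarith, by linarith⟩
      rw [add_sub_cancel, Real.exp_log hfi, Real.exp_log hgi] at this
      rw [abs_sub_comm, add_comm]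
      exact this
  have habs : Tendsto (fun i => Real.log (ℓ (g i)) - Real.log (ℓ (f i))) l (𝓝 0) := by
    rw [tendsto_zero_iff_abs_tendsto_zero]
    refine hmin.congr' ?_
    filter_upwards [hmin.eventually (gt_mem_nhds one_pos)] with i hi
    exact min_eq_right ((lt_or_ge 1 |Real.log (ℓ (g i)) - Real.log (ℓ (f i))|).elim
      (fun h => absurd hi (by rw [min_eq_left h.le]; exact lt_irrefl _)) id)
  have hexp := (Real.continuous_exp.tendsto 0).comp habs
  rw [Real.exp_zero] at hexp
  refine hexp.congr' ?_
  filter_upwards [hf.eventually hℓ.eventually_pos, hgtop.eventually hℓ.eventually_pos] with i h1 h2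
  simp only [Function.comp]
  rw [← Real.log_div h2.ne' h1.ne', Real.exp_log (div_pos h2 h1)]

/-- A slowly varying function has equivalent values along functions of the same order. -/
theorem IsSlowlyVarying.tendsto_div_of_tendsto {ℓ : ℝ → ℝ} (hℓ : IsSlowlyVarying ℓ)
    {ι : Type*} {l : Filter ι} {f g : ι → ℝ} (hf : Tendsto f l atTop) {c : ℝ} (hc : 0 < c)
    (hg : Tendsto (fun i => g i / f i) l (𝓝 c)) :
    Tendsto (fun i => ℓ (g i) / ℓ (f i)) l (𝓝 1) := by
  have h1 : Tendsto (fun i => ℓ (g i) / ℓ (c * f i)) l (𝓝 1) := by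
    refine hℓ.tendsto_div_of_tendsto_one (hf.const_mul_atTop hc) ?_
    have := hg.div_const c
    rw [div_self hc.ne'] at this
    refine this.congr fun i => ?_
    rw [div_div, mul_comm]
  have h2 := (hℓ.tendsto_div c hc).comp hf
  have h3 := h1.mul h2
  rw [one_mul] at h3
  refine h3.congr' ?_
  filter_upwards [(hf.const_mul_atTop hc).eventually hℓ.eventually_pos] with i hi
  exact div_mul_div_cancel₀ hi.ne'

/-- Regular variation of the sequence `b(k)²`, extended to a step function. -/
theorem IsSlowlyVarying.tendsto_ceil_div {ℓ b : ℝ → ℝ} (hℓ : IsSlowlyVarying ℓ) {α : ℝ}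
    (hb : ∀ x : ℝ, 0 < x → b x = x ^ α * ℓ x) {c : ℝ} (hc : 0 < c) :
    Tendsto (fun x : ℝ => b ⌈c * x⌉₊ ^ 2 / b ⌈x⌉₊ ^ 2) atTop (𝓝 (c ^ (2 * α))) := by
  have hf : Tendsto (fun x : ℝ => ((⌈x⌉₊ : ℕ) : ℝ)) atTop atTop :=
    tendsto_natCast_atTop_atTop.comp tendsto_nat_ceil_atTop
  have hg : Tendsto (fun x : ℝ => ((⌈c * x⌉₊ : ℕ) : ℝ) / (⌈x⌉₊ : ℕ)) atTop (𝓝 c) := by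
    have h1 : Tendsto (fun x : ℝ => ((⌈c * x⌉₊ : ℕ) : ℝ) / x) atTop (𝓝 c) :=
      tendsto_nat_ceil_mul_div_atTop hc.le
    have h2 : Tendsto (fun x : ℝ => ((⌈x⌉₊ : ℕ) : ℝ) / x) atTop (𝓝 1) :=
      tendsto_nat_ceil_div_atTop
    have h3 := h1.div h2 one_ne_zero
    rw [div_one] at h3
    refine h3.congr' ?_
    filter_upwards [eventually_gt_atTop 0] with x hx
    exact div_div_div_cancel_right₀ hx.ne' _ _
  have h1 := hℓ.tendsto_div_of_tendsto hf hc hg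
  have h2 : Tendsto (fun x : ℝ => (((⌈c * x⌉₊ : ℕ) : ℝ) / (⌈x⌉₊ : ℕ)) ^ α) atTop (𝓝 (c ^ α)) :=
    hg.rpow_const (Or.inl hc.ne')
  have h3 := (h2.mul h1).pow 2
  rw [mul_one, ← Real.rpow_natCast, ← Real.rpow_mul hc.le, mul_comm α] at h3
  refine (h3.congr' ?_)
  filter_upwards [eventually_gt_atTop 0] with x hx
  have p1 : (0 : ℝ) < ⌈x⌉₊ := by exact_mod_cast Nat.ceil_pos.2 hx
  have p2 : (0 : ℝ) < ⌈c * x⌉₊ := by exact_mod_cast Nat.ceil_pos.2 (mul_pos hc hx)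
  rw [hb _ p1, hb _ p2, Real.div_rpow p2.le p1.le, div_mul_div_comm, div_pow]

end SlowlyVarying

/-! ### Partial sums of regularly varying sequences -/

section StepSum

/-- The continuous interpolation `∫₀ˣ a(⌈y⌉) dy` of the partial sums `a(1) + ⋯ + a(m)`. -/
noncomputable def stepSum (a : ℕ → ℝ) (x : ℝ) : ℝ := ∫ y in (0 : ℝ)..x, a ⌈y⌉₊

variable {a : ℕ → ℝ}

theorem intervalIntegrable_comp_ceil (a : ℕ → ℝ) (c x y : ℝ) :
    IntervalIntegrable (fun t => a ⌈c * t⌉₊) volume x y := by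
  rw [intervalIntegrable_iff]
  obtain ⟨B, hB⟩ := ((isCompact_uIcc (a := x) (b := y)).image
    (continuous_const_mul c)).bddAbove
  refine Measure.integrableOn_of_bounded (M := ∑ k ∈ Finset.range (⌈B⌉₊ + 1), |a k|) (by simp)
    ((measurable_from_nat (f := a)).comp
      (Nat.measurable_ceil.comp (measurable_const_mul c))).aestronglyMeasurable ?_
  refine (ae_restrict_iff' measurableSet_uIoc).2 (Eventually.of_forall fun t ht => ?_)
  have h1 : c * t ≤ B := hB ⟨t, Set.uIoc_subset_uIcc ht, rfl⟩
  exact Finset.single_le_sum (f := fun k => |a k|) (fun k _ => abs_nonneg _)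
    (Finset.mem_range.2 (Nat.lt_succ_of_le (Nat.ceil_mono h1)))

theorem intervalIntegrable_ceil (a : ℕ → ℝ) (x y : ℝ) :
    IntervalIntegrable (fun t => a ⌈t⌉₊) volume x y := by
  simpa only [one_mul] using intervalIntegrable_comp_ceil a 1 x y

theorem stepSum_sub (a : ℕ → ℝ) (x y : ℝ) :
    stepSum a y - stepSum a x = ∫ t in x..y, a ⌈t⌉₊ :=
  intervalIntegral.integral_interval_sub_left (intervalIntegrable_ceil a _ _)
    (intervalIntegrable_ceil a _ _)

theorem stepSum_mono (ha : ∀ k, 0 ≤ a k) : Monotone (stepSum a) := fun x y hxy => by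
  rw [← sub_nonneg, stepSum_sub]
  exact intervalIntegral.integral_nonneg hxy fun t _ => ha _

theorem stepSum_natCast (a : ℕ → ℝ) (m : ℕ) : stepSum a m = ∑ k ∈ Finset.Icc 1 m, a k := by
  induction m with
  | zero => simp [stepSum]
  | succ m ih =>
    rw [Finset.sum_Icc_succ_top (by omega), ← ih, ← sub_eq_iff_eq_add', stepSum_sub]
    have h : ∫ t in (m : ℝ)..((m + 1 : ℕ) : ℝ), a ⌈t⌉₊
        = ∫ _t in (m : ℝ)..((m + 1 : ℕ) : ℝ), a (m + 1) := by
      refine intervalIntegral.integral_congr_ae (Eventually.of_forall fun t ht => ?_)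
      rw [Set.uIoc_of_le (by push_cast; linarith)] at ht
      congr 1
      rw [Nat.ceil_eq_iff (by omega)]
      simpa using ht
    rw [h, intervalIntegral.integral_const]
    simp

theorem stepSum_mul_sub (a : ℕ → ℝ) {c : ℝ} (hc : 0 < c) (x y : ℝ) :
    stepSum a (c * y) - stepSum a (c * x) = c * ∫ t in x..y, a ⌈c * t⌉₊ := by
  rw [stepSum_sub, intervalIntegral.integral_comp_mul_left (fun t => a ⌈t⌉₊) hc.ne', smul_eq_mul,
    mul_inv_cancel_left₀ hc.ne']

theorem stepSum_mul (a : ℕ → ℝ) {c : ℝ} (hc : 0 < c) (x : ℝ) :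
    stepSum a (c * x) = c * ∫ t in (0 : ℝ)..x, a ⌈c * t⌉₊ := by
  have := stepSum_mul_sub a hc 0 x
  rwa [mul_zero, show stepSum a 0 = 0 by simp [stepSum], sub_zero] at this

/-- If `F / G → r` and `∫ G` diverges, then `∫ F / ∫ G → r`. -/
theorem tendsto_integral_div_integral {F G : ℝ → ℝ}
    (hF : ∀ x y, IntervalIntegrable F volume x y) (hG : ∀ x y, IntervalIntegrable G volume x y)
    (hG0 : ∀ y, 0 ≤ G y) (hGpos : ∀ᶠ y in atTop, 0 < G y)
    (hI : Tendsto (fun x => ∫ y in (0 : ℝ)..x, G y) atTop atTop) {r : ℝ}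
    (h : Tendsto (fun y => F y / G y) atTop (𝓝 r)) :
    Tendsto (fun x => (∫ y in (0 : ℝ)..x, F y) / ∫ y in (0 : ℝ)..x, G y) atTop (𝓝 r) := by
  rw [Metric.tendsto_nhds]
  intro ε hε
  have h1 : ∀ᶠ y in atTop, |F y - r * G y| ≤ ε / 2 * G y := by
    filter_upwards [Metric.tendsto_nhds.1 h (ε / 2) (half_pos hε), hGpos] with y hy hGy
    rw [Real.dist_eq] at hy
    have : F y - r * G y = (F y / G y - r) * G y := by field_simp
    rw [this, abs_mul, abs_of_pos hGy]
    exact mul_le_mul_of_nonneg_right hy.le hGy.le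
  obtain ⟨X, hX⟩ := eventually_atTop.1 h1
  set X' := max X 0
  filter_upwards [eventually_ge_atTop X',
    hI.eventually_gt_atTop (2 * |∫ y in (0 : ℝ)..X', (F y - r * G y)| / ε),
    hI.eventually_gt_atTop 0] with x hx hxI hxI0
  have hD : ∀ x y, IntervalIntegrable (fun y => F y - r * G y) volume x y := fun x y =>
    (hF x y).sub ((hG x y).const_mul r)
  have h2 : (∫ y in (0 : ℝ)..x, F y) - r * ∫ y in (0 : ℝ)..x, G y
      = (∫ y in (0 : ℝ)..X', (F y - r * G y)) + ∫ y in X'..x, (F y - r * G y) := by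
    rw [intervalIntegral.integral_add_adjacent_intervals (hD _ _) (hD _ _),
      intervalIntegral.integral_sub (hF _ _) ((hG _ _).const_mul r),
      intervalIntegral.integral_const_mul]
  have h3 : |∫ y in X'..x, (F y - r * G y)| ≤ ∫ y in X'..x, ε / 2 * G y := by
    refine (Real.norm_eq_abs _).symm.trans_le (intervalIntegral.norm_integral_le_of_norm_le hx
      (Eventually.of_forall fun y hy => ?_) ((hG _ _).const_mul _))
    exact hX y ((le_max_left _ _).trans hy.1.le)
  have h4 : ∫ y in X'..x, G y ≤ ∫ y in (0 : ℝ)..x, G y :=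
    intervalIntegral.integral_mono_interval (le_max_right _ _) hx le_rfl
      (Eventually.of_forall fun y => hG0 y) (hG _ _)
  rw [intervalIntegral.integral_const_mul] at h3
  have h5 := abs_add_le (∫ y in (0 : ℝ)..X', (F y - r * G y)) (∫ y in X'..x, (F y - r * G y))
  rw [Real.dist_eq, div_sub' hxI0.ne', abs_div, abs_of_pos hxI0, div_lt_iff₀ hxI0, mul_comm _ r, h2]
  rw [div_lt_iff₀ hε] at hxI
  nlinarith

/-- The partial sums of a regularly varying sequence of index `β`, if they diverge, are regularly
varying of index `β + 1`. -/
theorem tendsto_stepSum_mul_div (ha : ∀ k, 0 ≤ a k) (hpos : ∀ᶠ k in atTop, 0 < a k) {β c : ℝ}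
    (hc : 0 < c) (hreg : Tendsto (fun x : ℝ => a ⌈c * x⌉₊ / a ⌈x⌉₊) atTop (𝓝 (c ^ β)))
    (hdiv : Tendsto (stepSum a) atTop atTop) :
    Tendsto (fun x => stepSum a (c * x) / stepSum a x) atTop (𝓝 (c ^ (β + 1))) := by
  have h := (tendsto_integral_div_integral (intervalIntegrable_comp_ceil a c)
    (intervalIntegrable_ceil a) (fun y => ha _) (tendsto_nat_ceil_atTop.eventually hpos) hdiv
    hreg).const_mul c
  rw [Real.rpow_add_one hc.ne', mul_comm (c ^ β)]
  refine h.congr fun x => ?_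
  rw [stepSum_mul a hc, mul_div_assoc]
  rfl

theorem tendsto_stepSum_atTop (ha : ∀ k, 0 ≤ a k)
    (hdiv : Tendsto (fun m => ∑ k ∈ Finset.Icc 1 m, a k) atTop atTop) :
    Tendsto (stepSum a) atTop atTop := by
  refine tendsto_atTop_atTop_of_monotone (stepSum_mono ha) fun B => ?_
  obtain ⟨m, hm⟩ := (hdiv.eventually_ge_atTop B).exists
  exact ⟨m, by rwa [stepSum_natCast]⟩

/-- Regular variation of diverging partial sums, along integers: the monotone interpolation is
squeezed between its values at `s m` and `s' m`, for `s < t < s'`. -/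
theorem tendsto_sum_Icc_div (ha : ∀ k, 0 ≤ a k) (hpos : ∀ᶠ k in atTop, 0 < a k) {β t : ℝ}
    (hreg : ∀ c : ℝ, 0 < c → Tendsto (fun x : ℝ => a ⌈c * x⌉₊ / a ⌈x⌉₊) atTop (𝓝 (c ^ β)))
    (hdiv : Tendsto (fun m => ∑ k ∈ Finset.Icc 1 m, a k) atTop atTop) (ht : 0 < t) {u : ℕ → ℕ}
    (hu : Tendsto (fun m => (u m : ℝ) / m) atTop (𝓝 t)) :
    Tendsto (fun m => (∑ k ∈ Finset.Icc 1 (u m), a k) / ∑ k ∈ Finset.Icc 1 m, a k) atTop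
      (𝓝 (t ^ (β + 1))) := by
  have hT := tendsto_stepSum_atTop ha hdiv
  have hs : ∀ s : ℝ, 0 < s → Tendsto (fun m : ℕ => stepSum a (s * m) / stepSum a m) atTop
      (𝓝 (s ^ (β + 1))) := fun s hs =>
    (tendsto_stepSum_mul_div ha hpos hs (hreg s hs) hT).comp tendsto_natCast_atTop_atTop
  have hcont : Tendsto (fun s : ℝ => s ^ (β + 1)) (𝓝 t) (𝓝 (t ^ (β + 1))) :=
    Real.continuousAt_rpow_const _ _ (Or.inl ht.ne')
  simp only [← stepSum_natCast] at hdiv ⊢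
  rw [tendsto_order]
  constructor
  · intro B hB
    have h1 : ∀ᶠ s in 𝓝[<] t, B < s ^ (β + 1) ∧ 0 < s :=
      nhdsWithin_le_nhds ((hcont.eventually (lt_mem_nhds hB)).and (lt_mem_nhds ht))
    obtain ⟨s, ⟨hs1, hs0⟩, hst⟩ := (h1.and self_mem_nhdsWithin).exists
    filter_upwards [(hs s hs0).eventually (lt_mem_nhds hs1), hu.eventually (lt_mem_nhds hst),
      hdiv.eventually_gt_atTop 0, eventually_gt_atTop 0] with m hm1 hm2 hm3 hm4
    refine hm1.trans_le (div_le_div_of_nonneg_right (stepSum_mono ha ?_) hm3.le)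
    rw [lt_div_iff₀ (by exact_mod_cast hm4)] at hm2
    exact hm2.le
  · intro B hB
    have h1 : ∀ᶠ s in 𝓝[>] t, s ^ (β + 1) < B ∧ 0 < s :=
      nhdsWithin_le_nhds ((hcont.eventually (gt_mem_nhds hB)).and (lt_mem_nhds ht))
    obtain ⟨s, ⟨hs1, hs0⟩, hst⟩ := (h1.and self_mem_nhdsWithin).exists
    filter_upwards [(hs s hs0).eventually (gt_mem_nhds hs1), hu.eventually (gt_mem_nhds hst),
      hdiv.eventually_gt_atTop 0, eventually_gt_atTop 0] with m hm1 hm2 hm3 hm4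
    refine (div_le_div_of_nonneg_right (stepSum_mono ha ?_) hm3.le).trans_lt hm1
    rw [div_lt_iff₀ (by exact_mod_cast hm4)] at hm2
    exact hm2.le

theorem two_rpow_mul_two (β : ℝ) : (2 : ℝ) * 2 ^ β = 2 ^ (β + 1) := by
  rw [Real.rpow_add_one two_ne_zero, mul_comm]

/-- A regularly varying sequence of index `> -1` is not summable: doubling the range of summation
multiplies the tails of the sums by more than `1`. -/
theorem tendsto_sum_Icc_atTop (ha : ∀ k, 0 ≤ a k) (hpos : ∀ᶠ k in atTop, 0 < a k) {β : ℝ}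
    (hβ : -1 < β) (hreg : Tendsto (fun x : ℝ => a ⌈2 * x⌉₊ / a ⌈x⌉₊) atTop (𝓝 (2 ^ β))) :
    Tendsto (fun m => ∑ k ∈ Finset.Icc 1 m, a k) atTop atTop := by
  rcases tendsto_atTop_of_monotone (stepSum_mono ha) with h | ⟨L, hL⟩
  · simpa only [Function.comp_def, stepSum_natCast] using h.comp tendsto_natCast_atTop_atTop
  exfalso
  have h2 : (1 : ℝ) / 2 < 2 ^ β := by
    have := Real.one_lt_rpow (x := 2) (z := β + 1) (by norm_num) (by linarith)
    rw [← two_rpow_mul_two] at this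
    linarith
  obtain ⟨μ, hμ, hμ'⟩ := exists_between h2
  have hev : ∀ᶠ y : ℝ in atTop, μ * a ⌈y⌉₊ ≤ a ⌈2 * y⌉₊ ∧ 0 < a ⌈y⌉₊ := by
    filter_upwards [hreg.eventually (lt_mem_nhds hμ'), tendsto_nat_ceil_atTop.eventually hpos]
      with y hy hy0
    exact ⟨((lt_div_iff₀ hy0).1 hy).le, hy0⟩
  obtain ⟨X, hX⟩ := eventually_atTop.1 (hev.and (eventually_ge_atTop 0))
  have hX0 : 0 ≤ X := (hX X le_rfl).2
  have hstep : ∀ᶠ x in atTop,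
      2 * μ * (stepSum a x - stepSum a X) ≤ stepSum a (2 * x) - stepSum a (2 * X) := by
    filter_upwards [eventually_ge_atTop X] with x hx
    rw [stepSum_mul_sub a two_pos, stepSum_sub, mul_assoc, ← intervalIntegral.integral_const_mul]
    refine mul_le_mul_of_nonneg_left (intervalIntegral.integral_mono_on hx
      ((intervalIntegrable_ceil a _ _).const_mul _) (intervalIntegrable_comp_ceil a 2 _ _)
      fun y hy => (hX y hy.1).1.1) zero_le_two
  have hlim := le_of_tendsto_of_tendsto ((hL.sub_const (stepSum a X)).const_mul (2 * μ))
    ((hL.comp (tendsto_id.const_mul_atTop two_pos)).sub_const (stepSum a (2 * X))) hstep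
  have hlt : stepSum a X < stepSum a (X + 1) := by
    rw [← sub_pos, stepSum_sub]
    exact intervalIntegral.intervalIntegral_pos_of_pos_on (intervalIntegrable_ceil a _ _)
      (fun y hy => (hX y hy.1.le).1.2) (by linarith)
  have hle := (stepSum_mono ha).ge_of_tendsto hL (X + 1)
  have hXX := stepSum_mono ha (show X ≤ 2 * X by linarith)
  nlinarith

/-- A regularly varying sequence of index `< -1` is summable: doubling the range of summation
multiplies the tails of the sums by less than `1`. -/
theorem summable_of_regularlyVarying (ha : ∀ k, 0 ≤ a k) (hpos : ∀ᶠ k in atTop, 0 < a k) {β : ℝ}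
    (hβ : β < -1) (hreg : Tendsto (fun x : ℝ => a ⌈2 * x⌉₊ / a ⌈x⌉₊) atTop (𝓝 (2 ^ β))) :
    Summable fun k => a (k + 1) := by
  have h2 : (2 : ℝ) ^ β < 1 / 2 := by
    have := Real.rpow_lt_one_of_one_lt_of_neg (x := 2) (z := β + 1) (by norm_num) (by linarith)
    rw [← two_rpow_mul_two] at this
    linarith
  obtain ⟨μ, hμ, hμ'⟩ := exists_between h2
  have hev : ∀ᶠ y : ℝ in atTop, a ⌈2 * y⌉₊ ≤ μ * a ⌈y⌉₊ := by
    filter_upwards [hreg.eventually (gt_mem_nhds hμ), tendsto_nat_ceil_atTop.eventually hpos]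
      with y hy hy0
    exact ((div_lt_iff₀ hy0).1 hy).le
  obtain ⟨X, hX⟩ := eventually_atTop.1 (hev.and (eventually_ge_atTop 0))
  have hX0 : 0 ≤ X := (hX X le_rfl).2
  have hμ0 : 0 < μ := (Real.rpow_pos_of_pos two_pos β).trans hμ
  have hTX : 0 ≤ stepSum a X := intervalIntegral.integral_nonneg hX0 fun y _ => ha _
  have hbd : ∀ x, X ≤ x → stepSum a x ≤ stepSum a (2 * X) / (1 - 2 * μ) := by
    intro x hx
    have hstep : stepSum a (2 * x) - stepSum a (2 * X)
        ≤ 2 * μ * (stepSum a x - stepSum a X) := by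
      rw [stepSum_mul_sub a two_pos, stepSum_sub, mul_assoc,
        ← intervalIntegral.integral_const_mul μ]
      exact mul_le_mul_of_nonneg_left (intervalIntegral.integral_mono_on hx
        (intervalIntegrable_comp_ceil a 2 _ _) ((intervalIntegrable_ceil a _ _).const_mul _)
        fun y hy => (hX y hy.1).1) zero_le_two
    have h2x := stepSum_mono ha (show x ≤ 2 * x by linarith)
    rw [le_div_iff₀ (by linarith)]
    nlinarith
  refine summable_of_sum_range_le (c := stepSum a (2 * X) / (1 - 2 * μ)) (fun k => ha _) fun n => ?_
  have h3 : ∑ k ∈ Finset.range n, a (k + 1) = stepSum a n := by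
    rw [stepSum_natCast, Finset.range_eq_Ico, Finset.sum_Ico_add' a 0 n 1]
    rfl
  rw [h3]
  exact (stepSum_mono ha (le_max_left _ X)).trans (hbd _ (le_max_right _ _))

end StepSum

/-! ### The second moment of the frequencies -/

section Moments

variable {a : ℕ → ℝ}

/-- Summation by parts against the squared frequencies. -/
theorem sum_mul_freq_sq (a : ℕ → ℝ) (N : ℝ) (m : ℕ) :
    ∑ k ∈ Finset.Icc 1 m, a k * (N / 2 - k) ^ 2
      = (∑ k ∈ Finset.Icc 1 m, a k) * (N / 2 - m) ^ 2
        + ∑ k ∈ Finset.Icc 1 m, (∑ j ∈ Finset.Icc 1 (k - 1), a j) * (N - 2 * (k - 1 : ℕ) - 1) := by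
  induction m with
  | zero => simp
  | succ m ih =>
    rw [Finset.sum_Icc_succ_top (by omega), ih, Finset.sum_Icc_succ_top (by omega),
      Finset.sum_Icc_succ_top (by omega), Nat.add_sub_cancel]
    push_cast
    ring

/-- The second moment of the frequencies, relative to diverging weights that vary regularly with
index `ρ - 1`. After summation by parts it is a Riemann-type integral of `t ^ ρ (1 - t) / 2`. -/
theorem tendsto_sum_mul_freq_sq_div (ha : ∀ k, 0 ≤ a k) {ρ : ℝ} (hρ : 0 ≤ ρ)
    (hdiv : Tendsto (fun m => ∑ k ∈ Finset.Icc 1 m, a k) atTop atTop)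
    (hreg : ∀ t : ℝ, 0 < t → ∀ u : ℕ → ℕ, Tendsto (fun m => (u m : ℝ) / m) atTop (𝓝 t) →
      Tendsto (fun m => (∑ k ∈ Finset.Icc 1 (u m), a k) / ∑ k ∈ Finset.Icc 1 m, a k) atTop
        (𝓝 (t ^ ρ))) :
    Tendsto (fun m : ℕ => (∑ k ∈ Finset.Icc 1 m, a k * ((2 * m + 1) / 2 - k) ^ 2)
      / ((2 * m + 1) ^ 2 * ∑ k ∈ Finset.Icc 1 m, a k)) atTop
      (𝓝 (1 / (2 * ((ρ + 1) * (ρ + 2))))) := by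
  set S : ℕ → ℝ := fun m => ∑ k ∈ Finset.Icc 1 m, a k with hS
  have hSmono : Monotone S := fun i j hij =>
    Finset.sum_le_sum_of_subset_of_nonneg (Finset.Icc_subset_Icc_right hij) fun k _ _ => ha k
  have hS0 : ∀ k, 0 ≤ S k := fun k => Finset.sum_nonneg fun j _ => ha j
  have hinv : Tendsto (fun m : ℕ => 1 / (m : ℝ)) atTop (𝓝 0) :=
    tendsto_one_div_atTop_nhds_zero_nat
  -- after summation by parts the ratio is `1 / (4 n²) + (∑ₖ w m k) / n` with `n = 2m + 1`, and the
  -- sum equals `m ∫₀¹ w m ⌈m t⌉ dt`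
  let w : ℕ → ℕ → ℝ := fun m k => S (k - 1) / S m * ((2 * m - 2 * (k - 1 : ℕ)) / (2 * m + 1))
  have hint : Tendsto (fun m : ℕ => ∫ t in (0 : ℝ)..1, w m ⌈m * t⌉₊) atTop
      (𝓝 (∫ t in (0 : ℝ)..1, t ^ ρ * (1 - t))) := by
    refine intervalIntegral.tendsto_integral_filter_of_dominated_convergence (fun _ => 1)
      (Eventually.of_forall fun m => ((intervalIntegrable_comp_ceil (w m) m 0 1).def').1)
      (Eventually.of_forall fun m => Eventually.of_forall fun t ht => ?_)
      intervalIntegrable_const (Eventually.of_forall fun t ht => ?_)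
    · rw [Set.uIoc_of_le zero_le_one] at ht
      have h1 : ⌈(m : ℝ) * t⌉₊ ≤ m := Nat.ceil_le.2 (by
        nlinarith [ht.2, (m.cast_nonneg : (0 : ℝ) ≤ m)])
      have h2 : ⌈(m : ℝ) * t⌉₊ - 1 ≤ m := (Nat.sub_le _ _).trans h1
      have h3 : ((⌈(m : ℝ) * t⌉₊ - 1 : ℕ) : ℝ) ≤ m := by exact_mod_cast h2
      have h4 : (0 : ℝ) ≤ ((⌈(m : ℝ) * t⌉₊ - 1 : ℕ) : ℝ) := Nat.cast_nonneg _
      have h5 : 0 ≤ S (⌈(m : ℝ) * t⌉₊ - 1) / S m := div_nonneg (hS0 _) (hS0 _)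
      have h6 : 0 ≤ (2 * (m : ℝ) - 2 * (⌈(m : ℝ) * t⌉₊ - 1 : ℕ)) / (2 * m + 1) :=
        div_nonneg (by linarith) (by linarith)
      rw [Real.norm_eq_abs, abs_of_nonneg (mul_nonneg h5 h6)]
      refine mul_le_one₀ (div_le_one_of_le₀ (hSmono h2) (hS0 _)) h6 ?_
      rw [div_le_one (by linarith)]
      linarith
    · rw [Set.uIoc_of_le zero_le_one] at ht
      have hm : Tendsto (fun m : ℕ => ((m : ℕ) : ℝ)) atTop atTop := tendsto_natCast_atTop_atTop
      have hu : Tendsto (fun m : ℕ => ((⌈(m : ℝ) * t⌉₊ - 1 : ℕ) : ℝ) / m) atTop (𝓝 t) := by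
        have h1 := ((tendsto_nat_ceil_mul_div_atTop (R := ℝ) ht.1.le).comp hm).sub hinv
        rw [sub_zero] at h1
        refine h1.congr' ?_
        filter_upwards [eventually_gt_atTop 0] with m hm0
        have : 1 ≤ ⌈(m : ℝ) * t⌉₊ := Nat.ceil_pos.2 (mul_pos (by exact_mod_cast hm0) ht.1)
        simp only [Function.comp]
        rw [Nat.cast_sub this, mul_comm t]
        push_cast
        ring
      refine (hreg t ht.1 _ hu).mul ?_
      have h2 := (((tendsto_const_nhds (x := (2 : ℝ))).sub (hu.const_mul 2)).div
        ((tendsto_const_nhds (x := (2 : ℝ))).add hinv) (by norm_num))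
      rw [show (2 - 2 * t) / (2 + 0) = 1 - t by ring] at h2
      refine h2.congr' ?_
      filter_upwards [eventually_gt_atTop 0] with m hm0
      have : (0 : ℝ) < m := by exact_mod_cast hm0
      simp only [Pi.div_apply]
      field_simp
  have hval : ∫ t in (0 : ℝ)..1, t ^ ρ * (1 - t) = 1 / ((ρ + 1) * (ρ + 2)) := by
    have h1 : ∫ t in (0 : ℝ)..1, t ^ ρ * (1 - t) = ∫ t in (0 : ℝ)..1, (t ^ ρ - t ^ (ρ + 1)) := by
      refine intervalIntegral.integral_congr_ae (Eventually.of_forall fun t ht => ?_)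
      rw [Set.uIoc_of_le zero_le_one] at ht
      rw [Real.rpow_add_one ht.1.ne']
      ring
    rw [h1, intervalIntegral.integral_sub
      (intervalIntegral.intervalIntegrable_rpow' (by linarith))
      (intervalIntegral.intervalIntegrable_rpow' (by linarith)),
      integral_rpow (Or.inl (by linarith)), integral_rpow (Or.inl (by linarith)),
      Real.one_rpow, Real.one_rpow, Real.zero_rpow (by linarith), Real.zero_rpow (by linarith)]
    have : ρ + 1 ≠ 0 := by linarith
    have : ρ + 1 + 1 ≠ 0 := by linarith
    have : ρ + 2 ≠ 0 := by linarith
    field_simp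
    ring
  rw [hval] at hint
  have hmn : Tendsto (fun m : ℕ => (m : ℝ) / (2 * m + 1)) atTop (𝓝 (1 / 2)) := by
    have h2 := (tendsto_const_nhds (x := (1 : ℝ))).div
        ((tendsto_const_nhds (x := (2 : ℝ))).add hinv) (by norm_num)
    rw [add_zero] at h2
    refine h2.congr' ?_
    filter_upwards [eventually_gt_atTop 0] with m hm0
    have : (0 : ℝ) < m := by exact_mod_cast hm0
    simp only [Pi.div_apply]
    field_simp
  have hn : Tendsto (fun m : ℕ => (1 / (2 * (m : ℝ) + 1)) ^ 2 / 4) atTop (𝓝 0) := by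
    have h1 : Tendsto (fun m : ℕ => 2 * (m : ℝ) + 1) atTop atTop :=
      tendsto_atTop_add_const_right _ _ (tendsto_natCast_atTop_atTop.const_mul_atTop two_pos)
    have := ((tendsto_const_nhds (x := (1 : ℝ))).div_atTop h1).pow 2 |>.div_const 4
    simpa using this
  have hfin := hn.add (hmn.mul hint)
  rw [zero_add, one_div_mul_one_div] at hfin
  refine hfin.congr' ?_
  filter_upwards [hdiv.eventually_gt_atTop 0, eventually_gt_atTop 0] with m hSm hm0
  have hm : (0 : ℝ) < m := by exact_mod_cast hm0
  have h1 : (m : ℝ) * ∫ t in (0 : ℝ)..1, w m ⌈m * t⌉₊ = ∑ k ∈ Finset.Icc 1 m, w m k := by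
    rw [← stepSum_mul (w m) hm, mul_one, stepSum_natCast]
  rw [div_mul_eq_mul_div, h1, sum_mul_freq_sq]
  have h2 : ∑ k ∈ Finset.Icc 1 m, w m k = (∑ k ∈ Finset.Icc 1 m,
      (∑ j ∈ Finset.Icc 1 (k - 1), a j) * (2 * (m : ℝ) + 1 - 2 * (k - 1 : ℕ) - 1))
        / ((2 * m + 1) * S m) := by
    rw [Finset.sum_div]
    refine Finset.sum_congr rfl fun k _ => ?_
    simp only [w, hS]
    rw [div_mul_div_comm, mul_comm (∑ k ∈ Finset.Icc 1 m, a k)]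
    congr 2
    ring
  rw [h2]
  have h3 : S m ≠ 0 := hSm.ne'
  have h4 : (∑ k ∈ Finset.Icc 1 m, a k) = S m := rfl
  rw [h4]
  field_simp
  ring

/-- The second moment of the frequencies, relative to summable weights. -/
theorem tendsto_sum_mul_freq_sq_div_of_summable (ha : ∀ k, 0 ≤ a k)
    (hs : Summable fun k => a (k + 1)) :
    Tendsto (fun m : ℕ => (∑ k ∈ Finset.Icc 1 m, a k * ((2 * m + 1) / 2 - k) ^ 2)
      / (2 * (m : ℝ) + 1) ^ 2) atTop (𝓝 ((∑' k, a (k + 1)) / 4)) := by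
  have h1 : Tendsto (fun m : ℕ => 2 * (m : ℝ) + 1) atTop atTop :=
    tendsto_atTop_add_const_right _ _ (tendsto_natCast_atTop_atTop.const_mul_atTop two_pos)
  let f : ℕ → ℕ → ℝ := fun m k =>
    if k < m then a (k + 1) * (1 / 2 - (k + 1 : ℕ) / (2 * m + 1)) ^ 2 else 0
  have hf : Tendsto (fun m => ∑' k, f m k) atTop (𝓝 (∑' k, a (k + 1) * (1 / 2) ^ 2)) := by
    refine tendsto_tsum_of_dominated_convergence hs (fun k => ?_)
      (Eventually.of_forall fun m k => ?_)
    · have h2 := (((tendsto_const_nhds (x := ((k + 1 : ℕ) : ℝ))).div_atTop h1).const_sub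
        (1 / 2)).pow 2 |>.const_mul (a (k + 1))
      rw [sub_zero] at h2
      refine h2.congr' ?_
      filter_upwards [eventually_gt_atTop k] with m hm
      simp only [f, if_pos hm]
    · by_cases hk : k < m
      · simp only [f, if_pos hk]
        rw [Real.norm_eq_abs, abs_mul, abs_of_nonneg (ha _), abs_of_nonneg (sq_nonneg _)]
        refine mul_le_of_le_one_right (ha _) ?_
        have h3 : ((k + 1 : ℕ) : ℝ) ≤ m := by exact_mod_cast hk
        have h4 : ((k + 1 : ℕ) : ℝ) / (2 * m + 1) ≤ 1 := by
          rw [div_le_one (by positivity)]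
          linarith [(m.cast_nonneg : (0 : ℝ) ≤ m)]
        have h5 : 0 ≤ ((k + 1 : ℕ) : ℝ) / (2 * m + 1) := by positivity
        nlinarith
      · simp only [f, if_neg hk, norm_zero]
        exact ha _
  rw [tsum_mul_right] at hf
  rw [show (∑' k, a (k + 1)) / 4 = (∑' k, a (k + 1)) * (1 / 2) ^ 2 by ring]
  refine hf.congr fun m => ?_
  rw [tsum_eq_sum (s := Finset.range m) fun k hk => if_neg (by simpa using hk), Finset.sum_div,
    ← Finset.sum_congr (f := fun k => a (k + 1) * (1 / 2 - (k + 1 : ℕ) / (2 * m + 1)) ^ 2) rfl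
      fun k hk => ?_]
  · rw [Finset.range_eq_Ico, Finset.sum_Ico_add'
      (fun k : ℕ => a k * (1 / 2 - (k : ℝ) / (2 * m + 1)) ^ 2) 0 m 1]
    refine Finset.sum_congr rfl fun k _ => ?_
    rw [mul_div_assoc, ← div_pow, sub_div]
    congr 3
    field_simp
  · simp only [if_pos (Finset.mem_range.1 hk)]

end Moments

/-! ### Limits of the variances and of the profile -/

section VarianceLimits

theorem coe_trigVar (b : ℝ → ℝ) (v : ℝ≥0) (m : ℕ) :
    (trigVar b v m : ℝ) = (∑ k ∈ Finset.Icc 1 m, b k ^ 2) * (v / 2) := by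
  simp [trigVar, Finset.sum_mul]

theorem trigVar_pos {b : ℝ → ℝ} {v : ℝ≥0} (hv : v ≠ 0) {m : ℕ}
    (hb : ∃ k ∈ Finset.Icc 1 m, b k ≠ 0) : 0 < trigVar b v m := by
  obtain ⟨k, hk, hbk⟩ := hb
  rw [← NNReal.coe_pos, coe_trigVar]
  refine mul_pos (Finset.sum_pos' (fun j _ => sq_nonneg _) ⟨k, hk, ?_⟩)
    (div_pos (NNReal.coe_pos.2 (pos_iff_ne_zero.2 hv)) two_pos)
  exact pow_pos (abs_pos.2 hbk) 2 |>.trans_eq (sq_abs _)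

theorem coe_trigDerivVar (b : ℝ → ℝ) (v : ℝ≥0) (m : ℕ) :
    (trigDerivVar b v m : ℝ)
      = (∑ k ∈ Finset.Icc 1 m, b k ^ 2 * ((2 * m + 1) / 2 - k) ^ 2) * (v / 2) := by
  simp [trigDerivVar, Finset.sum_mul, freq, mul_pow]

theorem trigDerivVar_div_trigVar (b : ℝ → ℝ) {v : ℝ≥0} (hv : v ≠ 0) (m : ℕ) :
    (trigDerivVar b v m : ℝ) / ((2 * m + 1) ^ 2 * trigVar b v m)
      = (∑ k ∈ Finset.Icc 1 m, b k ^ 2 * ((2 * m + 1) / 2 - k) ^ 2)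
        / ((2 * m + 1) ^ 2 * ∑ k ∈ Finset.Icc 1 m, b k ^ 2) := by
  have hv' : (v : ℝ) / 2 ≠ 0 := div_ne_zero (NNReal.coe_ne_zero.2 hv) two_ne_zero
  rw [coe_trigVar, coe_trigDerivVar, ← mul_assoc, mul_div_mul_right _ _ hv']

theorem sum_Icc_one_eq_sum_range (a : ℕ → ℝ) (m : ℕ) :
    ∑ k ∈ Finset.Icc 1 m, a k = ∑ k ∈ Finset.range m, a (k + 1) := by
  rw [Finset.range_eq_Ico, Finset.sum_Ico_add' a 0 m 1]
  rfl

variable {α : ℝ} {b ℓ : ℝ → ℝ}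

theorem IsSlowlyVarying.eventually_pos_natCast (hℓ : IsSlowlyVarying ℓ)
    (hb : ∀ x : ℝ, 0 < x → b x = x ^ α * ℓ x) : ∀ᶠ k : ℕ in atTop, 0 < b k := by
  filter_upwards [tendsto_natCast_atTop_atTop.eventually hℓ.eventually_pos,
    eventually_gt_atTop 0] with k hk hk0
  have : (0 : ℝ) < k := by exact_mod_cast hk0
  rw [hb _ this]
  exact mul_pos (Real.rpow_pos_of_pos this _) hk

theorem slowSum_neg_one_eq (hb : ∀ x : ℝ, 0 < x → b x = x ^ (-1 / 2 : ℝ) * ℓ x) :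
    slowSum (-1) ℓ = ∑' k : ℕ, ENNReal.ofReal (b ((k + 1 : ℕ) : ℝ) ^ 2) := by
  refine tsum_congr fun k => ?_
  have : (0 : ℝ) < ((k + 1 : ℕ) : ℝ) := by positivity
  have h : (((k + 1 : ℕ) : ℝ) ^ (-1 / 2 : ℝ)) ^ 2 = ((k + 1 : ℕ) : ℝ) ^ (-1 : ℝ) := by
    rw [← Real.rpow_natCast, ← Real.rpow_mul this.le]
    norm_num
  rw [hb _ this, mul_pow, h]

theorem slowSum_neg_one_lt_top_iff (hb : ∀ x : ℝ, 0 < x → b x = x ^ (-1 / 2 : ℝ) * ℓ x) :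
    slowSum (-1) ℓ < ⊤ ↔ Summable fun k : ℕ => b ((k + 1 : ℕ) : ℝ) ^ 2 := by
  rw [slowSum_neg_one_eq hb, lt_top_iff_ne_top]
  refine ⟨fun h => ?_, fun h => h.tsum_ofReal_ne_top⟩
  exact (ENNReal.summable_toReal h).congr fun k => ENNReal.toReal_ofReal (sq_nonneg _)

/-- Diverging variances: the limit of the normalized ratio. -/
theorem tendsto_trigVar_of_diverges {v : ℝ≥0} (hv : v ≠ 0) (hℓ : IsSlowlyVarying ℓ)
    (hb : ∀ x : ℝ, 0 < x → b x = x ^ α * ℓ x)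
    (hα : -1 / 2 < α ∨ (α = -1 / 2 ∧ slowSum (-1) ℓ = ⊤)) :
    Tendsto (fun m => (trigVar b v m : ℝ)) atTop atTop ∧
    Tendsto (fun m : ℕ => (trigDerivVar b v m : ℝ) / ((2 * m + 1) ^ 2 * trigVar b v m)) atTop
      (𝓝 (1 / (4 * ((1 + α) * (3 + 2 * α))))) := by
  let a : ℕ → ℝ := fun k => b k ^ 2
  have ha : ∀ k, 0 ≤ a k := fun k => sq_nonneg _
  have hpos : ∀ᶠ k in atTop, 0 < a k :=
    (hℓ.eventually_pos_natCast hb).mono fun k hk => pow_pos hk 2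
  have hdiv : Tendsto (fun m => ∑ k ∈ Finset.Icc 1 m, a k) atTop atTop := by
    rcases hα with hα | ⟨rfl, htop⟩
    · exact tendsto_sum_Icc_atTop ha hpos (by linarith) (hℓ.tendsto_ceil_div hb two_pos)
    · simp only [sum_Icc_one_eq_sum_range]
      rw [← not_summable_iff_tendsto_nat_atTop_of_nonneg fun k => ha _]
      intro hs
      exact ((slowSum_neg_one_lt_top_iff hb).2 hs).ne htop
  have hα' : -1 / 2 ≤ α := hα.elim le_of_lt fun h => h.1.ge
  constructor
  · simp only [coe_trigVar]
    exact hdiv.atTop_mul_const (div_pos (NNReal.coe_pos.2 (pos_iff_ne_zero.2 hv)) two_pos)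
  · simp only [trigDerivVar_div_trigVar b hv]
    have h := tendsto_sum_mul_freq_sq_div (ρ := 2 * α + 1) ha (by linarith) hdiv fun t ht u hu =>
      tendsto_sum_Icc_div ha hpos (fun c hc => hℓ.tendsto_ceil_div hb hc) hdiv ht hu
    rwa [show 2 * ((2 * α + 1 + 1) * (2 * α + 1 + 2)) = 4 * ((1 + α) * (3 + 2 * α)) by ring] at h

/-- Converging variances: almost all of the weight is on frequencies close to `(2m+1)/2`. -/
theorem tendsto_trigVar_of_converges {v : ℝ≥0} (hv : v ≠ 0) (hℓ : IsSlowlyVarying ℓ)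
    (hb : ∀ x : ℝ, 0 < x → b x = x ^ α * ℓ x)
    (hα : α < -1 / 2 ∨ (α = -1 / 2 ∧ slowSum (-1) ℓ < ⊤)) :
    ∃ V₀ : ℝ, 0 < V₀ ∧ Tendsto (fun m => (trigVar b v m : ℝ)) atTop (𝓝 V₀) ∧
    Tendsto (fun m : ℕ => (trigDerivVar b v m : ℝ) / ((2 * m + 1) ^ 2 * trigVar b v m)) atTop
      (𝓝 (1 / 4)) := by
  let a : ℕ → ℝ := fun k => b k ^ 2
  have ha : ∀ k, 0 ≤ a k := fun k => sq_nonneg _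
  have hpos : ∀ᶠ k in atTop, 0 < a k :=
    (hℓ.eventually_pos_natCast hb).mono fun k hk => pow_pos hk 2
  have hs : Summable fun k => a (k + 1) := by
    rcases hα with hα | ⟨rfl, htop⟩
    · exact summable_of_regularlyVarying ha hpos (by linarith) (hℓ.tendsto_ceil_div hb two_pos)
    · exact (slowSum_neg_one_lt_top_iff hb).1 htop
  have hA : 0 < ∑' k, a (k + 1) := by
    obtain ⟨k, hk⟩ := ((tendsto_add_atTop_nat 1).eventually hpos).exists
    exact hs.tsum_pos (fun k => ha _) k hk
  have hv' : 0 < (v : ℝ) / 2 := div_pos (NNReal.coe_pos.2 (pos_iff_ne_zero.2 hv)) two_pos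
  have hS : Tendsto (fun m => ∑ k ∈ Finset.Icc 1 m, a k) atTop (𝓝 (∑' k, a (k + 1))) := by
    simp only [sum_Icc_one_eq_sum_range]
    exact hs.hasSum.tendsto_sum_nat
  refine ⟨(∑' k, a (k + 1)) * (v / 2), mul_pos hA hv', ?_, ?_⟩
  · simp only [coe_trigVar]
    exact hS.mul_const _
  · simp only [trigDerivVar_div_trigVar b hv]
    have h := (tendsto_sum_mul_freq_sq_div_of_summable ha hs).div hS hA.ne'
    rw [div_div, mul_comm (4 : ℝ), ← div_div, div_self hA.ne'] at h
    refine h.congr fun m => ?_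
    rw [Pi.div_apply, div_div]

end VarianceLimits

/-- With diverging variances the profile flattens to the constant `E|qZ| / √(2π) = q / π`. -/
theorem tendsto_profile_of_tendsto_atTop {V q y : ℕ → ℝ} {q₀ : ℝ} (hV : Tendsto V atTop atTop)
    (hq : Tendsto q atTop (𝓝 q₀)) (hq₀ : 0 ≤ q₀) (hy : ∀ m, |y m| ≤ 1) :
    Tendsto (fun m => profile (V m) (q m) (y m)) atTop (𝓝 (q₀ / Real.pi)) := by
  have hpi := Real.pi_pos
  have h1 : Tendsto (fun m => -(1 - y m ^ 2) / (2 * V m)) atTop (𝓝 0) := by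
    refine tendsto_bdd_div_atTop_nhds_zero (b := -1) (B := 0)
      (Eventually.of_forall fun m => ?_) (Eventually.of_forall fun m => ?_)
      (hV.const_mul_atTop two_pos)
    · nlinarith [sq_nonneg (y m)]
    · have := (sq_le_one_iff_abs_le_one (y m)).2 (hy m)
      linarith
  have h2 : Tendsto (fun m => y m / (2 * Real.sqrt (V m))) atTop (𝓝 0) :=
    tendsto_bdd_div_atTop_nhds_zero (b := -1) (B := 1)
      (Eventually.of_forall fun m => (abs_le.1 (hy m)).1)
      (Eventually.of_forall fun m => (abs_le.1 (hy m)).2)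
      ((Real.tendsto_sqrt_atTop.comp hV).const_mul_atTop two_pos)
  have h3 := (continuous_meanAbs.tendsto (0, q₀)).comp (h2.prodMk_nhds hq)
  have h4 := ((h1.rexp).const_mul (Real.sqrt (2 * Real.pi))⁻¹).mul h3
  have h5 : meanAbs 0 q₀ = q₀ * Real.sqrt (2 / Real.pi) := by
    rw [← meanAbs_zero_one]
    have := meanAbs_mul q₀ 0 1
    rwa [mul_zero, mul_one, abs_of_nonneg hq₀] at this
  rw [Real.exp_zero, mul_one, h5] at h4
  have h9 : q₀ / Real.pi = (Real.sqrt (2 * Real.pi))⁻¹ * (q₀ * Real.sqrt (2 / Real.pi)) := by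
    rw [Real.sqrt_mul (by norm_num), Real.sqrt_div (by norm_num)]
    have h6 : Real.sqrt 2 ≠ 0 := by positivity
    have h7 : Real.sqrt Real.pi ≠ 0 := by positivity
    have h8 : Real.sqrt Real.pi ^ 2 = Real.pi := Real.sq_sqrt hpi.le
    field_simp
    rw [h8]
  rw [h9]
  exact h4

/-! ### Zeros of random self-inversive polynomials -/

theorem theorem4p5 {Ω : Type*} [MeasurableSpace Ω] (P : Measure Ω) [IsProbabilityMeasure P]
    (ξ : ℕ → Ω → ℂ) (σ : ℝ≥0) (hσ : 0 < σ)
    (hindep : iIndepFun ξ P) (hlaw : ∀ k, HasLaw (ξ k) (isotropicGaussian (σ ^ 2)) P)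
    (α : ℝ) (b ℓ : ℝ → ℝ) (hℓ : IsSlowlyVarying ℓ) (hb : ∀ x : ℝ, 0 < x → b x = x ^ α * ℓ x) :
    -- the expected numbers of zeros on arcs are well defined
    (∀ m : ℕ, ∀ x ∈ Set.Icc 0 (2 * Real.pi), Integrable
      (fun ω => (zeroCount (selfInversivePoly b (fun k => ξ k ω) m) (unitArc x) : ℝ)) P) ∧
    -- the densities exist
    (∀ m : ℕ, (∃ k ∈ Finset.Icc 1 m, b k ≠ 0) →
      DifferentiableOn ℝ (expectedArcCount P b ξ m) (Set.Icc 0 (2 * Real.pi))) ∧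
    -- (i)
    ((-1 / 2 < α ∨ (α = -1 / 2 ∧ slowSum (-1) ℓ = ⊤)) →
      ∀ φ ∈ Set.Icc 0 (2 * Real.pi),
        Tendsto (fun m : ℕ => zeroDensity P b ξ m φ / (2 * (m : ℝ) + 1)) atTop
          (𝓝 (1 / (2 * Real.pi) * (1 / Real.sqrt ((1 + α) * (3 + 2 * α)))))) ∧
    -- (ii)
    ((α < -1 / 2 ∨ (α = -1 / 2 ∧ slowSum (-1) ℓ < ⊤)) →
      (∀ φ ∈ Set.Icc 0 (2 * Real.pi),
        φ ∉ ({0, Real.pi / 2, Real.pi, 3 * Real.pi / 2, 2 * Real.pi} : Set ℝ) →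
        ¬ ∃ L : EReal, Tendsto
          (fun m : ℕ => ((zeroDensity P b ξ m φ / (2 * (m : ℝ) + 1) : ℝ) : EReal)) atTop (𝓝 L)) ∧
      (∀ x ∈ Set.Icc 0 (2 * Real.pi),
        Tendsto (fun m : ℕ => expectedArcCount P b ξ m x / (2 * (m : ℝ) + 1)) atTop
          (𝓝 (x / (2 * Real.pi)))) ∧
      (∀ f : ℝ → ℝ, ContinuousOn f (Set.Icc 0 (2 * Real.pi)) →
        (∀ m : ℕ, Integrable
          (fun ω => circleZeroSum (selfInversivePoly b (fun k => ξ k ω) m) f) P) ∧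
        Tendsto
          (fun m : ℕ => (∫ ω, circleZeroSum (selfInversivePoly b (fun k => ξ k ω) m) f ∂P)
            / (2 * (m : ℝ) + 1)) atTop
          (𝓝 (1 / (2 * Real.pi) * ∫ θ in (0 : ℝ)..(2 * Real.pi), f θ)))) := by
  have hv : σ ^ 2 ≠ 0 := pow_ne_zero 2 hσ.ne'
  have hpi := Real.two_pi_pos
  have hex : ∀ᶠ m : ℕ in atTop, ∃ k ∈ Finset.Icc 1 m, b k ≠ 0 := by
    obtain ⟨k, hk, hk1⟩ := ((hℓ.eventually_pos_natCast hb).and (eventually_ge_atTop 1)).exists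
    filter_upwards [eventually_ge_atTop k] with m hm
    exact ⟨k, Finset.mem_Icc.2 ⟨hk1, hm⟩, hk.ne'⟩
  let V : ℕ → ℝ := fun m => trigVar b (σ ^ 2) m
  let q : ℕ → ℝ := fun m =>
    Real.sqrt (trigDerivVar b (σ ^ 2) m / ((2 * m + 1) ^ 2 * trigVar b (σ ^ 2) m))
  have hV0 : ∀ m : ℕ, (∃ k ∈ Finset.Icc 1 m, b k ≠ 0) → 0 < trigVar b (σ ^ 2) m :=
    fun m hm => trigVar_pos hv hm
  have hdens : ∀ φ ∈ Set.Icc 0 (2 * Real.pi), ∀ᶠ m : ℕ in atTop,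
      profile (V m) (q m) (Real.sin ((2 * m + 1) / 2 * φ))
        = zeroDensity P b ξ m φ / (2 * (m : ℝ) + 1) := by
    intro φ hφ
    filter_upwards [hex] with m hm
    rw [zeroDensity_eq_arcDensity hindep hlaw hv hm hφ, arcDensity_div_eq_profile (hV0 m hm)]
  refine ⟨fun m x hx => ?_, fun m hm φ hφ =>
    (hasDerivWithinAt_expectedArcCount hindep hlaw hv hm hφ).differentiableWithinAt,
    fun hα φ hφ => ?_, fun hα => ?_⟩
  · simp only [zeroCount_unitArc _ hx]
    exact integrable_circleZeroSum_of_hasLaw hindep hlaw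
      (measurable_one.indicator measurableSet_Icc) (abs_indicator_one_le _)
  · obtain ⟨hV, hr⟩ := tendsto_trigVar_of_diverges hv hℓ hb hα
    have hlim := tendsto_profile_of_tendsto_atTop hV hr.sqrt (Real.sqrt_nonneg _)
      (y := fun m : ℕ => Real.sin ((2 * m + 1) / 2 * φ)) fun m => Real.abs_sin_le_one _
    have hval : Real.sqrt (1 / (4 * ((1 + α) * (3 + 2 * α)))) / Real.pi
        = 1 / (2 * Real.pi) * (1 / Real.sqrt ((1 + α) * (3 + 2 * α))) := by
      rw [Real.sqrt_div zero_le_one, Real.sqrt_one, Real.sqrt_mul (by norm_num),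
        show (4 : ℝ) = 2 ^ 2 by norm_num, Real.sqrt_sq zero_le_two]
      ring
    rw [hval] at hlim
    exact hlim.congr' (hdens φ hφ)
  · obtain ⟨V₀, hV₀, hV, hr⟩ := tendsto_trigVar_of_converges hv hℓ hb hα
    have hq : Tendsto q atTop (𝓝 (1 / 2)) := by
      have := hr.sqrt
      rwa [show (1 / 4 : ℝ) = (1 / 2) ^ 2 by norm_num, Real.sqrt_sq (by norm_num)] at this
    have hVpos : ∀ᶠ m in atTop, 0 < V m := hex.mono fun m hm => hV0 m hm
    have hdiv : ∀ m : ℕ, (∃ k ∈ Finset.Icc 1 m, b k ≠ 0) → ∀ (f : ℝ → ℝ) (x : ℝ),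
        ∫ θ in (0 : ℝ)..x, f θ * profile (V m) (q m) (Real.sin ((2 * m + 1) / 2 * θ))
          = (∫ θ in (0 : ℝ)..x, f θ * arcDensity b (σ ^ 2) m θ) / (2 * (m : ℝ) + 1) := by
      intro m hm f x
      rw [← intervalIntegral.integral_div]
      refine intervalIntegral.integral_congr fun θ _ => ?_
      simp only [mul_div_assoc, arcDensity_div_eq_profile (hV0 m hm), V, q]
    refine ⟨fun φ hφ hφ' ⟨L, hL⟩ => ?_, fun x hx => ?_, fun f hf => ?_⟩
    · refine not_tendsto_profile hV₀ hV hq (sin_two_mul_ne_zero hφ hφ') ⟨L, hL.congr' ?_⟩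
      filter_upwards [hdens φ hφ] with m hm
      rw [hm]
    · have h := tendsto_integral_mul_profile (f := fun _ => 1) hV₀ hV hq hVpos hx.1
        continuousOn_const
      rw [intervalIntegral.integral_const, sub_zero, smul_eq_mul, mul_one, one_div_mul_eq_div] at h
      refine h.congr' ?_
      filter_upwards [hex] with m hm
      rw [hdiv m hm, expectedArcCount_eq_integral hindep hlaw hv hm hx]
      simp only [one_mul]
    · -- values of `f` outside `[0, 2π]` play no role, so `f` may be cut off there
      obtain ⟨hfm, C, hC⟩ := measurable_and_bounded_indicator_Icc hpi.le hf
      have hsum : ∀ p, circleZeroSum p f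
          = circleZeroSum p ((Set.Icc 0 (2 * Real.pi)).indicator f) := fun p =>
        circleZeroSum_congr p fun θ hθ =>
          (Set.indicator_of_mem (Set.Ico_subset_Icc_self hθ) f).symm
      simp only [hsum]
      refine ⟨fun m => integrable_circleZeroSum_of_hasLaw hindep hlaw hfm hC, ?_⟩
      refine (tendsto_integral_mul_profile hV₀ hV hq hVpos hpi.le hf).congr' ?_
      filter_upwards [hex] with m hm
      rw [hdiv m hm, integral_circleZeroSum_of_hasLaw hindep hlaw hv hm hfm hC]
      congr 1
      refine intervalIntegral.integral_congr fun θ hθ => ?_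
      rw [Set.uIcc_of_le hpi.le] at hθ
      simp only [Set.indicator_of_mem hθ]
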